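/- **Setting.** Differential dynamic logic (dL) has terms built from variables, rational constants, $+,-,\cdot,/$, rational powers and differentials; formulas built from comparisons, the propositional connectives, $\forall x,\exists x$, $[\alpha]\phi$ and $\langle\alpha\rangle\phi$; and hybrid programs $x:=\theta$, $x:=*$, $?\psi$, $\alpha;\beta$, $\alpha\cup\beta$, $\alpha^*$ and $\{x'=\theta\,\&\,Q\}$ (systems of equations allowed), with the usual denotational semantics: a state maps variables to reals, a program denotes a transition relation on states, and an ODE runs along its unique solution, inside $Q$, for some duration $\ge 0$. The nominal logic dL$_h$ has in addition an atomic formula $t$ for each state name $t$. An interpretation assigns states to some of the names, and $t$ is true in a state $\omega$ iff the interpretation assigns $\omega$ to $t$. A dynamic trace $\eta$ is a nonempty list of states, beginning with a state, interleaved with state names. The interpretation $\mathrm{interp}(\eta)$ maps each name $t$ that occurs in $\eta$ to the last state of the longest prefix of $\eta$ that precedes an occurrence of $t$; other names are true nowhere. A context $\Gamma$ is a list of (possibly named) assumptions, which are dL formulas, and of abbreviations and functional abbreviations. A static trace $H$ is a list of records: an assignment $x:=\theta$ done by substitution, an assignment $x:=\theta$ done by an equation with the old value of $x$ in a ghost variable,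 a nondeterministic assignment with the old value in a ghost variable, or a state name. Kaisar's checking judgment $\Gamma;H\vdash \mathrm{SP}:\Delta\leadsto H'$ says that the structured proof $\mathrm{SP}$ checks for the sequent $\Gamma\vdash\Delta$ of dL and transforms $H$ into $H'$. It is defined inductively by the rules of the calculus Kaisar: *let* and functional *let*; *note* (forward chaining from facts by pattern selection, modus ponens and instantiation); *have*; *show* (by identity, by real arithmetic, or by sound automation); *state* $t$ (which appends $t$ to $H$); *focus* on an assumption or a goal; *assume* and *case* for propositional goals and tests; *assign* for boxes and diamonds, by substitution if admissible and else by an equation with a fresh ghost; *case* for $\cup$, for $[\alpha](\phi\wedge\psi)$ and for unfolding $\alpha^*$; *after–have–then* composition; *inv*/*finally* for loops and for ODEs (differential invariants, under which earlier invariants are available); differential *ghost* (linear in the ghost); *solve*; convergence for $\langle\alpha^*\rangle$; and the implicit conversions $[\alpha;\beta]\phi\equiv[\alpha][\beta]\phi$, $\langle\alpha;\beta\rangle\phi\equiv\langle\alpha\rangle\langle\beta\rangle\phi$, $\psi\to\phi\equiv[?\psi]\phi$, $\forall x\,\phi\equiv[x:=*]\phi$, $\exists x\,\phi\equiv\langle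 x:=*\rangle\phi$, and pushing negations inwards. Expressions written in a proof may contain abbreviations and nominal terms $t(\theta)$, which are expanded with the help of $\Gamma$ and $H$. Nominalization adds to a program $\alpha$ a test for each named state on the main path of a proof. Up to reassociation of $;$, with the trivial test as the empty program, it is defined by $$\begin{aligned} \mathrm{nom}(\alpha,\textbf{state }t\ \mathrm{SP})&=\;?t;\ \mathrm{nom}(\alpha,\mathrm{SP})\\ \mathrm{nom}(?\phi;\alpha,\textbf{assume}\ldots\mathrm{SP})&=\;?\phi;\ \mathrm{nom}(\alpha,\mathrm{SP})\\ \mathrm{nom}(x:=\theta;\alpha,\textbf{assign}\ldots\mathrm{SP})&=x:=\theta;\ \mathrm{nom}(\alpha,\mathrm{SP}), \text{ and likewise for } x:=*\\ \mathrm{nom}(\{x'=\theta\,\&\,Q\};\alpha,\textbf{solve}\ldots\mathrm{SP})&=\{x'=\theta\,\&\,Q\};\ \mathrm{nom}(\alpha,\mathrm{SP})\\ \mathrm{nom}(\beta;\alpha,\textbf{finally }\mathrm{SP})&=\beta;\ \mathrm{nom}(\alpha,\mathrm{SP})\ \text{ if } \beta \text{ is a loop or an ODE}\\ \mathrm{nom}(\alpha;\beta,\textbf{after}\{\mathrm{SP}_1\}\textbf{have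 }\psi\textbf{ then}\{\mathrm{SP}_2\})&=\mathrm{nom}(\alpha,\mathrm{SP}_1);\ \mathrm{nom}(\beta,\mathrm{SP}_2)\\ \mathrm{nom}(\alpha,P\ \mathrm{SP})&=\mathrm{nom}(\alpha,\mathrm{SP}) \end{aligned}$$ where in the last line $P\ \mathrm{SP}$ is a *have* (with $\mathrm{SP}$ its continuation), *let*, functional *let*, *note*, *inv* or *ghost* step, and by $\mathrm{nom}(\alpha,\mathrm{SP})=\alpha$ in all other cases, in particular for *case* and *focus*. **Theorem** (nominalization is sound when applied to proofs that check). Let $\Gamma$ be a context, $H,H'$ static traces, $\mathrm{SP}$ a structured proof, $\alpha$ a hybrid program and $\phi$ a formula of dL such that $\Gamma;H\vdash\mathrm{SP}:[\alpha]\phi\leadsto H'$ checks. Then for every dynamic trace $\eta$ the dL$_h$ sequent $\Gamma\vdash[\mathrm{nom}(\alpha,\mathrm{SP})]\phi$ is valid under the interpretation $\mathrm{interp}(\eta)$: in every state in which all assumptions of $\Gamma$ are true, $[\mathrm{nom}(\alpha,\mathrm{SP})]\phi$ is true. -/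

import Mathlib

namespace Kaisar

/-! Expressions: terms, formulas, ODE systems and hybrid programs -/

inductive Kind
  | trm | fml | ode | prg

abbrev Ident := ℕ

/-- Variables. `⟨x, 0⟩` is the variable `x`, `⟨x, 1⟩` its differential variable `x'`, and so on. -/
structure Var where
  name : ℕ
  primes : ℕ
deriving DecidableEq

def Var.prime (x : Var) : Var := ⟨x.name, x.primes + 1⟩

inductive Cmp
  | lt | le | eq | ge | gt | ne

/-- What a language adds to the operators of dL: atoms, unary and binary constructs. -/
structure Ext where
  leaf : Kind → Type
  un : Kind → Type
  bin : Kind → Type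

inductive Expr (E : Ext) : Kind → Type
  | var (x : Var) : Expr E .trm
  | num (q : ℚ) : Expr E .trm
  | add (a b : Expr E .trm) : Expr E .trm
  | sub (a b : Expr E .trm) : Expr E .trm
  | mul (a b : Expr E .trm) : Expr E .trm
  | div (a b : Expr E .trm) : Expr E .trm
  | pow (a : Expr E .trm) (q : ℚ) : Expr E .trm
  /-- the differential of a term -/
  | diff (a : Expr E .trm) : Expr E .trm
  | cmp (c : Cmp) (a b : Expr E .trm) : Expr E .fml
  | and (p q : Expr E .fml) : Expr E .fml
  | or (p q : Expr E .fml) : Expr E .fml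
  | not (p : Expr E .fml) : Expr E .fml
  | imp (p q : Expr E .fml) : Expr E .fml
  | iff (p q : Expr E .fml) : Expr E .fml
  | all (x : Var) (p : Expr E .fml) : Expr E .fml
  | ex (x : Var) (p : Expr E .fml) : Expr E .fml
  | box (a : Expr E .prg) (p : Expr E .fml) : Expr E .fml
  | dia (a : Expr E .prg) (p : Expr E .fml) : Expr E .fml
  /-- the single equation `x' = a` -/
  | deq (x : Var) (a : Expr E .trm) : Expr E .ode
  /-- the union of two systems of equations -/
  | comma (o o₂ : Expr E .ode) : Expr E .ode
  | assign (x : Var) (a : Expr E .trm) : Expr E .prg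
  | random (x : Var) : Expr E .prg
  | test (p : Expr E .fml) : Expr E .prg
  | seq (a b : Expr E .prg) : Expr E .prg
  | choice (a b : Expr E .prg) : Expr E .prg
  | star (a : Expr E .prg) : Expr E .prg
  | evolve (o : Expr E .ode) (q : Expr E .fml) : Expr E .prg
  | leaf {k : Kind} (l : E.leaf k) : Expr E k
  | un {k : Kind} (u : E.un k) (e : Expr E k) : Expr E k
  | bin {k : Kind} (u : E.bin k) (e f : Expr E k) : Expr E k

/-- dL with additional atoms only. -/
def atoms (L : Kind → Type) : Ext := ⟨L, fun _ => Empty, fun _ => Empty⟩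

/-- Expressions of dL. -/
abbrev DL (k : Kind) := Expr (atoms fun _ => Empty) k

inductive NomLeaf : Kind → Type
  | state (t : Ident) : NomLeaf .fml

/-- Expressions of the nominal logic dLh: state names are atomic formulas. -/
abbrev DLh (k : Kind) := Expr (atoms NomLeaf) k

inductive NowLeaf : Kind → Type
  | now (a : DL .trm) : NowLeaf .trm

/-- Bodies of functional abbreviations: terms with pseudo-nominals `now(a)`. A variable outside
`now` has its sequent-level meaning. -/
abbrev Mob := Expr (atoms NowLeaf) .trm

inductive ExtUn : Kind → Type
  | nominal (t : Ident) : ExtUn .trm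

/-- Extended expressions, as written in proofs: abbreviations `X_` and nominal terms `t(θ)`. -/
abbrev XExpr (k : Kind) := Expr ⟨fun _ => Ident, ExtUn, fun _ => Empty⟩ k

inductive PatLeaf : Kind → Type
  | ident {k : Kind} (X : Ident) : PatLeaf k
  | wild {k : Kind} : PatLeaf k
  | vars {k : Kind} (V : Finset Var) : PatLeaf k
  | nvars {k : Kind} (V : Finset Var) : PatLeaf k

inductive PatUn : Kind → Type
  | neg {k : Kind} : PatUn k

inductive PatBin : Kind → Type
  | union {k : Kind} : PatBin k
  | inter {k : Kind} : PatBin k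

/-- Patterns. -/
abbrev Pat (k : Kind) := Expr ⟨PatLeaf, PatUn, PatBin⟩ k

namespace Expr

variable {E : Ext}

/-! Static notions -/

/-- Free variables; `must a` are the variables bound on every path of the program `a`. -/
def must : {k : Kind} → Expr E k → Finset Var
  | _, .deq x _ => {x, x.prime}
  | _, .comma o o₂ => o.must ∪ o₂.must
  | _, .assign x _ => {x}
  | _, .random x => {x}
  | _, .seq a b => a.must ∪ b.must
  | _, .choice a b => a.must ∩ b.must
  | _, .evolve o _ => o.must
  | _, _ => ∅

def fv : {k : Kind} → Expr E k → Finset Var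
  | _, .var x => {x}
  | _, .num _ => ∅
  | _, .add a b => a.fv ∪ b.fv
  | _, .sub a b => a.fv ∪ b.fv
  | _, .mul a b => a.fv ∪ b.fv
  | _, .div a b => a.fv ∪ b.fv
  | _, .pow a _ => a.fv
  | _, .diff a => a.fv ∪ a.fv.image Var.prime
  | _, .cmp _ a b => a.fv ∪ b.fv
  | _, .and p q => p.fv ∪ q.fv
  | _, .or p q => p.fv ∪ q.fv
  | _, .not p => p.fv
  | _, .imp p q => p.fv ∪ q.fv
  | _, .iff p q => p.fv ∪ q.fv
  | _, .all x p => p.fv \ {x}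
  | _, .ex x p => p.fv \ {x}
  | _, .box a p => a.fv ∪ (p.fv \ a.must)
  | _, .dia a p => a.fv ∪ (p.fv \ a.must)
  | _, .deq x a => {x} ∪ a.fv
  | _, .comma o o₂ => o.fv ∪ o₂.fv
  | _, .assign _ a => a.fv
  | _, .random _ => ∅
  | _, .test p => p.fv
  | _, .seq a b => a.fv ∪ (b.fv \ a.must)
  | _, .choice a b => a.fv ∪ b.fv
  | _, .star a => a.fv
  | _, .evolve o q => o.fv ∪ q.fv
  | _, .leaf _ => ∅
  | _, .un _ e => e.fv
  | _, .bin _ e f => e.fv ∪ f.fv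

/-- Bound variables. -/
def bv : {k : Kind} → Expr E k → Finset Var
  | _, .and p q => p.bv ∪ q.bv
  | _, .or p q => p.bv ∪ q.bv
  | _, .not p => p.bv
  | _, .imp p q => p.bv ∪ q.bv
  | _, .iff p q => p.bv ∪ q.bv
  | _, .all x p => {x} ∪ p.bv
  | _, .ex x p => {x} ∪ p.bv
  | _, .box a p => a.bv ∪ p.bv
  | _, .dia a p => a.bv ∪ p.bv
  | _, .deq x _ => {x, x.prime}
  | _, .comma o o₂ => o.bv ∪ o₂.bv
  | _, .assign x _ => {x}
  | _, .random x => {x}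
  | _, .test _ => ∅
  | _, .seq a b => a.bv ∪ b.bv
  | _, .choice a b => a.bv ∪ b.bv
  | _, .star a => a.bv
  | _, .evolve o _ => o.bv
  | _, .un _ e => e.bv
  | _, .bin _ e f => e.bv ∪ f.bv
  | _, _ => ∅

/-- All variables that occur, free or bound. An equation for `x` and a differential mention the
differential variables too. -/
def vars : {k : Kind} → Expr E k → Finset Var
  | _, .var x => {x}
  | _, .num _ => ∅
  | _, .add a b => a.vars ∪ b.vars
  | _, .sub a b => a.vars ∪ b.vars
  | _, .mul a b => a.vars ∪ b.vars
  | _, .div a b => a.vars ∪ b.vars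
  | _, .pow a _ => a.vars
  | _, .diff a => a.vars ∪ a.vars.image Var.prime
  | _, .cmp _ a b => a.vars ∪ b.vars
  | _, .and p q => p.vars ∪ q.vars
  | _, .or p q => p.vars ∪ q.vars
  | _, .not p => p.vars
  | _, .imp p q => p.vars ∪ q.vars
  | _, .iff p q => p.vars ∪ q.vars
  | _, .all x p => {x} ∪ p.vars
  | _, .ex x p => {x} ∪ p.vars
  | _, .box a p => a.vars ∪ p.vars
  | _, .dia a p => a.vars ∪ p.vars
  | _, .deq x a => {x, x.prime} ∪ a.vars
  | _, .comma o o₂ => o.vars ∪ o₂.vars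
  | _, .assign x a => {x} ∪ a.vars
  | _, .random x => {x}
  | _, .test p => p.vars
  | _, .seq a b => a.vars ∪ b.vars
  | _, .choice a b => a.vars ∪ b.vars
  | _, .star a => a.vars
  | _, .evolve o q => o.vars ∪ q.vars
  | _, .leaf _ => ∅
  | _, .un _ e => e.vars
  | _, .bin _ e f => e.vars ∪ f.vars

def names {k : Kind} (e : Expr E k) : Finset ℕ := e.vars.image Var.name

/-- The equations of a system, in order. -/
def eqns : {k : Kind} → Expr E k → List (Var × Expr E .trm)
  | _, .deq x a => [(x, a)]
  | _, .comma o o₂ => o.eqns ++ o₂.eqns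
  | _, _ => []

/-- The variables that a system evolves, and their differential variables. -/
def evolved (o : Expr E .ode) : Finset Var := (o.eqns.map Prod.fst).toFinset

def evolvedPrimes (o : Expr E .ode) : Finset Var := o.evolved.image Var.prime

/-- First-order formulas of real arithmetic (and their terms): no programs, no differentials. -/
def IsFOL : {k : Kind} → Expr E k → Prop
  | _, .var _ => True
  | _, .num _ => True
  | _, .add a b => a.IsFOL ∧ b.IsFOL
  | _, .sub a b => a.IsFOL ∧ b.IsFOL
  | _, .mul a b => a.IsFOL ∧ b.IsFOL
  | _, .div a b => a.IsFOL ∧ b.IsFOL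
  | _, .pow a _ => a.IsFOL
  | _, .cmp _ a b => a.IsFOL ∧ b.IsFOL
  | _, .and p q => p.IsFOL ∧ q.IsFOL
  | _, .or p q => p.IsFOL ∧ q.IsFOL
  | _, .not p => p.IsFOL
  | _, .imp p q => p.IsFOL ∧ q.IsFOL
  | _, .iff p q => p.IsFOL ∧ q.IsFOL
  | _, .all _ p => p.IsFOL
  | _, .ex _ p => p.IsFOL
  | _, _ => False

/-- The formula is an instance of a propositional tautology: it is true under every assignment `v`
of truth values to its non-propositional subformulas. -/
def PropTrue (v : Expr E .fml → Prop) : Expr E .fml → Prop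
  | .and p q => p.PropTrue v ∧ q.PropTrue v
  | .or p q => p.PropTrue v ∨ q.PropTrue v
  | .not p => ¬ p.PropTrue v
  | .imp p q => p.PropTrue v → q.PropTrue v
  | .iff p q => (p.PropTrue v ↔ q.PropTrue v)
  | p => v p

/-! Replacement -/

/-- Homomorphic replacement of variable occurrences in terms, of binders and of atoms. -/
def trav {L M : Kind → Type} (f : Var → Expr (atoms M) .trm) (b : Var → Var)
    (g : (k : Kind) → L k → Expr (atoms M) k) : {k : Kind} → Expr (atoms L) k → Expr (atoms M) k
  | _, .var x => f x
  | _, .num q => .num q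
  | _, .add a c => .add (a.trav f b g) (c.trav f b g)
  | _, .sub a c => .sub (a.trav f b g) (c.trav f b g)
  | _, .mul a c => .mul (a.trav f b g) (c.trav f b g)
  | _, .div a c => .div (a.trav f b g) (c.trav f b g)
  | _, .pow a q => .pow (a.trav f b g) q
  | _, .diff a => .diff (a.trav f b g)
  | _, .cmp o a c => .cmp o (a.trav f b g) (c.trav f b g)
  | _, .and p q => .and (p.trav f b g) (q.trav f b g)
  | _, .or p q => .or (p.trav f b g) (q.trav f b g)
  | _, .not p => .not (p.trav f b g)
  | _, .imp p q => .imp (p.trav f b g) (q.trav f b g)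
  | _, .iff p q => .iff (p.trav f b g) (q.trav f b g)
  | _, .all x p => .all (b x) (p.trav f b g)
  | _, .ex x p => .ex (b x) (p.trav f b g)
  | _, .box a p => .box (a.trav f b g) (p.trav f b g)
  | _, .dia a p => .dia (a.trav f b g) (p.trav f b g)
  | _, .deq x a => .deq (b x) (a.trav f b g)
  | _, .comma o o₂ => .comma (o.trav f b g) (o₂.trav f b g)
  | _, .assign x a => .assign (b x) (a.trav f b g)
  | _, .random x => .random (b x)
  | _, .test p => .test (p.trav f b g)
  | _, .seq a c => .seq (a.trav f b g) (c.trav f b g)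
  | _, .choice a c => .choice (a.trav f b g) (c.trav f b g)
  | _, .star a => .star (a.trav f b g)
  | _, .evolve o q => .evolve (o.trav f b g) (q.trav f b g)
  | k, .leaf l => g k l

/-- Reading a dL expression as a dLh expression. -/
def embed {k : Kind} (e : DL k) : DLh k := e.trav .var id fun _ l => Empty.elim l

/-- Simultaneous substitution of terms for variables; see `Adm`. -/
def subst {k : Kind} (σ : Var → DL .trm) (e : DL k) : DL k :=
  e.trav σ id fun _ l => Empty.elim l

/-- The substitution of `a` for `x`. -/
def single (x : Var) (a : DL .trm) : Var → DL .trm := Function.update Expr.var x a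

/-- No variable of `V` that `σ` replaces, and no variable of its replacement, is in `B`. -/
def NoClash (σ : Var → DL .trm) (B V : Finset Var) : Prop :=
  ∀ z ∈ V, σ z ≠ .var z → z ∉ B ∧ Disjoint (σ z).fv B

/-- Admissibility of a substitution: no replaced variable occurs in the scope of a quantifier or
program that binds it or a variable of its replacement, nor under a differential. -/
def Adm (σ : Var → DL .trm) : {k : Kind} → DL k → Prop
  | _, .add a b => a.Adm σ ∧ b.Adm σ
  | _, .sub a b => a.Adm σ ∧ b.Adm σ
  | _, .mul a b => a.Adm σ ∧ b.Adm σ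
  | _, .div a b => a.Adm σ ∧ b.Adm σ
  | _, .pow a _ => a.Adm σ
  | _, .diff a => ∀ z ∈ a.fv ∪ a.fv.image Var.prime, σ z = .var z
  | _, .cmp _ a b => a.Adm σ ∧ b.Adm σ
  | _, .and p q => p.Adm σ ∧ q.Adm σ
  | _, .or p q => p.Adm σ ∧ q.Adm σ
  | _, .not p => p.Adm σ
  | _, .imp p q => p.Adm σ ∧ q.Adm σ
  | _, .iff p q => p.Adm σ ∧ q.Adm σ
  | _, .all x p => NoClash σ {x} p.vars ∧ p.Adm σ
  | _, .ex x p => NoClash σ {x} p.vars ∧ p.Adm σ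
  | _, .box a p => NoClash σ a.bv p.vars ∧ a.Adm σ ∧ p.Adm σ
  | _, .dia a p => NoClash σ a.bv p.vars ∧ a.Adm σ ∧ p.Adm σ
  | _, .deq _ a => a.Adm σ
  | _, .comma o o₂ => o.Adm σ ∧ o₂.Adm σ
  | _, .assign _ a => a.Adm σ
  | _, .test p => p.Adm σ
  | _, .seq a b => NoClash σ a.bv b.vars ∧ a.Adm σ ∧ b.Adm σ
  | _, .choice a b => a.Adm σ ∧ b.Adm σ
  | _, .star a => NoClash σ a.bv a.vars ∧ a.Adm σ
  | _, .evolve o q => NoClash σ o.bv (o.vars ∪ q.vars) ∧ o.Adm σ ∧ q.Adm σ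
  | _, _ => True

/-- Uniform renaming by a permutation of names; `x'` is renamed along with `x`. -/
def rename {L : Kind → Type} {k : Kind} (f : Equiv.Perm ℕ) (e : Expr (atoms L) k) :
    Expr (atoms L) k :=
  e.trav (fun x => .var ⟨f x.name, x.primes⟩) (fun x => ⟨f x.name, x.primes⟩) fun _ l => .leaf l

end Expr

open Kaisar.Expr

/-! Semantics -/

abbrev State := Var → ℝ

/-- Terms denote real-valued functions of the state, formulas denote sets of states, programs
denote transition relations, ODE systems denote vector fields on finitely many variables. -/
def Den : Kind → Type
  | .trm => State → ℝ
  | .fml => State → Prop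
  | .ode => List (Var × (State → ℝ))
  | .prg => State → State → Prop

/-- `φ` solves the system on `[0, T]` from `ω`. Along the solution each `x'` has the value of the
right-hand side for `x`; variables that the system does not mention keep their value. -/
def Flow (sys : List (Var × (State → ℝ))) (ω : State) (T : ℝ) (φ : ℝ → State) : Prop :=
  (∀ p ∈ sys, φ 0 p.1 = ω p.1) ∧
  ∀ s ∈ Set.Icc 0 T,
    (∀ p ∈ sys, φ s p.1.prime = p.2 (φ s) ∧
      HasDerivWithinAt (fun r => φ r p.1) (p.2 (φ s)) (Set.Icc 0 T) s) ∧
    ∀ z, (∀ p ∈ sys, z ≠ p.1 ∧ z ≠ p.1.prime) → φ s z = ω z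

/-- `φ` is the unique solution on `[0, T]`: it is one, and every solution of a duration at most `T`
agrees with it. -/
def UniqueFlow (sys : List (Var × (State → ℝ))) (ω : State) (T : ℝ) (φ : ℝ → State) : Prop :=
  Flow sys ω T φ ∧
  ∀ s ∈ Set.Icc 0 T, ∀ ψ, Flow sys ω s ψ → ∀ r ∈ Set.Icc 0 s, ψ r = φ r

def Cmp.Holds : Cmp → ℝ → ℝ → Prop
  | .lt, a, b => a < b
  | .le, a, b => a ≤ b
  | .eq, a, b => a = b
  | .ge, a, b => a ≥ b
  | .gt, a, b => a > b
  | .ne, a, b => a ≠ b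

/-- Denotational semantics, given the denotation `J` of the additional atoms. -/
noncomputable def sem {L : Kind → Type} (J : (k : Kind) → L k → Den k) :
    {k : Kind} → Expr (atoms L) k → Den k
  | _, .var x => fun ω => ω x
  | _, .num q => fun _ => (q : ℝ)
  | _, .add a b => fun ω => sem J a ω + sem J b ω
  | _, .sub a b => fun ω => sem J a ω - sem J b ω
  | _, .mul a b => fun ω => sem J a ω * sem J b ω
  | _, .div a b => fun ω => sem J a ω / sem J b ω
  | _, .pow a q => fun ω => (sem J a ω) ^ (q : ℝ)
  | _, .diff a => fun ω =>
      ∑ x ∈ a.fv, deriv (fun r => sem J a (Function.update ω x r)) (ω x) * ω x.prime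
  | _, .cmp c a b => fun ω => c.Holds (sem J a ω) (sem J b ω)
  | _, .and p q => fun ω => sem J p ω ∧ sem J q ω
  | _, .or p q => fun ω => sem J p ω ∨ sem J q ω
  | _, .not p => fun ω => ¬ sem J p ω
  | _, .imp p q => fun ω => sem J p ω → sem J q ω
  | _, .iff p q => fun ω => (sem J p ω ↔ sem J q ω)
  | _, .all x p => fun ω => ∀ r : ℝ, sem J p (Function.update ω x r)
  | _, .ex x p => fun ω => ∃ r : ℝ, sem J p (Function.update ω x r)
  | _, .box a p => fun ω => ∀ ν, sem J a ω ν → sem J p ν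
  | _, .dia a p => fun ω => ∃ ν, sem J a ω ν ∧ sem J p ν
  | _, .deq x a => [(x, sem J a)]
  | _, .comma o o₂ => List.append (sem J o) (sem J o₂)
  | _, .assign x a => fun ω ν => ν = Function.update ω x (sem J a ω)
  | _, .random x => fun ω ν => ∃ r : ℝ, ν = Function.update ω x r
  | _, .test p => fun ω ν => ω = ν ∧ sem J p ω
  | _, .seq a b => fun ω ν => ∃ μ, sem J a ω μ ∧ sem J b μ ν
  | _, .choice a b => fun ω ν => sem J a ω ν ∨ sem J b ω ν
  | _, .star a => Relation.ReflTransGen (sem J a)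
  | _, .evolve o q => fun ω ν => ∃ T : ℝ, 0 ≤ T ∧ ∃ φ : ℝ → State,
      UniqueFlow (sem J o) ω T φ ∧ (∀ s ∈ Set.Icc 0 T, sem J q (φ s)) ∧ ν = φ T
  | k, .leaf l => J k l

/-- Semantics of dL. -/
noncomputable def den {k : Kind} (e : DL k) : Den k := sem (fun _ l => Empty.elim l) e

/-- Interpretations of dLh: the unique state identified by a name, for some of the names. -/
abbrev Interp := Ident → Option State

/-- Semantics of dLh: the formula `t` is true exactly in the state that `t` identifies. -/
noncomputable def denh (I : Interp) {k : Kind} (e : DLh k) : Den k :=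
  sem (fun _ l => match l with | .state t => fun ω => I t = some ω) e

/-- Validity of the dLh sequent `ps ⊢ qs` under the interpretation `I`. -/
def ValidH (I : Interp) (ps qs : List (DLh .fml)) : Prop :=
  ∀ ω : State, (∀ p ∈ ps, denh I p ω) → ∃ q ∈ qs, denh I q ω

/-- Truth of the dL sequent `ps ⊢ qs` in a state, and its validity. -/
def SeqAt (ps qs : List (DL .fml)) (ω : State) : Prop :=
  (∀ p ∈ ps, den p ω) → ∃ q ∈ qs, den q ω

def Valid (ps qs : List (DL .fml)) : Prop := ∀ ω, SeqAt ps qs ω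

/-- Dynamic traces: lists of states, beginning with one, interleaved with state names. -/
inductive DynTrace
  | start (ω : State)
  | state (η : DynTrace) (ω : State)
  | name (η : DynTrace) (t : Ident)

def DynTrace.last : DynTrace → State
  | .start ω => ω
  | .state _ ω => ω
  | .name η _ => η.last

/-- `t(η)`: the longest prefix that precedes the name `t`. -/
def DynTrace.upto (t : Ident) : DynTrace → Option DynTrace
  | .start _ => none
  | .state η _ => η.upto t
  | .name η s => if s = t then some η else η.upto t

/-- The interpretation that maps each `t` of the trace to the last state of `t(η)`. -/
def interp (η : DynTrace) : Interp := fun t => (η.upto t).map DynTrace.last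

/-- The term is defined and differentiable at `ω`: no denominator vanishes, and powers are taken
where they are differentiable. For a formula (quantifier-free): all its terms are. -/
def Regular (ω : State) : {k : Kind} → DL k → Prop
  | _, .var _ => True
  | _, .num _ => True
  | _, .add a b => Regular ω a ∧ Regular ω b
  | _, .sub a b => Regular ω a ∧ Regular ω b
  | _, .mul a b => Regular ω a ∧ Regular ω b
  | _, .div a b => Regular ω a ∧ Regular ω b ∧ (den b : State → ℝ) ω ≠ 0
  | _, .pow a q => Regular ω a ∧ ((den a : State → ℝ) ω ≠ 0 ∨ 1 ≤ q ∨ q = 0)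
  | _, .cmp _ a b => Regular ω a ∧ Regular ω b
  | _, .and p q => Regular ω p ∧ Regular ω q
  | _, .or p q => Regular ω p ∧ Regular ω q
  | _, _ => False

/-- The differential of a formula. -/
def dform : DL .fml → Option (DL .fml)
  | .cmp .lt a b => some (.cmp .le (.diff a) (.diff b))
  | .cmp .le a b => some (.cmp .le (.diff a) (.diff b))
  | .cmp .eq a b => some (.cmp .eq (.diff a) (.diff b))
  | .cmp .ne a b => some (.cmp .eq (.diff a) (.diff b))
  | .cmp .ge a b => some (.cmp .ge (.diff a) (.diff b))
  | .cmp .gt a b => some (.cmp .ge (.diff a) (.diff b))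
  | .and p q => do
      let p' ← dform p
      let q' ← dform q
      return .and p' q'
  | .or p q => do
      let p' ← dform p
      let q' ← dform q
      return .and p' q'
  | _ => none

/-! Contexts and static traces. The most recent entry comes first. -/

/-- `hyp n φ`: an assumption, possibly named. `abbr X e`: an abbreviation. `fabbr X m`: a
functional abbreviation. -/
inductive Entry
  | hyp (n : Option Ident) (φ : DL .fml)
  | abbr (X : Ident) {k : Kind} (e : DL k)
  | fabbr (X : Ident) (m : Mob)

abbrev Ctx := List Entry

/-- The assumptions in a context. -/
def facts (Γ : Ctx) : List (DL .fml) :=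
  Γ.filterMap fun | .hyp _ φ => some φ | _ => none

/-- Trace records: `x := θ` done by substitution; `x := θ` done by an equation, with the old value
in the ghost `xᵢ`; nondeterministic assignment with the old value in `xᵢ`; a state name. -/
inductive Rec
  | sub (x : Var) (θ : DL .trm)
  | eq (x xi : Var) (θ : DL .trm)
  | any (x xi : Var)
  | state (t : Ident)

abbrev Trace := List Rec

/-- The sequent-level equivalent of a program variable at the end of a trace. -/
def nowVar (x : Var) : Trace → DL .trm
  | [] => .var x
  | .sub y θ :: H => if y = x then θ else nowVar x H
  | .eq y _ _ :: H => if y = x then .var x else nowVar x H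
  | .any y _ :: H => if y = x then .var x else nowVar x H
  | .state _ :: H => nowVar x H

/-- The sequent-level equivalent of a program variable at the state `t` of a trace. -/
def nomVar (t : Ident) (x : Var) : Trace → Option (DL .trm)
  | [] => none
  | .state s :: H => if s = t then some (nowVar x H) else nomVar t x H
  | .sub _ _ :: H => nomVar t x H
  | .eq y yi _ :: H => if y = x then nomVar t yi H else nomVar t x H
  | .any y yi :: H => if y = x then nomVar t yi H else nomVar t x H

def stateNames (H : Trace) : List Ident :=
  H.filterMap fun | .state t => some t | _ => none

/-- The value of a variable at a state, where `none` stands for the current state. -/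
def varAt (H : Trace) : Option Ident → Var → DL .trm
  | none, x => nowVar x H
  | some t, x => (nomVar t x H).getD (.var x)

/-- The value of a functional abbreviation at a state. -/
def mobAt (H : Trace) (st : Option Ident) (m : Mob) : DL .trm :=
  m.trav .var id fun _ l => match l with | .now a => a.subst (varAt H st)

def Entry.vars : Entry → Finset Var
  | .hyp _ φ => φ.vars
  | .abbr _ e => e.vars
  | .fabbr _ m => m.vars ∪ Expr.vars
      (m.trav (M := fun _ => Empty) .var id fun _ l => match l with | .now a => a)

def Entry.names (e : Entry) : Finset ℕ := e.vars.image Var.name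

def Rec.names : Rec → Finset ℕ
  | .sub x θ => {x.name} ∪ θ.names
  | .eq x xi θ => {x.name, xi.name} ∪ θ.names
  | .any x xi => {x.name, xi.name}
  | .state _ => ∅

/-- The name `n` is fresh for a context, a trace and formulas. -/
def Fresh (n : ℕ) (Γ : Ctx) (H : Trace) (Δ : List (DL .fml)) : Prop :=
  (∀ e ∈ Γ, n ∉ e.names) ∧ (∀ r ∈ H, n ∉ r.names) ∧ ∀ p ∈ Δ, n ∉ p.names

def Entry.rename (f : Equiv.Perm ℕ) : Entry → Entry
  | .hyp n φ => .hyp n (φ.rename f)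
  | .abbr X e => .abbr X (e.rename f)
  | .fabbr X m => .fabbr X (Expr.rename f m)

def renameCtx (f : Equiv.Perm ℕ) (Γ : Ctx) : Ctx := Γ.map (Entry.rename f)

/-- The entry bound to an identifier, as an expression of kind `k`, at a state. -/
def resolve (Γ : Ctx) (H : Trace) (st : Option Ident) (X : Ident) : Option ((k : Kind) × DL k) :=
  Γ.findSome? fun
    | .hyp n φ => if n = some X then some ⟨.fml, φ⟩ else none
    | .abbr Y e => if Y = X then some ⟨_, e⟩ else none
    | .fabbr Y m => if Y = X then some ⟨.trm, mobAt H st m⟩ else none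

open Classical in
/-- Coercion of an expression of some kind to kind `k`, if that is its kind. -/
noncomputable def ofKind (k : Kind) (e : (k : Kind) × DL k) : Option (DL k) :=
  if h : e.1 = k then some (h ▸ e.2) else none

/-- Expansion of an extended expression: abbreviations are replaced by their values, variables by
their sequent-level equivalents at the state `st`. -/
noncomputable def expand (Γ : Ctx) (H : Trace) :
    Option Ident → {k : Kind} → XExpr k → Option (DL k)
  | st, _, .var x => some (varAt H st x)
  | _, _, .num q => some (.num q)
  | st, _, .add a b => do return .add (← expand Γ H st a) (← expand Γ H st b)
  | st, _, .sub a b => do return .sub (← expand Γ H st a) (← expand Γ H st b)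
  | st, _, .mul a b => do return .mul (← expand Γ H st a) (← expand Γ H st b)
  | st, _, .div a b => do return .div (← expand Γ H st a) (← expand Γ H st b)
  | st, _, .pow a q => do return .pow (← expand Γ H st a) q
  | st, _, .diff a => do return .diff (← expand Γ H st a)
  | st, _, .cmp c a b => do return .cmp c (← expand Γ H st a) (← expand Γ H st b)
  | st, _, .and p q => do return .and (← expand Γ H st p) (← expand Γ H st q)
  | st, _, .or p q => do return .or (← expand Γ H st p) (← expand Γ H st q)
  | st, _, .not p => do return .not (← expand Γ H st p)
  | st, _, .imp p q => do return .imp (← expand Γ H st p) (← expand Γ H st q)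
  | st, _, .iff p q => do return .iff (← expand Γ H st p) (← expand Γ H st q)
  | st, _, .all x p => do return .all x (← expand Γ H st p)
  | st, _, .ex x p => do return .ex x (← expand Γ H st p)
  | st, _, .box a p => do return .box (← expand Γ H st a) (← expand Γ H st p)
  | st, _, .dia a p => do return .dia (← expand Γ H st a) (← expand Γ H st p)
  | st, _, .deq x a => do return .deq x (← expand Γ H st a)
  | st, _, .comma o o₂ => do return .comma (← expand Γ H st o) (← expand Γ H st o₂)
  | st, _, .assign x a => do return .assign x (← expand Γ H st a)
  | _, _, .random x => some (.random x)
  | st, _, .test p => do return .test (← expand Γ H st p)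
  | st, _, .seq a b => do return .seq (← expand Γ H st a) (← expand Γ H st b)
  | st, _, .choice a b => do return .choice (← expand Γ H st a) (← expand Γ H st b)
  | st, _, .star a => do return .star (← expand Γ H st a)
  | st, _, .evolve o q => do return .evolve (← expand Γ H st o) (← expand Γ H st q)
  | st, k, .leaf X => (resolve Γ H st X).bind (ofKind k)
  | _, _, .un (.nominal t) a => if t ∈ stateNames H then expand Γ H (some t) a else none

/-- Mobilization of the body of a functional abbreviation with state argument `t`: what is under
the nominal `t` becomes a pseudo-nominal, everything else is expanded. -/
noncomputable def mobilize (Γ : Ctx) (H : Trace) (t : Ident) : XExpr .trm → Option Mob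
  | .num q => some (.num q)
  | .add a b => do return .add (← mobilize Γ H t a) (← mobilize Γ H t b)
  | .sub a b => do return .sub (← mobilize Γ H t a) (← mobilize Γ H t b)
  | .mul a b => do return .mul (← mobilize Γ H t a) (← mobilize Γ H t b)
  | .div a b => do return .div (← mobilize Γ H t a) (← mobilize Γ H t b)
  | .pow a q => do return .pow (← mobilize Γ H t a) q
  | .un (.nominal s) a =>
      if s = t then (expand Γ [] none a).map fun θ => .leaf (.now θ)
      else (expand Γ H none (.un (.nominal s) a)).map (trav .var id fun _ l => Empty.elim l)
  | e => (expand Γ H none e).map (trav .var id fun _ l => Empty.elim l)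

/-! Pattern matching -/

/-- The identifiers in a pattern. -/
def Expr.idents : {k : Kind} → Pat k → List Ident
  | _, .add a b => a.idents ++ b.idents
  | _, .sub a b => a.idents ++ b.idents
  | _, .mul a b => a.idents ++ b.idents
  | _, .div a b => a.idents ++ b.idents
  | _, .pow a _ => a.idents
  | _, .diff a => a.idents
  | _, .cmp _ a b => a.idents ++ b.idents
  | _, .and p q => p.idents ++ q.idents
  | _, .or p q => p.idents ++ q.idents
  | _, .not p => p.idents
  | _, .imp p q => p.idents ++ q.idents
  | _, .iff p q => p.idents ++ q.idents
  | _, .all _ p => p.idents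
  | _, .ex _ p => p.idents
  | _, .box a p => a.idents ++ p.idents
  | _, .dia a p => a.idents ++ p.idents
  | _, .deq _ a => a.idents
  | _, .comma o o₂ => o.idents ++ o₂.idents
  | _, .assign _ a => a.idents
  | _, .test p => p.idents
  | _, .seq a b => a.idents ++ b.idents
  | _, .choice a b => a.idents ++ b.idents
  | _, .star a => a.idents
  | _, .evolve o q => o.idents ++ q.idents
  | _, .leaf (.ident X) => [X]
  | _, .un _ p => p.idents
  | _, .bin _ p q => p.idents ++ q.idents
  | _, _ => []

open Classical in
/-- Pattern matching: the context extended by the bindings of the match, or `none` if the pattern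
does not match. -/
noncomputable def pmatch (H : Trace) : {k : Kind} → Pat k → DL k → Ctx → Option Ctx
  | _, .var x, e, Γ => if e = nowVar x H then some Γ else none
  | _, .num q, e, Γ => if e = .num q then some Γ else none
  | _, .add p q, e₀, Γ => match e₀ with
      | .add e f => (pmatch H p e Γ).bind (pmatch H q f)
      | _ => none
  | _, .sub p q, e₀, Γ => match e₀ with
      | .sub e f => (pmatch H p e Γ).bind (pmatch H q f)
      | _ => none
  | _, .mul p q, e₀, Γ => match e₀ with
      | .mul e f => (pmatch H p e Γ).bind (pmatch H q f)
      | _ => none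
  | _, .div p q, e₀, Γ => match e₀ with
      | .div e f => (pmatch H p e Γ).bind (pmatch H q f)
      | _ => none
  | _, .pow p r, e₀, Γ => match e₀ with
      | .pow e s => if r = s then pmatch H p e Γ else none
      | _ => none
  | _, .diff p, e₀, Γ => match e₀ with
      | .diff e => pmatch H p e Γ
      | _ => none
  | _, .cmp c p q, e₀, Γ => match e₀ with
      | .cmp d e f => if c = d then (pmatch H p e Γ).bind (pmatch H q f) else none
      | _ => none
  | _, .and p q, e₀, Γ => match e₀ with
      | .and e f => (pmatch H p e Γ).bind (pmatch H q f)
      | _ => none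
  | _, .or p q, e₀, Γ => match e₀ with
      | .or e f => (pmatch H p e Γ).bind (pmatch H q f)
      | _ => none
  | _, .not p, e₀, Γ => match e₀ with
      | .not e => pmatch H p e Γ
      | _ => none
  | _, .imp p q, e₀, Γ => match e₀ with
      | .imp e f => (pmatch H p e Γ).bind (pmatch H q f)
      | _ => none
  | _, .iff p q, e₀, Γ => match e₀ with
      | .iff e f => (pmatch H p e Γ).bind (pmatch H q f)
      | _ => none
  | _, .all x p, e₀, Γ => match e₀ with
      | .all y e => if x = y then pmatch H p e Γ else none
      | _ => none
  | _, .ex x p, e₀, Γ => match e₀ with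
      | .ex y e => if x = y then pmatch H p e Γ else none
      | _ => none
  | _, .box p q, e₀, Γ => match e₀ with
      | .box e f => (pmatch H p e Γ).bind (pmatch H q f)
      | _ => none
  | _, .dia p q, e₀, Γ => match e₀ with
      | .dia e f => (pmatch H p e Γ).bind (pmatch H q f)
      | _ => none
  | _, .deq x p, e₀, Γ => match e₀ with
      | .deq y e => if x = y then pmatch H p e Γ else none
      | _ => none
  | _, .comma p q, e₀, Γ => match e₀ with
      | .comma e f => (pmatch H p e Γ).bind (pmatch H q f)
      | _ => none
  | _, .assign x p, e₀, Γ => match e₀ with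
      | .assign y e => if x = y then pmatch H p e Γ else none
      | _ => none
  | _, .random x, e₀, Γ => match e₀ with
      | .random y => if x = y then some Γ else none
      | _ => none
  | _, .test p, e₀, Γ => match e₀ with
      | .test e => pmatch H p e Γ
      | _ => none
  | _, .seq p q, e₀, Γ => match e₀ with
      | .seq e f => (pmatch H p e Γ).bind (pmatch H q f)
      | _ => none
  | _, .choice p q, e₀, Γ => match e₀ with
      | .choice e f => (pmatch H p e Γ).bind (pmatch H q f)
      | _ => none
  | _, .star p, e₀, Γ => match e₀ with
      | .star e => pmatch H p e Γ
      | _ => none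
  | _, .evolve p q, e₀, Γ => match e₀ with
      | .evolve e f => (pmatch H p e Γ).bind (pmatch H q f)
      | _ => none
  | _, .leaf (.ident X), e, Γ =>
      match resolve Γ H none X with
      | some v => if v = ⟨_, e⟩ then some Γ else none
      | none => some (.abbr X e :: Γ)
  | _, .leaf .wild, _, Γ => some Γ
  | _, .leaf (.vars V), e, Γ => if V ⊆ e.fv then some Γ else none
  | _, .leaf (.nvars V), e, Γ => if Disjoint V e.fv then some Γ else none
  | _, .un .neg p, e, Γ =>
      if pmatch H p e Γ = none ∧ ∀ X ∈ p.idents, resolve Γ H none X ≠ none then some Γ else none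
  | _, .bin .union p q, e, Γ => (pmatch H p e Γ).orElse fun _ => pmatch H q e Γ
  | _, .bin .inter p q, e, Γ => (pmatch H p e Γ).bind (pmatch H q e)

/-! Proofs -/

/-- Forward-chaining proofs: a fact selected by a pattern, modus ponens, instantiation. -/
inductive FP
  | pat (p : Pat .fml)
  | app (f g : FP)
  | inst (f : FP) (e : XExpr .trm)

/-- Proof methods of unstructured proofs. -/
inductive Method
  | id | real | auto

/-- Structured proofs; `inv`, `ghost` and `finally` form the invariant proofs. -/
inductive SP
  /-- `let p = e` -/
  | sLet {k : Kind} (p : Pat k) (e : XExpr k) (sp : SP)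
  /-- `let t(X) = e` -/
  | flet (t X : Ident) (e : XExpr .trm) (sp : SP)
  | note (x : Ident) (f : FP) (sp : SP)
  | sHave (x : Ident) (e : XExpr .fml) (sp₁ sp₂ : SP)
  /-- `show p using ps fs by m` -/
  | sShow (p : Pat .fml) (ps : List (Pat .fml)) (fs : List FP) (m : Method)
  | state (t : Ident) (sp : SP)
  | focus (p : Pat .fml) (sp : SP)
  | assume (x : Ident) (p : Pat .fml) (sp : SP)
  /-- case analysis of a conjunction, a disjunction and an equivalence -/
  | caseAnd (p q : Pat .fml) (sp₁ sp₂ : SP)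
  | caseOr (p q : Pat .fml) (sp : SP)
  | caseIff (p q : Pat .fml) (sp₁ sp₂ : SP)
  | assign (x : Var) (e : XExpr .trm) (sp : SP)
  | assignAny (x : Var) (sp : SP)
  /-- nondeterministic assignment with a witness, in a diamond -/
  | assignWit (x : Var) (e : XExpr .trm) (sp : SP)
  /-- `case p => sp₁ | q => sp₂` for `[α ∪ β]φ`, `[α](φ ∧ ψ)` and `[α*]φ` -/
  | cases {k l : Kind} (p : Pat k) (q : Pat l) (sp₁ sp₂ : SP)
  /-- case analysis for `⟨α ∪ β⟩φ` -/
  | caseDia (p q : Pat .prg) (sp : SP)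
  /-- case analysis for `⟨α*⟩φ` -/
  | caseDiaIter (p : Pat .prg) (q : Pat .fml) (sp : SP)
  /-- `after {sp₁} have e then {sp₂}` -/
  | after (e : XExpr .fml) (sp₁ sp₂ : SP)
  /-- `solve p xt:pt xd:pd`, for a box: the time bound is named `xt`, the domain `xd` -/
  | solve (p : Pat .prg) (xt : Ident) (pt : Pat .fml) (xd : Ident) (pd : Pat .fml) (sp : SP)
  /-- `solve p t:e dc:pd`, for a diamond -/
  | dsolve (p : Pat .prg) (e : XExpr .trm) (pd : Pat .fml) (sp₁ sp₂ : SP)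
  /-- convergence, with a variant `e` in the variable named `x` -/
  | con (x : ℕ) (e : XExpr .fml) (pre ind post : SP)
  | inv (x : Ident) (e : XExpr .fml) (pre ind ip : SP)
  /-- `ghost y := e₀; y' = e₁` for the variable named `y` -/
  | ghost (y : ℕ) (e₁ e₀ : XExpr .trm) (ip : SP)
  | finally (sp : SP)

/-- The standard library of facts: valid formulas of first-order real arithmetic, and instances of
propositional tautologies. -/
def Library (φ : DL .fml) : Prop :=
  (φ.IsFOL ∧ Valid [] [φ]) ∨ ∀ v, φ.PropTrue v

/-- The forward-chaining proof `f` proves a fact. -/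
inductive FPChecks (Γ : Ctx) (H : Trace) : FP → DL .fml → Prop
  | pat (p : Pat .fml) (φ : DL .fml) (hφ : φ ∈ facts Γ ∨ Library φ)
      (hm : (pmatch H p φ Γ).isSome) : FPChecks Γ H (.pat p) φ
  | app (f g : FP) (φ ψ : DL .fml) (hg : FPChecks Γ H g φ) (hf : FPChecks Γ H f (.imp φ ψ)) :
      FPChecks Γ H (.app f g) ψ
  | inst (f : FP) (e : XExpr .trm) (x : Var) (φ : DL .fml) (θ : DL .trm)
      (hf : FPChecks Γ H f (.all x φ)) (he : expand Γ H none e = some θ)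
      (ha : Adm (single x θ) φ) : FPChecks Γ H (.inst f e) (φ.subst (single x θ))

/-- The facts used by `show ... using ps fs`; all assumptions if nothing is listed. -/
def Used (Γ : Ctx) (H : Trace) (ps : List (Pat .fml)) (fs : List FP) (φ : DL .fml) : Prop :=
  (φ ∈ facts Γ ∧ ((ps = [] ∧ fs = []) ∨ ∃ p ∈ ps, (pmatch H p φ Γ).isSome)) ∨
  ∃ f ∈ fs, FPChecks Γ H f φ

/-- What a method proves. `id` finds the first goal among the facts. `real` is the decision
procedure for first-order real arithmetic, applied to the first-order facts and goals. `auto`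
stands for sound automation: it may prove every valid sequent. -/
def Method.Proves (F : DL .fml → Prop) (φ : DL .fml) (Δ : List (DL .fml)) : Method → Prop
  | .id => F φ
  | .real => ∀ ω : State, (∀ ψ, F ψ → ψ.IsFOL → den ψ ω) → ∃ χ ∈ φ :: Δ, χ.IsFOL ∧ den χ ω
  | .auto => ∀ ω : State, (∀ ψ, F ψ → den ψ ω) → ∃ χ ∈ φ :: Δ, den χ ω

/-- `Implicit φ ψ`: the goal `φ` is implicitly converted to `ψ`. -/
inductive Implicit : DL .fml → DL .fml → Prop
  | boxSeq (a b : DL .prg) (p : DL .fml) : Implicit (.box (.seq a b) p) (.box a (.box b p))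
  | diaSeq (a b : DL .prg) (p : DL .fml) : Implicit (.dia (.seq a b) p) (.dia a (.dia b p))
  | all (x : Var) (p : DL .fml) : Implicit (.all x p) (.box (.random x) p)
  | ex (x : Var) (p : DL .fml) : Implicit (.ex x p) (.dia (.random x) p)
  | imp (p q : DL .fml) : Implicit (.imp p q) (.box (.test p) q)
  | notAll (x : Var) (p : DL .fml) : Implicit (.not (.all x p)) (.ex x (.not p))
  | notEx (x : Var) (p : DL .fml) : Implicit (.not (.ex x p)) (.all x (.not p))
  | notNot (p : DL .fml) : Implicit (.not (.not p)) p
  | notAnd (p q : DL .fml) : Implicit (.not (.and p q)) (.or (.not p) (.not q))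
  | notOr (p q : DL .fml) : Implicit (.not (.or p q)) (.and (.not p) (.not q))
  | notImp (p q : DL .fml) : Implicit (.not (.imp p q)) (.and p (.not q))
  | notIff (p q : DL .fml) :
      Implicit (.not (.iff p q)) (.or (.and p (.not q)) (.and (.not p) q))
  | notBox (a : DL .prg) (p : DL .fml) : Implicit (.not (.box a p)) (.dia a (.not p))
  | notDia (a : DL .prg) (p : DL .fml) : Implicit (.not (.dia a p)) (.box a (.not p))

/-! Side conditions of the checking rules -/

/-- `f` exchanges the names in `B` with fresh ghost names, and nothing else. -/
def Ghosting (B : Finset ℕ) (f : Equiv.Perm ℕ) (Γ : Ctx) (H : Trace) (Δ : List (DL .fml)) : Prop :=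
  (∀ n, f (f n) = n) ∧ (∀ n, f n ≠ n → n ∈ B ∨ f n ∈ B) ∧ ∀ n ∈ B, f n ∉ B ∧ Fresh (f n) Γ H Δ

/-- `f` is the renaming of an assignment to `x` that stores the old value in the ghost `xi`. An
assigned differential variable that does not occur needs no renaming. -/
def GhostVar (x : Var) (xi : ℕ) (f : Equiv.Perm ℕ) (Γ : Ctx) (H : Trace) (θ : DL .trm)
    (goal : DL .fml) (Δ : List (DL .fml)) : Prop :=
  Fresh xi Γ H (goal :: Δ) ∧ xi ∉ θ.names ∧ xi ≠ x.name ∧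
  (f = Equiv.swap x.name xi ∨
    (f = 1 ∧ x.primes ≠ 0 ∧ (∀ e ∈ Γ, x ∉ e.vars) ∧ (∀ p ∈ Δ, x ∉ p.vars) ∧ x ∉ θ.vars))

/-- The trace after an abstracted program: its bound variables have arbitrary values, the old ones
are in the ghosts. -/
noncomputable def absTrace (f : Equiv.Perm ℕ) (a : DL .prg) (H : Trace) : Trace :=
  a.bv.toList.map (fun x => .any x ⟨f x.name, x.primes⟩) ++ H

def renameAll (f : Equiv.Perm ℕ) (Δ : List (DL .fml)) : List (DL .fml) := Δ.map (Expr.rename f)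

/-- The context of invariants `J`, and the same under the box of `a`. -/
def invs (Js : List (Ident × DL .fml)) : Ctx := Js.map fun j => .hyp (some j.1) j.2

def boxedInvs (a : DL .prg) (Js : List (Ident × DL .fml)) : Ctx :=
  Js.map fun j => .hyp (some j.1) (.box a j.2)

/-- Throughout the runs of `a` from the states where `Γ ⊢ Δ` is at stake, `e` is regular. -/
def RegularAlong {k : Kind} (Γ : Ctx) (Δ : List (DL .fml)) (a : DL .prg) (e : DL k) : Prop :=
  ∀ ω ν : State, (∀ p ∈ facts Γ, den p ω) → (∀ q ∈ Δ, ¬ den q ω) →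
    (den a : State → State → Prop) ω ν → Regular ν e

/-- `[x' := θ]p` for all equations `x' = θ` of a system. -/
def boxAssigns (l : List (Var × DL .trm)) (p : DL .fml) : DL .fml :=
  l.foldr (fun e q => .box (.assign e.1.prime e.2) q) p

/-- For each initial state, the terms `Y` in the time variable `t` describe a solution of the
system; with `u`, the unique one. -/
def Solution (o : DL .ode) (t : Var) (Y : Var → DL .trm) : Prop :=
  ∀ (ω : State) (r : ℝ), 0 ≤ r → ∃ φ, Flow (den o) ω r φ ∧
    ∀ x ∈ o.evolved, ∀ s ∈ Set.Icc 0 r, φ s x = (den (Y x) : State → ℝ) (Function.update ω t s)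

def UniqueSolution (o : DL .ode) (t : Var) (Y : Var → DL .trm) : Prop :=
  ∀ (ω : State) (r : ℝ), 0 ≤ r → ∃ φ, UniqueFlow (den o) ω r φ ∧
    ∀ x ∈ o.evolved, ∀ s ∈ Set.Icc 0 r, φ s x = (den (Y x) : State → ℝ) (Function.update ω t s)

/-- The terms `Y` at time `a`. -/
def atTime (o : DL .ode) (t : Var) (Y : Var → DL .trm) (a : DL .trm) : Var → DL .trm :=
  fun x => if x ∈ o.evolved then (Y x).subst (single t a) else .var x

/-- `∀ s (0 ≤ s ∧ s ≤ a → Q)` -/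
def upTo (s : Var) (a : DL .trm) (Q : DL .fml) : DL .fml :=
  .all s (.imp (.and (.cmp .le (.num 0) (.var s)) (.cmp .le (.var s) a)) Q)

noncomputable def solTrace (o : DL .ode) (Y : Var → DL .trm) (H : Trace) : Trace :=
  o.evolved.toList.map (fun x => .sub x (Y x)) ++ H

/-! Proof checking -/

/-- `Checks Γ H sp Δ H'`: the structured proof `sp` checks and proves the sequent `Γ ⊢ Δ`,
transforming the trace `H` into `H'`. -/
inductive Checks : Ctx → Trace → SP → List (DL .fml) → Trace → Prop
  | implicit {Γ H H' sp φ ψ Δ} (hi : Implicit φ ψ) (h : Checks Γ H sp (ψ :: Δ) H') :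
      Checks Γ H sp (φ :: Δ) H'
  | sLet {Γ Γ₁ : Ctx} {H H' : Trace} {k : Kind} {p : Pat k} {e : XExpr k} {e' : DL k} {sp Δ}
      (he : expand Γ H none e = some e') (hm : pmatch H p e' Γ = some Γ₁)
      (h : Checks Γ₁ H sp Δ H') : Checks Γ H (.sLet p e sp) Δ H'
  | flet {Γ H H' t X e m now sp Δ} (he : mobilize Γ H t e = some m) (hn : now ∉ stateNames H)
      (h : Checks (.fabbr X m :: Γ) (.state now :: H) sp Δ H') :
      Checks Γ H (.flet t X e sp) Δ H'
  | note {Γ H H' x f ψ sp Δ} (hf : FPChecks Γ H f ψ)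
      (h : Checks (.hyp (some x) ψ :: Γ) H sp Δ H') : Checks Γ H (.note x f sp) Δ H'
  | sHave {Γ H H₁ H' x e ψ sp₁ sp₂ Δ} (he : expand Γ H none e = some ψ)
      (h₁ : Checks Γ H sp₁ [ψ] H₁) (h₂ : Checks (.hyp (some x) ψ :: Γ) H sp₂ Δ H') :
      Checks Γ H (.sHave x e sp₁ sp₂) Δ H'
  | sShow {Γ H p ps fs m φ Δ} (hm : (pmatch H p φ Γ).isSome)
      (hf : ∀ f ∈ fs, ∃ ψ, FPChecks Γ H f ψ) (h : m.Proves (Used Γ H ps fs) φ Δ) :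
      Checks Γ H (.sShow p ps fs m) (φ :: Δ) H
  | state {Γ H H' t sp Δ} (h : Checks Γ (.state t :: H) sp Δ H') : Checks Γ H (.state t sp) Δ H'
  | focusL {Γ₁ Γ₂ n H H₁ p φ sp Δ} (hm : (pmatch H p φ (Γ₁ ++ .hyp n φ :: Γ₂)).isSome)
      (h : Checks (Γ₁ ++ Γ₂) H sp (.not φ :: Δ) H₁) :
      Checks (Γ₁ ++ .hyp n φ :: Γ₂) H (.focus p sp) Δ H
  | focusR {Γ H H₁ p φ sp Δ₁ Δ₂} (hm : (pmatch H p φ Γ).isSome)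
      (h : Checks Γ H sp (φ :: (Δ₁ ++ Δ₂)) H₁) :
      Checks Γ H (.focus p sp) (Δ₁ ++ φ :: Δ₂) H
  -- First-order connectives and tests
  | assumeTest {Γ Γ₁ H H' x p ψ φ sp Δ} (hm : pmatch H p ψ Γ = some Γ₁)
      (h : Checks (.hyp (some x) ψ :: Γ₁) H sp (φ :: Δ) H') :
      Checks Γ H (.assume x p sp) (.box (.test ψ) φ :: Δ) H'
  | assumeImp {Γ Γ₁ H H' x p ψ φ sp Δ} (hm : pmatch H p ψ Γ = some Γ₁)
      (h : Checks (.hyp (some x) ψ :: Γ₁) H sp (φ :: Δ) H') :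
      Checks Γ H (.assume x p sp) (.imp ψ φ :: Δ) H'
  | caseAnd {Γ Γ₁ H H₁ H₂ p q φ ψ sp₁ sp₂ Δ}
      (hm : pmatch H (.and p q) (.and φ ψ) Γ = some Γ₁)
      (h₁ : Checks Γ₁ H sp₁ (φ :: Δ) H₁) (h₂ : Checks Γ₁ H sp₂ (ψ :: Δ) H₂) :
      Checks Γ H (.caseAnd p q sp₁ sp₂) (.and φ ψ :: Δ) H
  | caseOr {Γ Γ₁ H H' p q φ ψ sp Δ} (hm : pmatch H (.or p q) (.or φ ψ) Γ = some Γ₁)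
      (h : Checks Γ₁ H sp (φ :: ψ :: Δ) H') :
      Checks Γ H (.caseOr p q sp) (.or φ ψ :: Δ) H'
  | caseIff {Γ Γ₁ H H₁ H₂ p q φ ψ sp₁ sp₂ Δ}
      (hm : pmatch H (.iff p q) (.iff φ ψ) Γ = some Γ₁)
      (h₁ : Checks (.hyp none φ :: Γ₁) H sp₁ (ψ :: Δ) H₁)
      (h₂ : Checks (.hyp none ψ :: Γ₁) H sp₂ (φ :: Δ) H₂) :
      Checks Γ H (.caseIff p q sp₁ sp₂) (.iff φ ψ :: Δ) H
  -- Assignments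
  | boxSub {Γ H H' x e θ φ sp Δ} (he : expand Γ H none e = some θ) (ha : Adm (single x θ) φ)
      (h : Checks Γ (.sub x θ :: H) sp (φ.subst (single x θ) :: Δ) H') :
      Checks Γ H (.assign x e sp) (.box (.assign x θ) φ :: Δ) H'
  | boxEq {Γ H H' x e θ φ sp Δ xi f} (he : expand Γ H none e = some θ)
      (hf : GhostVar x xi f Γ H θ (.box (.assign x θ) φ) Δ)
      (h : Checks (.hyp none (.cmp .eq (.var x) (θ.rename f)) :: renameCtx f Γ)
        (.eq x ⟨xi, x.primes⟩ θ :: H) sp (φ :: renameAll f Δ) H') :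
      Checks Γ H (.assign x e sp) (.box (.assign x θ) φ :: Δ) H'
  | boxAny {Γ H H' x φ sp Δ xi f} (hf : GhostVar x xi f Γ H (.num 0) (.box (.random x) φ) Δ)
      (h : Checks (renameCtx f Γ) (.any x ⟨xi, x.primes⟩ :: H) sp (φ :: renameAll f Δ) H') :
      Checks Γ H (.assignAny x sp) (.box (.random x) φ :: Δ) H'
  | diaSub {Γ H H' x e θ φ sp Δ} (he : expand Γ H none e = some θ) (ha : Adm (single x θ) φ)
      (h : Checks Γ (.sub x θ :: H) sp (φ.subst (single x θ) :: Δ) H') :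
      Checks Γ H (.assign x e sp) (.dia (.assign x θ) φ :: Δ) H'
  | diaEq {Γ H H' x e θ φ sp Δ xi f} (he : expand Γ H none e = some θ)
      (hf : GhostVar x xi f Γ H θ (.dia (.assign x θ) φ) Δ)
      (h : Checks (.hyp none (.cmp .eq (.var x) (θ.rename f)) :: renameCtx f Γ)
        (.eq x ⟨xi, x.primes⟩ θ :: H) sp (φ :: renameAll f Δ) H') :
      Checks Γ H (.assign x e sp) (.dia (.assign x θ) φ :: Δ) H'
  | diaAny {Γ H H' x e θ φ sp Δ} (he : expand Γ H none e = some θ) (ha : Adm (single x θ) φ)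
      (h : Checks Γ (.sub x θ :: H) sp (φ.subst (single x θ) :: Δ) H') :
      Checks Γ H (.assignWit x e sp) (.dia (.random x) φ :: Δ) H'
  -- Choices, repetitions, conjunctions after a box
  | boxChoice {Γ Γ₁ Γ₂ : Ctx} {H H₁ H₂} {p q : Pat .prg} {a b φ sp₁ sp₂ Δ}
      (hp : pmatch H p a Γ = some Γ₁) (hq : pmatch H q b Γ = some Γ₂)
      (h₁ : Checks Γ₁ H sp₁ (.box a φ :: Δ) H₁) (h₂ : Checks Γ₂ H sp₂ (.box b φ :: Δ) H₂) :
      Checks Γ H (.cases p q sp₁ sp₂) (.box (.choice a b) φ :: Δ) H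
  | boxAnd {Γ Γ₁ Γ₂ : Ctx} {H H₁ H₂} {p q : Pat .fml} {a φ ψ sp₁ sp₂ Δ}
      (hp : pmatch H p φ Γ = some Γ₁) (hq : pmatch H q ψ Γ = some Γ₂)
      (h₁ : Checks Γ₁ H sp₁ (.box a φ :: Δ) H₁) (h₂ : Checks Γ₂ H sp₂ (.box a ψ :: Δ) H₂) :
      Checks Γ H (.cases p q sp₁ sp₂) (.box a (.and φ ψ) :: Δ) H
  | boxIter {Γ Γ₁ Γ₂ : Ctx} {H H₁ H₂} {p : Pat .fml} {q : Pat .prg} {a φ sp₁ sp₂ Δ}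
      (hp : pmatch H p φ Γ = some Γ₁) (hq : pmatch H q a Γ = some Γ₂)
      (h₁ : Checks Γ₁ H sp₁ (φ :: Δ) H₁)
      (h₂ : Checks Γ₂ H sp₂ (.box a (.box (.star a) φ) :: Δ) H₂) :
      Checks Γ H (.cases p q sp₁ sp₂) (.box (.star a) φ :: Δ) H
  | diaChoice {Γ Γ₁ Γ₂ : Ctx} {H H₁ p q a b φ sp Δ}
      (hp : pmatch H p a Γ = some Γ₁) (hq : pmatch H q b Γ = some Γ₂)
      (h : Checks Γ H sp (.dia a φ :: .dia b φ :: Δ) H₁) :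
      Checks Γ H (.caseDia p q sp) (.dia (.choice a b) φ :: Δ) H
  | diaIter {Γ Γ₁ Γ₂ : Ctx} {H H' p q a φ sp Δ}
      (hp : pmatch H p a Γ = some Γ₁) (hq : pmatch H q φ Γ = some Γ₂)
      (h : Checks Γ₂ H sp (φ :: .dia a (.dia (.star a) φ) :: Δ) H') :
      Checks Γ H (.caseDiaIter p q sp) (.dia (.star a) φ :: Δ) H'
  -- Composition
  | boxAfter {Γ H H₁ H' e ψ a φ sp₁ sp₂ Δ f} (he : expand Γ H none e = some ψ)
      (hf : Ghosting (a.bv.image Var.name) f Γ (H₁ ++ H) (ψ :: .box a φ :: Δ))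
      (h₁ : Checks Γ H sp₁ (.box a ψ :: Δ) H₁)
      (h₂ : Checks (.hyp none ψ :: renameCtx f Γ) (absTrace f a H₁) sp₂ (φ :: renameAll f Δ) H') :
      Checks Γ H (.after e sp₁ sp₂) (.box a φ :: Δ) H'
  | diaAfter {Γ H H₁ H' e ψ a φ sp₁ sp₂ Δ f} (he : expand Γ H none e = some ψ)
      (hf : Ghosting (a.bv.image Var.name) f Γ (H₁ ++ H) (ψ :: .dia a φ :: Δ))
      (h₁ : Checks Γ H sp₁ (.dia a ψ :: Δ) H₁)
      (h₂ : Checks (.hyp none ψ :: renameCtx f Γ) (absTrace f a H₁) sp₂ (φ :: renameAll f Δ) H') :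
      Checks Γ H (.after e sp₁ sp₂) (.dia a φ :: Δ) H'
  -- Loops
  | invLoop {Γ H H₁ H₂ H₃ x e ψ a φ pre ind ip Δ f} {Js : List (Ident × DL .fml)}
      (he : expand (invs Js ++ Γ) H none e = some ψ)
      (hf : Ghosting (a.bv.image Var.name) f (boxedInvs (.star a) Js ++ Γ) H
        (ψ :: .box (.star a) φ :: Δ))
      (h₁ : Checks (invs Js ++ Γ) H pre (ψ :: Δ) H₁)
      (h₂ : Checks (.hyp none ψ :: (invs Js ++ renameCtx f Γ)) (absTrace f a H) ind
        (.box a ψ :: renameAll f Δ) H₂)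
      (h₃ : Checks (boxedInvs (.star a) ((x, ψ) :: Js) ++ Γ) H ip (.box (.star a) φ :: Δ) H₃) :
      Checks (boxedInvs (.star a) Js ++ Γ) H (.inv x e pre ind ip) (.box (.star a) φ :: Δ) H
  | finLoop {Γ H H' a φ sp Δ f} {Js : List (Ident × DL .fml)}
      (hf : Ghosting (a.bv.image Var.name) f (boxedInvs (.star a) Js ++ Γ) H
        (.box (.star a) φ :: Δ))
      (h : Checks (invs Js ++ renameCtx f Γ) (absTrace f a H) sp (φ :: renameAll f Δ) H') :
      Checks (boxedInvs (.star a) Js ++ Γ) H (.finally sp) (.box (.star a) φ :: Δ) H'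
  | con {Γ H H₁ H₂ H₃ x e ψ a φ pre ind post Δ f}
      (he : expand Γ H none e = some ψ) (hx : Fresh x Γ H (.dia (.star a) φ :: Δ))
      (hf : Ghosting (a.bv.image Var.name) f Γ H (ψ :: .dia (.star a) φ :: Δ)) (hfx : f x = x)
      (ha : Adm (single ⟨x, 0⟩ (.sub (.var ⟨x, 0⟩) (.num 1))) ψ)
      (h₁ : Checks Γ H pre (.ex ⟨x, 0⟩ ψ :: Δ) H₁)
      (h₂ : Checks (.hyp none (.cmp .gt (.var ⟨x, 0⟩) (.num 0)) :: .hyp none ψ :: renameCtx f Γ)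
        (absTrace f a H) ind
        (.dia a (ψ.subst (single ⟨x, 0⟩ (.sub (.var ⟨x, 0⟩) (.num 1)))) :: renameAll f Δ) H₂)
      (h₃ : Checks (.hyp none (.cmp .le (.var ⟨x, 0⟩) (.num 0)) :: .hyp none ψ :: renameCtx f Γ)
        (absTrace f a H) post [.dia (.star a) φ] H₃) :
      Checks Γ H (.con x e pre ind post) (.dia (.star a) φ :: Δ) H
  -- Differential equations
  | invOde {Γ H H₁ H₂ H' x e ψ ψ' o Q φ pre ind ip Δ f} {Js : List (Ident × DL .fml)}
      {vs : List Var}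
      (he : expand (invs Js ++ Γ) H none e = some ψ) (hψ : dform ψ = some ψ')
      (hf : Ghosting (o.bv.image Var.name) f (boxedInvs (.evolve o Q) Js ++ Γ) H
        (ψ :: .box (.evolve o Q) φ :: Δ))
      (hd : Disjoint o.evolvedPrimes ψ.vars ∧ ∀ j ∈ Js, Disjoint o.evolvedPrimes j.2.vars)
      (hd' : Disjoint (ψ.vars.image Var.prime) ψ.vars)
      (hr : RegularAlong (boxedInvs (.evolve o Q) Js ++ Γ) Δ (.evolve o Q) ψ)
      (hv : ∀ v, v ∈ vs ↔ v ∈ ψ.fv ∧ v ∉ o.evolved)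
      (h₁ : Checks (invs Js ++ Γ) H pre (ψ :: Δ) H₁)
      (h₂ : Checks (.hyp none Q :: (invs Js ++ renameCtx f Γ)) (absTrace f (.evolve o Q) H) ind
        (boxAssigns (o.eqns ++ vs.map fun v => (v, .num 0)) ψ' :: renameAll f Δ) H₂)
      (h₃ : Checks (boxedInvs (.evolve o Q) ((x, ψ) :: Js) ++ Γ) H ip
        (.box (.evolve o Q) φ :: Δ) H') :
      Checks (boxedInvs (.evolve o Q) Js ++ Γ) H (.inv x e pre ind ip)
        (.box (.evolve o Q) φ :: Δ) H'
  | finOde {Γ H H' o Q φ sp Δ f} {Js : List (Ident × DL .fml)}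
      (hf : Ghosting (o.bv.image Var.name) f (boxedInvs (.evolve o Q) Js ++ Γ) H
        (.box (.evolve o Q) φ :: Δ))
      (h : Checks (.hyp none Q :: (invs Js ++ renameCtx f Γ)) (absTrace f (.evolve o Q) H) sp
        (φ :: renameAll f Δ) H') :
      Checks (boxedInvs (.evolve o Q) Js ++ Γ) H (.finally sp) (.box (.evolve o Q) φ :: Δ) H'
  | ghostOde {Γ H H' y e₁ e₀ θ₁ θ₀ o Q φ ip Δ} {Js : List (Ident × DL .fml)} {a b : DL .trm}
      (he₁ : expand (boxedInvs (.evolve o Q) Js ++ Γ) H none e₁ = some θ₁)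
      (he₀ : expand (boxedInvs (.evolve o Q) Js ++ Γ) H none e₀ = some θ₀)
      (hy : Fresh y (boxedInvs (.evolve o Q) Js ++ Γ) H (.box (.evolve o Q) φ :: Δ))
      (hy₀ : y ∉ θ₀.names)
      (hab : y ∉ a.names ∧ y ∉ b.names ∧ Disjoint o.evolvedPrimes a.fv ∧
        Disjoint o.evolvedPrimes b.fv)
      (hl : ∀ ω : State, (den θ₁ : State → ℝ) ω = den a ω * ω ⟨y, 0⟩ + den b ω)
      (hr : RegularAlong (boxedInvs (.evolve o Q) Js ++ Γ) Δ (.evolve o Q) a ∧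
        RegularAlong (boxedInvs (.evolve o Q) Js ++ Γ) Δ (.evolve o Q) b)
      (h : Checks (.hyp none (.cmp .eq (.var ⟨y, 0⟩) θ₀) :: Γ) H ip
        (.box (.evolve (.comma o (.deq ⟨y, 0⟩ θ₁)) Q) φ :: Δ) H') :
      Checks (boxedInvs (.evolve o Q) Js ++ Γ) H (.ghost y e₁ e₀ ip)
        (.box (.evolve o Q) φ :: Δ) H'
  | solve {Γ Γ₁ Γ₂ Γ₃ H H' p xt pt xd pd o Q φ sp Δ t s} {Y : Var → DL .trm}
      (hm₁ : pmatch H p (.evolve o Q) Γ = some Γ₁)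
      (hm₂ : pmatch H pt (.cmp .ge (.var ⟨t, 0⟩) (.num 0)) Γ₁ = some Γ₂)
      (hm₃ : pmatch H pd Q Γ₂ = some Γ₃)
      (ht : Fresh t Γ H (.box (.evolve o Q) φ :: Δ)) (hs : Fresh s Γ H (.box (.evolve o Q) φ :: Δ))
      (hst : s ≠ t)
      (hY : ∀ x ∈ o.evolved, s ∉ (Y x).names ∧ Adm (single ⟨t, 0⟩ (.var ⟨s, 0⟩)) (Y x))
      (hsol : Solution o ⟨t, 0⟩ Y) (hQ : Disjoint o.evolvedPrimes Q.vars)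
      (hφ : Disjoint o.evolvedPrimes φ.vars)
      (haQ : Adm (atTime o ⟨t, 0⟩ Y (.var ⟨s, 0⟩)) Q)
      (haφ : Adm (atTime o ⟨t, 0⟩ Y (.var ⟨t, 0⟩)) φ)
      (h : Checks
        (.hyp (some xt) (.cmp .ge (.var ⟨t, 0⟩) (.num 0)) ::
          .hyp (some xd) (upTo ⟨s, 0⟩ (.var ⟨t, 0⟩)
            (Q.subst (atTime o ⟨t, 0⟩ Y (.var ⟨s, 0⟩)))) :: Γ₃)
        (solTrace o (atTime o ⟨t, 0⟩ Y (.var ⟨t, 0⟩)) H) sp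
        (φ.subst (atTime o ⟨t, 0⟩ Y (.var ⟨t, 0⟩)) :: Δ) H') :
      Checks Γ H (.solve p xt pt xd pd sp) (.box (.evolve o Q) φ :: Δ) H'
  | dsolve {Γ Γ₁ Γ₂ H H₁ H' p e θ pd o Q φ sp₁ sp₂ Δ t s} {Y : Var → DL .trm}
      (hm₁ : pmatch H p (.evolve o Q) Γ = some Γ₁) (hm₂ : pmatch H pd Q Γ₁ = some Γ₂)
      (he : expand Γ H none e = some θ)
      (ht : Fresh t Γ H (.dia (.evolve o Q) φ :: Δ)) (hs : Fresh s Γ H (.dia (.evolve o Q) φ :: Δ))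
      (hst : s ≠ t) (hθ : s ∉ θ.names ∧ t ∉ θ.names)
      (hY : ∀ x ∈ o.evolved, s ∉ (Y x).names ∧ Adm (single ⟨t, 0⟩ (.var ⟨s, 0⟩)) (Y x))
      (hsol : UniqueSolution o ⟨t, 0⟩ Y) (hQ : Disjoint o.evolvedPrimes Q.vars)
      (hφ : Disjoint o.evolvedPrimes φ.vars)
      (haQ : Adm (atTime o ⟨t, 0⟩ Y (.var ⟨s, 0⟩)) Q)
      (haφ : Adm (atTime o ⟨t, 0⟩ Y θ) φ)
      (h₁ : Checks Γ H sp₁ (.and (.cmp .ge θ (.num 0))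
        (upTo ⟨s, 0⟩ θ (Q.subst (atTime o ⟨t, 0⟩ Y (.var ⟨s, 0⟩)))) :: Δ) H₁)
      (h₂ : Checks Γ₂ (solTrace o (atTime o ⟨t, 0⟩ Y θ) H) sp₂
        (φ.subst (atTime o ⟨t, 0⟩ Y θ) :: Δ) H') :
      Checks Γ H (.dsolve p e pd sp₁ sp₂) (.dia (.evolve o Q) φ :: Δ) H'

/-! Nominalization -/

/-- A program as its first component, and the rest if there is one. -/
def uncons : DL .prg → DL .prg × Option (DL .prg)
  | .seq a b => ((uncons a).1, some ((uncons a).2.elim b fun c => .seq c b))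
  | a => (a, none)

/-- The remaining program; the trivial test when nothing remains. -/
def rest : Option (DL .prg) → DLh .prg
  | none => .test (.cmp .eq (.num 0) (.num 0))
  | some a => a.embed

/-- Nominalization of the program that remains to be executed. -/
def nomRest : SP → Option (DL .prg) → DLh .prg
  | .state t sp, o => .seq (.test (.leaf (.state t))) (nomRest sp o)
  | .sHave _ _ _ sp, o => nomRest sp o
  | .sLet _ _ sp, o => nomRest sp o
  | .flet _ _ _ sp, o => nomRest sp o
  | .note _ _ sp, o => nomRest sp o
  | .inv _ _ _ _ ip, o => nomRest ip o
  | .ghost _ _ _ ip, o => nomRest ip o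
  | .after _ sp₁ sp₂, some (.seq a b) => .seq (nomRest sp₁ (some a)) (nomRest sp₂ (some b))
  | .after _ sp₁ sp₂, some a => .seq (nomRest sp₁ (some a)) (nomRest sp₂ none)
  | .assume _ _ sp, some a =>
      match uncons a with
      | (.test φ, r) => .seq (embed (.test φ)) (nomRest sp r)
      | _ => a.embed
  | .assign _ _ sp, some a =>
      match uncons a with
      | (.assign x θ, r) => .seq (embed (.assign x θ)) (nomRest sp r)
      | _ => a.embed
  | .assignAny _ sp, some a =>
      match uncons a with
      | (.random x, r) => .seq (embed (.random x)) (nomRest sp r)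
      | _ => a.embed
  | .solve _ _ _ _ _ sp, some a =>
      match uncons a with
      | (.evolve o q, r) => .seq (embed (.evolve o q)) (nomRest sp r)
      | _ => a.embed
  | .finally sp, some a =>
      match uncons a with
      | (.star b, r) => .seq (embed (.star b)) (nomRest sp r)
      | (.evolve o q, r) => .seq (embed (.evolve o q)) (nomRest sp r)
      | _ => a.embed
  | _, o => rest o

/-- `nom(a, sp)`: the program `a` with a test for each state that `sp` names. -/
def nom (a : DL .prg) (sp : SP) : DLh .prg := nomRest sp (some a)

end Kaisar

namespace Kaisar

open Kaisar.Expr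

/-! Typed readings of the denotation -/

/-! Nominalization inserts nothing but tests into a program, and a test can only discard runs.
Hence, whatever the state names mean, every run of `nom α sp` is a run of `α`
(`runRest_of_nomRest`). A box is antitone in the runs of its program, so `[nom α sp]φ` follows from
`[α]φ`. The dynamic trace plays no further role, and formulas without names mean the same in dLh as
in dL (`denh_embed`). What remains is the soundness of the calculus in plain dL, `Checks.sound`:
whatever checks is valid.

Soundness is an induction on the checking derivation. Static traces matter only for expansion,
matching and freshness, and `facts_pmatch` shows that matching leaves the assumptions alone, so each
rule becomes a statement about validity of sequents. Classically the side formulas may be taken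
false (`sound_cons_iff`).

Three semantic tools carry the rules. Admissible substitution amounts to a change of state
(`substOK`), and coincidence is its instance for the identity. Uniform renaming is an isomorphism of
states (`renameOK`). Together they justify ghosts: `ghostState` is a single state in which unrenamed
formulas speak about the end of a program and renamed ones about its beginning, and `Ghosting.elim`
and `GhostVar.elim` provide it to the rules for assignments, composition, loops and invariants.

The rules for differential equations rest on analysis. A regular term is differentiable along a
flow, with the value of its differential as derivative (`hasDerivWithinAt_val`), which together with
monotonicity yields differential invariants (`dform_invariant`). A linear ghost equation is solvable
for as long as the original flow lasts (`exists_ghost_flow`). Uniqueness of flows identifies the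
explicit solutions used by *solve*. -/

noncomputable def val (e : DL .trm) : State → ℝ := den e

/-- `Den` is a match on the kind. Fixing the kind turns denotations into functions and relations in
the syntactic sense, with a head symbol that rewriting can use. -/
def Sat (p : DL .fml) : State → Prop := den p

def Run (a : DL .prg) : State → State → Prop := den a

noncomputable def field (o : DL .ode) : List (Var × (State → ℝ)) := den o

section Unfold

variable (a b : DL .trm) (p q : DL .fml) (α β : DL .prg) (x : Var) (ω ν : State)

@[simp] theorem val_var : val (.var x) ω = ω x := rfl
@[simp] theorem val_num (r : ℚ) : val (.num r) ω = r := rfl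
@[simp] theorem val_add : val (.add a b) ω = val a ω + val b ω := rfl
@[simp] theorem val_sub : val (.sub a b) ω = val a ω - val b ω := rfl
@[simp] theorem val_mul : val (.mul a b) ω = val a ω * val b ω := rfl
@[simp] theorem val_div : val (.div a b) ω = val a ω / val b ω := rfl
@[simp] theorem val_pow (r : ℚ) : val (.pow a r) ω = val a ω ^ (r : ℝ) := rfl
theorem val_diff : val (.diff a) ω =
    ∑ x ∈ a.fv, deriv (fun r => val a (Function.update ω x r)) (ω x) * ω x.prime := rfl
@[simp] theorem sat_cmp (c : Cmp) : Sat (.cmp c a b) ω ↔ c.Holds (val a ω) (val b ω) := Iff.rfl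
@[simp] theorem sat_and : Sat (.and p q) ω ↔ Sat p ω ∧ Sat q ω := Iff.rfl
@[simp] theorem sat_or : Sat (.or p q) ω ↔ Sat p ω ∨ Sat q ω := Iff.rfl
@[simp] theorem sat_not : Sat (.not p) ω ↔ ¬ Sat p ω := Iff.rfl
@[simp] theorem sat_imp : Sat (.imp p q) ω ↔ (Sat p ω → Sat q ω) := Iff.rfl
@[simp] theorem sat_iff : Sat (.iff p q) ω ↔ (Sat p ω ↔ Sat q ω) := Iff.rfl
@[simp] theorem sat_all : Sat (.all x p) ω ↔ ∀ r, Sat p (Function.update ω x r) := Iff.rfl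
@[simp] theorem sat_ex : Sat (.ex x p) ω ↔ ∃ r, Sat p (Function.update ω x r) := Iff.rfl
@[simp] theorem sat_box : Sat (.box α p) ω ↔ ∀ ν, Run α ω ν → Sat p ν := Iff.rfl
@[simp] theorem sat_dia : Sat (.dia α p) ω ↔ ∃ ν, Run α ω ν ∧ Sat p ν := Iff.rfl
@[simp] theorem run_assign : Run (.assign x a) ω ν ↔ ν = Function.update ω x (val a ω) := Iff.rfl
@[simp] theorem run_random : Run (.random x) ω ν ↔ ∃ r, ν = Function.update ω x r := Iff.rfl
@[simp] theorem run_test : Run (.test p) ω ν ↔ ω = ν ∧ Sat p ω := Iff.rfl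
@[simp] theorem run_seq : Run (.seq α β) ω ν ↔ ∃ μ, Run α ω μ ∧ Run β μ ν := Iff.rfl
@[simp] theorem run_choice : Run (.choice α β) ω ν ↔ Run α ω ν ∨ Run β ω ν := Iff.rfl
@[simp] theorem run_star : Run (.star α) ω ν ↔ Relation.ReflTransGen (Run α) ω ν := Iff.rfl
theorem run_evolve (o : DL .ode) : Run (.evolve o q) ω ν ↔ ∃ T : ℝ, 0 ≤ T ∧ ∃ φ : ℝ → State,
    UniqueFlow (field o) ω T φ ∧ (∀ s ∈ Set.Icc 0 T, Sat q (φ s)) ∧ ν = φ T := Iff.rfl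
@[simp] theorem field_comma (o o₂ : DL .ode) : field (.comma o o₂) = field o ++ field o₂ := rfl

end Unfold

/-! Static facts -/

/-- Terms bind nothing. Induction on an indexed family needs a variable kind, so `hk` selects one
kind and discards the other constructors; the device recurs below. -/
theorem fv_eq_vars {k : Kind} (e : DL k) (hk : k = .trm) : e.fv = e.vars := by
  induction e <;> simp_all [fv, Expr.vars]

theorem fv_trm (e : DL .trm) : e.fv = e.vars := fv_eq_vars e rfl

theorem subst_eq_self {k : Kind} (e : DL k) (σ : Var → DL .trm)
    (h : ∀ z ∈ e.vars, σ z = .var z) : e.subst σ = e := by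
  unfold subst
  induction e <;> simp_all [trav, Expr.vars]
  all_goals exact Empty.elim ‹_›

theorem subst_var {k : Kind} (e : DL k) : e.subst .var = e := subst_eq_self e _ fun _ _ => rfl

theorem adm_var {k : Kind} (e : DL k) : Adm .var e := by
  induction e <;> simp_all [Adm, NoClash]

/-- The bridge between the syntactic bound variables and `Flow`, which quantifies over the equations
of a system. -/
theorem mem_bv_iff {k : Kind} (o : DL k) (hk : k = .ode) (z : Var) :
    z ∈ o.bv ↔ ∃ p ∈ o.eqns, z = p.1 ∨ z = p.1.prime := by
  induction o <;> simp_all [bv, Expr.eqns, or_and_right, exists_or]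
  all_goals exact Empty.elim ‹_›

theorem bv_subset_vars {k : Kind} (e : DL k) : e.bv ⊆ e.vars := by
  induction e <;> simp only [bv, Expr.vars] <;> grind

theorem field_eq {k : Kind} (o : DL k) (hk : k = .ode) :
    field (hk ▸ o) = o.eqns.map fun p => (p.1, val p.2) := by
  induction o <;> cases hk
  case deq => rfl
  case comma h₁ h₂ => simp [Expr.eqns, ← h₁, ← h₂]
  all_goals exact Empty.elim ‹_›

theorem eqns_subst {k : Kind} (o : DL k) (hk : k = .ode) (σ : Var → DL .trm) :
    (o.subst σ).eqns = o.eqns.map fun p => (p.1, p.2.subst σ) := by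
  unfold subst
  induction o <;> cases hk
  case deq => rfl
  case comma h₁ h₂ => simp [trav, Expr.eqns, ← h₁, ← h₂]
  all_goals exact Empty.elim ‹_›

theorem vars_of_mem_eqns {k : Kind} (o : DL k) (p : Var × DL .trm) (hp : p ∈ o.eqns) :
    p.1 ∈ o.vars ∧ p.1.prime ∈ o.vars ∧ p.2.vars ⊆ o.vars := by
  induction o <;> simp only [Expr.eqns, List.not_mem_nil] at hp
  case deq =>
    rw [List.mem_singleton.1 hp]
    simp [Expr.vars, Finset.subset_iff]
    tauto
  case comma h₁ h₂ =>
    simp only [Expr.vars]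
    rcases List.mem_append.1 hp with h | h
    · have := h₁ h; grind
    · have := h₂ h; grind

theorem val_congr_of {k : Kind} (e : DL k) (hk : k = .trm) (ω ν : State)
    (h : ∀ z ∈ e.vars, ω z = ν z) : val (hk ▸ e) ω = val (hk ▸ e) ν := by
  induction e generalizing ω ν <;> cases hk
  case diff a ih =>
    simp only [Expr.vars, Finset.mem_union] at h
    simp only [val_diff, fv_trm]
    refine Finset.sum_congr rfl fun x hx => ?_
    rw [h x (.inl hx), h x.prime (.inr (Finset.mem_image_of_mem _ hx))]
    congr 2
    funext r
    refine ih rfl _ _ fun z hz => ?_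
    by_cases hzx : z = x
    · simp [hzx]
    · simp [hzx, h z (.inl hz)]
  case leaf => exact Empty.elim ‹_›
  case un => exact Empty.elim ‹_›
  case bin => exact Empty.elim ‹_›
  all_goals
    simp only [Expr.vars, Finset.mem_union, Finset.mem_singleton, forall_eq] at h
    grind [val_var, val_num, val_add, val_sub, val_mul, val_div, val_pow]

theorem val_congr (e : DL .trm) {ω ν : State} (h : ∀ z ∈ e.vars, ω z = ν z) :
    val e ω = val e ν := val_congr_of e rfl ω ν h

theorem run_eq_off_bv {k : Kind} (a : DL k) (hk : k = .prg) {ω ν : State}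
    (h : Run (hk ▸ a) ω ν) (z : Var) (hz : z ∉ a.bv) : ν z = ω z := by
  induction a generalizing ω ν <;> cases hk
  case assign => simp_all [bv]
  case random => obtain ⟨r, rfl⟩ := h; simp_all [bv]
  case test => rw [h.1]
  case seq iha ihb =>
    obtain ⟨μ, h₁, h₂⟩ := h
    simp only [bv, Finset.mem_union, not_or] at hz
    rw [ihb rfl h₂ hz.2, iha rfl h₁ hz.1]
  case choice iha ihb =>
    simp only [bv, Finset.mem_union, not_or] at hz
    exact h.elim (fun h => iha rfl h hz.1) fun h => ihb rfl h hz.2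
  case star ih =>
    change Relation.ReflTransGen _ _ _ at h
    induction h with
    | refl => rfl
    | tail _ h₂ ih₂ => rw [ih rfl h₂ hz, ih₂]
  case evolve o q _ _ =>
    obtain ⟨T, hT, φ, hφ, -, rfl⟩ := (run_evolve _ _ _ _).1 h
    refine (hφ.1.2 T ⟨hT, le_rfl⟩).2 z ?_
    rw [field_eq o rfl]
    simp only [bv, mem_bv_iff o rfl] at hz
    grind
  all_goals exact Empty.elim ‹_›

theorem run_eq (a : DL .prg) {ω ν : State} (h : Run a ω ν) {z : Var} (hz : z ∉ a.bv) :
    ν z = ω z := run_eq_off_bv a rfl h z hz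

/-! Flows -/

open Classical in
/-- A flow with the variables that the equations `L` do not mention reset to their values in `ω`. -/
noncomputable def reset (L : List (Var × DL .trm)) (ω : State) (φ : ℝ → State) : ℝ → State :=
  fun s z => if ∃ p ∈ L, z = p.1 ∨ z = p.1.prime then φ s z else ω z

/-- Systems on the same variables whose right-hand sides agree are solved by the same flows, up to
the variables that they do not mention. -/
theorem Flow.reset {L : List (Var × DL .trm)} {f g : DL .trm → State → ℝ} {ω ν : State}
    (h₀ : ∀ p ∈ L, ω p.1 = ν p.1)
    (hfg : ∀ μ, ∀ p ∈ L, (∀ z, (∀ p ∈ L, z ≠ p.1 ∧ z ≠ p.1.prime) → μ z = ω z) →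
      f p.2 μ = g p.2 (fun z => reset L ν (fun _ => μ) 0 z))
    {T : ℝ} {φ : ℝ → State} (h : Flow (L.map fun p => (p.1, f p.2)) ω T φ) :
    Flow (L.map fun p => (p.1, g p.2)) ν T (reset L ν φ) := by
  simp only [Flow, List.forall_mem_map] at h ⊢
  have e₁ : ∀ p ∈ L, ∀ s, Kaisar.reset L ν φ s p.1 = φ s p.1 := fun p hp s =>
    if_pos ⟨p, hp, .inl rfl⟩
  have e₂ : ∀ p ∈ L, ∀ s, Kaisar.reset L ν φ s p.1.prime = φ s p.1.prime := fun p hp s =>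
    if_pos ⟨p, hp, .inr rfl⟩
  refine ⟨fun p hp => ?_, fun s hs => ⟨fun p hp => ?_, fun z hz => ?_⟩⟩
  · rw [e₁ p hp, h.1 p hp, h₀ p hp]
  · obtain ⟨h₁, h₂⟩ := (h.2 s hs).1 p hp
    have := hfg (φ s) p hp (h.2 s hs).2
    have e₃ : (fun z => Kaisar.reset L ν (fun _ => φ s) 0 z) = Kaisar.reset L ν φ s := rfl
    rw [e₃] at this
    rw [e₂ p hp, h₁, this]
    refine ⟨rfl, ?_⟩
    simp only [e₁ p hp]
    rwa [← this]
  · exact if_neg (by grind)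

/-- A competing solution of the second system is carried back by `Flow.reset` with the roles
exchanged. Uniqueness for the first system settles the mentioned variables; the others are constant.
-/
theorem UniqueFlow.reset {L : List (Var × DL .trm)} {f g : DL .trm → State → ℝ} {ω ν : State}
    (h₀ : ∀ p ∈ L, ω p.1 = ν p.1)
    (hfg : ∀ μ, ∀ p ∈ L, (∀ z, (∀ p ∈ L, z ≠ p.1 ∧ z ≠ p.1.prime) → μ z = ω z) →
      f p.2 μ = g p.2 (fun z => Kaisar.reset L ν (fun _ => μ) 0 z))
    {T : ℝ} {φ : ℝ → State} (h : UniqueFlow (L.map fun p => (p.1, f p.2)) ω T φ) :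
    UniqueFlow (L.map fun p => (p.1, g p.2)) ν T (Kaisar.reset L ν φ) := by
  refine ⟨h.1.reset h₀ hfg, fun s hs ψ hψ r hr => ?_⟩
  have hψ' : Flow (L.map fun p => (p.1, f p.2)) ω s (Kaisar.reset L ω ψ) := by
    refine hψ.reset (fun p hp => (h₀ p hp).symm) fun μ p hp hμ => ?_
    -- `hfg` translates in one direction only. Resetting `μ` to `ω` and then back to `ν` returns
    -- `μ`, which agrees with `ν` off the system; this gives the other direction.
    have e := hfg (Kaisar.reset L ω (fun _ => μ) 0) p hp fun z hz => if_neg (by grind)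
    refine Eq.trans (congrArg _ ?_) e.symm
    funext z
    unfold Kaisar.reset
    by_cases hz : ∃ p ∈ L, z = p.1 ∨ z = p.1.prime
    · simp [hz]
    · simp only [hz, if_false]
      exact hμ z (by grind)
  have := h.2 s hs _ hψ' r hr
  funext z
  by_cases hz : ∃ p ∈ L, z = p.1 ∨ z = p.1.prime
  · have := congrFun this z
    simpa [Kaisar.reset, hz] using this
  · have := (hψ.2 r hr).2 z (by simp only [List.forall_mem_map]; grind)
    rw [this, Kaisar.reset, if_neg hz]

/-! Substitution -/

/-- The state `ν` has on `V` the values of the terms `σ` in `ω`. -/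
def Matches (σ : Var → DL .trm) (V : Finset Var) (ω ν : State) : Prop :=
  ∀ z ∈ V, ν z = val (σ z) ω

theorem Matches.mono {σ V W ω ν} (h : Matches σ W ω ν) (hVW : V ⊆ W) : Matches σ V ω ν :=
  fun z hz => h z (hVW hz)

theorem Expr.NoClash.mono {σ B C V W} (h : NoClash σ C W) (hB : B ⊆ C) (hV : V ⊆ W) :
    NoClash σ B V := fun z hz hσ =>
  ⟨fun hz' => (h z (hV hz) hσ).1 (hB hz'), (h z (hV hz) hσ).2.mono_right hB⟩

theorem Expr.NoClash.union {σ B V W} (h₁ : NoClash σ B V) (h₂ : NoClash σ B W) :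
    NoClash σ B (V ∪ W) := fun z hz =>
  (Finset.mem_union.1 hz).elim (h₁ z) (h₂ z)

/-- Changing the variables `B` in the same way keeps states matched. -/
theorem Matches.of_noClash {σ B V ω ν ω' ν'} (h : Matches σ V ω ν) (hc : NoClash σ B V)
    (hω : ∀ z, z ∉ B → ω' z = ω z) (hν : ∀ z ∈ V, z ∉ B → ν' z = ν z)
    (hB : ∀ z ∈ B, ν' z = ω' z) : Matches σ V ω' ν' := by
  intro z hz
  by_cases hσ : σ z = .var z
  · rw [hσ, val_var]
    by_cases hzB : z ∈ B
    · exact hB z hzB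
    · rw [hν z hz hzB, hω z hzB, h z hz, hσ, val_var]
  · obtain ⟨h₁, h₂⟩ := hc z hz hσ
    rw [hν z hz h₁, h z hz]
    refine val_congr _ fun y hy => (hω y ?_).symm
    rw [← fv_trm] at hy
    exact Finset.disjoint_left.1 h₂ hy

/-- The meaning of substitution, by kind. -/
def SubstOK (σ : Var → DL .trm) : {k : Kind} → DL k → Prop
  | .trm, e => ∀ ω ν, Matches σ e.vars ω ν → val (e.subst σ) ω = val e ν
  | .fml, p => ∀ ω ν, Matches σ p.vars ω ν → (Sat (p.subst σ) ω ↔ Sat p ν)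
  | .ode, o => ∀ p ∈ o.eqns, ∀ ω ν, Matches σ p.2.vars ω ν → val (p.2.subst σ) ω = val p.2 ν
  | .prg, a => ∀ V ω ν, NoClash σ a.bv V → Matches σ (V ∪ a.vars) ω ν →
      (∀ ω', Run (a.subst σ) ω ω' → ∃ ν', Run a ν ν' ∧ Matches σ V ω' ν') ∧
      ∀ ν', Run a ν ν' → ∃ ω', Run (a.subst σ) ω ω' ∧ Matches σ V ω' ν'

theorem Matches.update {σ x V ω ν} (h : Matches σ V ω ν) (hc : NoClash σ {x} V) (r : ℝ) :
    Matches σ V (Function.update ω x r) (Function.update ν x r) :=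
  h.of_noClash hc (fun z hz => Function.update_of_ne (by simpa using hz) _ _)
    (fun z _ hz => Function.update_of_ne (by simpa using hz) _ _)
    fun z hz => by rw [Finset.mem_singleton.1 hz]; simp

theorem reset_of_mem {o : DL .ode} {ω : State} {φ : ℝ → State} {s : ℝ} {z : Var}
    (hz : z ∈ o.bv) : reset o.eqns ω φ s z = φ s z := if_pos ((mem_bv_iff o rfl z).1 hz)

theorem reset_of_notMem {o : DL .ode} {ω : State} {φ : ℝ → State} {s : ℝ} {z : Var}
    (hz : z ∉ o.bv) : reset o.eqns ω φ s z = ω z :=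
  if_neg (mt (mem_bv_iff o rfl z).2 hz)

theorem UniqueFlow.eq_off_bv {o : DL .ode} {f : DL .trm → State → ℝ} {ω : State} {T s : ℝ}
    {φ : ℝ → State} (h : UniqueFlow (o.eqns.map fun p => (p.1, f p.2)) ω T φ)
    (hs : s ∈ Set.Icc 0 T) (z : Var) (hz : z ∉ o.bv) : φ s z = ω z := by
  rw [mem_bv_iff o rfl] at hz
  refine (h.1.2 s hs).2 z ?_
  simp only [List.forall_mem_map]
  grind

/-- `NoClash` makes `σ` trivial on the bound variables that occur, so both evolutions start with
equal values for the evolved variables. A flow of one system, reset off its equations, is then a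
flow of the other, and states at equal times stay matched because both change exactly the bound
variables, in the same way. -/
theorem substOK_evolve {σ : Var → DL .trm} {o : DL .ode} {q : DL .fml}
    (hc : NoClash σ o.bv (o.vars ∪ q.vars)) (ho : SubstOK σ o) (hq : SubstOK σ q) :
    SubstOK σ (.evolve o q) := by
  intro V ω ν hV h
  simp only [bv] at hV
  replace h : Matches σ (V ∪ (o.vars ∪ q.vars)) ω ν := h
  have hc' := hV.union hc
  have hov : ∀ p ∈ o.eqns, p.2.vars ⊆ o.vars := fun p hp => (vars_of_mem_eqns o p hp).2.2
  have hbv : ∀ p ∈ o.eqns, p.1 ∈ o.bv := fun p hp => (mem_bv_iff o rfl _).2 ⟨p, hp, .inl rfl⟩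
  have h₀ : ∀ p ∈ o.eqns, ω p.1 = ν p.1 := by
    intro p hp
    have hp' := (vars_of_mem_eqns o p hp).1
    have : σ p.1 = .var p.1 := by
      by_contra hne
      exact (hc p.1 (by simp [hp']) hne).1 (hbv p hp)
    rw [h p.1 (by simp [hp']), this, val_var]
  have hm : ∀ μ κ : State, (∀ z, z ∉ o.bv → μ z = ω z) → (∀ z, z ∉ o.bv → κ z = ν z) →
      (∀ z ∈ o.bv, κ z = μ z) → Matches σ (V ∪ (o.vars ∪ q.vars)) μ κ :=
    fun μ κ hμ hκ hB => h.of_noClash hc' hμ (fun z _ => hκ z) hB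
  have hsub : field (o.subst σ) = o.eqns.map fun p => (p.1, val (p.2.subst σ)) := by
    have := field_eq (o.subst σ) rfl
    rw [eqns_subst o rfl] at this
    simpa [Function.comp_def] using this
  have hself : field o = o.eqns.map fun p => (p.1, val p.2) := field_eq o rfl
  refine ⟨fun ω' hω' => ?_, fun ν' hν' => ?_⟩
  · obtain ⟨T, hT, φ, hφ, hQ, rfl⟩ := (run_evolve (q.subst σ) _ _ (o.subst σ)).1 hω'
    rw [hsub] at hφ
    have hφ' := hφ.reset (f := fun e => val (e.subst σ)) (g := val) h₀ fun μ p hp hμ => by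
      refine ho p hp _ _ ((hm μ _ (fun z hz => hμ z ?_) ?_ ?_).mono ?_)
      · rw [mem_bv_iff o rfl] at hz; grind
      · exact fun z hz => reset_of_notMem hz
      · exact fun z hz => reset_of_mem hz
      · exact (hov p hp).trans (by grind)
    have hms : ∀ s ∈ Set.Icc 0 T, Matches σ (V ∪ (o.vars ∪ q.vars)) (φ s)
        (reset o.eqns ν φ s) := fun s hs =>
      hm _ _ (hφ.eq_off_bv (f := fun e => val (e.subst σ)) hs) (fun z hz => reset_of_notMem hz)
        fun z hz => reset_of_mem hz
    refine ⟨_, (run_evolve _ _ _ _).2 ⟨T, hT, reset o.eqns ν φ, hself ▸ hφ', fun s hs => ?_, rfl⟩,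
      (hms T ⟨hT, le_rfl⟩).mono (by grind)⟩
    exact (hq _ _ ((hms s hs).mono (by grind))).1 (hQ s hs)
  · obtain ⟨T, hT, φ, hφ, hQ, rfl⟩ := (run_evolve _ _ _ _).1 hν'
    rw [hself] at hφ
    have hφ' := hφ.reset (f := val) (g := fun e => val (e.subst σ))
      (fun p hp => (h₀ p hp).symm) fun μ p hp hμ => by
      refine (ho p hp _ _ ((hm _ μ ?_ (fun z hz => hμ z ?_) ?_).mono ?_)).symm
      · exact fun z hz => reset_of_notMem hz
      · rw [mem_bv_iff o rfl] at hz; grind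
      · exact fun z hz => (reset_of_mem (φ := fun _ => μ) (s := 0) hz).symm
      · exact (hov p hp).trans (by grind)
    have hms : ∀ s ∈ Set.Icc 0 T, Matches σ (V ∪ (o.vars ∪ q.vars)) (reset o.eqns ω φ s)
        (φ s) := fun s hs =>
      hm _ _ (fun z hz => reset_of_notMem hz) (hφ.eq_off_bv hs) fun z hz => (reset_of_mem hz).symm
    refine ⟨_, (run_evolve _ _ _ _).2 ⟨T, hT, reset o.eqns ω φ, hsub ▸ hφ', fun s hs => ?_, rfl⟩,
      (hms T ⟨hT, le_rfl⟩).mono (by grind)⟩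
    exact (hq _ _ ((hms s hs).mono (by grind))).2 (hQ s hs)

/-- The next iteration can start only from states matched on the variables of `a`; the induction
therefore observes `V ∪ a.vars` instead of `V`. -/
theorem substOK_star {σ : Var → DL .trm} {a : DL .prg} (hc : NoClash σ a.bv a.vars)
    (ha : SubstOK σ a) : SubstOK σ (.star a) := by
  intro V ω ν hV h
  have hV' : NoClash σ a.bv (V ∪ a.vars) := Expr.NoClash.union hV hc
  replace h : Matches σ (V ∪ a.vars) ω ν := h
  have key : ∀ ω ν, Matches σ (V ∪ a.vars) ω ν → Matches σ (V ∪ a.vars ∪ a.vars) ω ν :=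
    fun ω ν h => h.mono (by grind)
  refine ⟨fun ω' hω' => ?_, fun ν' hν' => ?_⟩
  · suffices ∃ ν', Run (.star a) ν ν' ∧ Matches σ (V ∪ a.vars) ω' ν' from
      this.imp fun _ h => ⟨h.1, h.2.mono (by grind)⟩
    replace hω' : Relation.ReflTransGen (Run (a.subst σ)) ω ω' := hω'
    induction hω' with
    | refl => exact ⟨ν, .refl, h⟩
    | tail _ h₂ ih =>
      obtain ⟨μ, h₁, hm⟩ := ih
      obtain ⟨κ, h₃, hm'⟩ := (ha _ _ _ hV' (key _ _ hm)).1 _ h₂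
      exact ⟨κ, Relation.ReflTransGen.tail h₁ h₃, hm'⟩
  · suffices ∃ ω', Relation.ReflTransGen (Run (a.subst σ)) ω ω' ∧
        Matches σ (V ∪ a.vars) ω' ν' from
      this.imp fun _ h => ⟨h.1, h.2.mono (by grind)⟩
    replace hν' : Relation.ReflTransGen (Run a) ν ν' := hν'
    induction hν' with
    | refl => exact ⟨ω, .refl, h⟩
    | tail _ h₂ ih =>
      obtain ⟨μ, h₁, hm⟩ := ih
      obtain ⟨κ, h₃, hm'⟩ := (ha _ _ _ hV' (key _ _ hm)).2 _ h₂
      exact ⟨κ, Relation.ReflTransGen.tail h₁ h₃, hm'⟩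

/-- After the first program the states must still be matched on the variables that the second one
reads, so `V ∪ b.vars` is observed in between. -/
theorem substOK_seq {σ : Var → DL .trm} {a b : DL .prg} (hc : NoClash σ a.bv b.vars)
    (ha : SubstOK σ a) (hb : SubstOK σ b) : SubstOK σ (.seq a b) := by
  intro V ω ν hV h
  simp only [bv] at hV
  replace h : Matches σ (V ∪ (a.vars ∪ b.vars)) ω ν := h
  have hVa : NoClash σ a.bv (V ∪ b.vars) := (hV.mono (by grind) (by grind)).union hc
  have hVb : NoClash σ b.bv V := hV.mono (by grind) (by grind)
  have ha' := ha _ ω ν hVa (h.mono (by grind))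
  refine ⟨fun ω' hω' => ?_, fun ν' hν' => ?_⟩
  · obtain ⟨μ, h₁, h₂⟩ : ∃ μ, Run (a.subst σ) ω μ ∧ Run (b.subst σ) μ ω' := hω'
    obtain ⟨κ, h₃, hm⟩ := ha'.1 μ h₁
    obtain ⟨ν', h₄, hm'⟩ := (hb _ μ κ hVb hm).1 _ h₂
    exact ⟨ν', ⟨κ, h₃, h₄⟩, hm'⟩
  · obtain ⟨κ, h₁, h₂⟩ : ∃ μ, Run a ν μ ∧ Run b μ ν' := hν'
    obtain ⟨μ, h₃, hm⟩ := ha'.2 κ h₁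
    obtain ⟨ω', h₄, hm'⟩ := (hb _ μ κ hVb hm).2 _ h₂
    exact ⟨ω', ⟨μ, h₃, h₄⟩, hm'⟩

/-- All kinds are treated in one induction. For programs the right invariant is a simulation in both
directions, relative to a set `V` of variables observed afterwards; boxes and diamonds take `V` to
be the variables of the postcondition. For systems only the right-hand sides are compared, the flow
being handled at `evolve`. -/
theorem substOK {k : Kind} (e : DL k) (σ : Var → DL .trm) (h : Adm σ e) : SubstOK σ e := by
  induction e
  case var x => exact fun ω ν hm => (hm x (by simp [Expr.vars])).symm
  case num => exact fun _ _ _ => rfl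
  case diff a _ =>
    intro ω ν hm
    have hvars : (Expr.diff a : DL .trm).vars = a.fv ∪ a.fv.image Var.prime := by
      rw [fv_trm]; rfl
    -- Admissibility forces `σ` to fix every variable of a differential, so the term is left
    -- unchanged.
    rw [subst_eq_self _ _ (hvars ▸ h)]
    refine val_congr _ fun z hz => ?_
    rw [hm z hz, h z (hvars ▸ hz), val_var]
  case deq x a ih =>
    intro p hp
    obtain rfl : p = (x, a) := List.mem_singleton.1 hp
    exact ih h
  case comma h₁ h₂ =>
    intro p hp
    exact (List.mem_append.1 hp).elim (h₁ h.1 p) (h₂ h.2 p)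
  case pow a q ih =>
    intro ω ν hm
    exact congrArg (· ^ (q : ℝ)) (ih h ω ν hm)
  case not p ih =>
    intro ω ν hm
    exact not_congr (ih h ω ν hm)
  case all x p ih =>
    intro ω ν hm
    have hc : NoClash σ {x} p.vars := h.1
    exact forall_congr' fun r => ih h.2 _ _
      ((hm.mono (Finset.subset_union_right (s₁ := {x}))).update hc r)
  case ex x p ih =>
    intro ω ν hm
    have hc : NoClash σ {x} p.vars := h.1
    exact exists_congr fun r => ih h.2 _ _
      ((hm.mono (Finset.subset_union_right (s₁ := {x}))).update hc r)
  case box a p iha ihp =>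
    intro ω ν hm
    replace hm : Matches σ (p.vars ∪ a.vars) ω ν := hm.mono (by simp [Expr.vars, Finset.union_comm])
    obtain ⟨h₁, h₂⟩ := iha h.2.1 p.vars ω ν h.1 hm
    constructor
    · intro hb ν' hν'
      obtain ⟨ω', hr, hm'⟩ := h₂ ν' hν'
      exact (ihp h.2.2 _ _ hm').1 (hb ω' hr)
    · intro hb ω' hω'
      obtain ⟨ν', hr, hm'⟩ := h₁ ω' hω'
      exact (ihp h.2.2 _ _ hm').2 (hb ν' hr)
  case dia a p iha ihp =>
    intro ω ν hm
    replace hm : Matches σ (p.vars ∪ a.vars) ω ν := hm.mono (by simp [Expr.vars, Finset.union_comm])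
    obtain ⟨h₁, h₂⟩ := iha h.2.1 p.vars ω ν h.1 hm
    constructor
    · rintro ⟨ω', hω', hp⟩
      obtain ⟨ν', hr, hm'⟩ := h₁ ω' hω'
      exact ⟨ν', hr, (ihp h.2.2 _ _ hm').1 hp⟩
    · rintro ⟨ν', hν', hp⟩
      obtain ⟨ω', hr, hm'⟩ := h₂ ν' hν'
      exact ⟨ω', hr, (ihp h.2.2 _ _ hm').2 hp⟩
  case assign x a ih =>
    intro V ω ν hV hm
    have hV' : NoClash σ {x} V := hV
    have hva : val (a.subst σ) ω = val a ν := ih h _ _ (hm.mono (by simp [Expr.vars]; grind))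
    have hm' := (hm.mono Finset.subset_union_left).update hV' (val a ν)
    refine ⟨?_, ?_⟩
    · rintro ω' hω'
      replace hω' : ω' = Function.update ω x (val (a.subst σ) ω) := hω'
      exact ⟨_, rfl, by rw [hω', hva]; exact hm'⟩
    · rintro ν' rfl
      exact ⟨Function.update ω x (val (a.subst σ) ω), rfl, by rw [hva]; exact hm'⟩
  case random x =>
    intro V ω ν hV hm
    have hV' : NoClash σ {x} V := hV
    have hm' := (hm.mono Finset.subset_union_left).update hV'
    constructor <;> rintro _ ⟨r, rfl⟩ <;> exact ⟨_, ⟨r, rfl⟩, hm' r⟩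
  case test p ih =>
    intro V ω ν hV hm
    have hp := ih h ω ν (hm.mono Finset.subset_union_right)
    have hm' := hm.mono (Finset.subset_union_left (s₁ := V))
    constructor <;> rintro _ ⟨rfl, hr⟩
    · exact ⟨ν, ⟨rfl, hp.1 hr⟩, hm'⟩
    · exact ⟨ω, ⟨rfl, hp.2 hr⟩, hm'⟩
  case seq iha ihb => exact substOK_seq h.1 (iha h.2.1) (ihb h.2.2)
  case choice a b iha ihb =>
    intro V ω ν hV hm
    replace hm : Matches σ (V ∪ (a.vars ∪ b.vars)) ω ν := hm
    have h₁ := iha h.1 V ω ν (hV.mono (by simp [bv]) subset_rfl) (hm.mono (by grind))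
    have h₂ := ihb h.2 V ω ν (hV.mono (by simp [bv]) subset_rfl) (hm.mono (by grind))
    constructor <;> rintro _ (hr | hr)
    · exact (h₁.1 _ hr).imp fun _ h => ⟨.inl h.1, h.2⟩
    · exact (h₂.1 _ hr).imp fun _ h => ⟨.inr h.1, h.2⟩
    · exact (h₁.2 _ hr).imp fun _ h => ⟨.inl h.1, h.2⟩
    · exact (h₂.2 _ hr).imp fun _ h => ⟨.inr h.1, h.2⟩
  case star ih => exact substOK_star h.1 (ih h.2)
  case evolve iho ihq => exact substOK_evolve h.1 (iho h.2.1) (ihq h.2.2)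
  case leaf => exact Empty.elim ‹_›
  case un => exact Empty.elim ‹_›
  case bin => exact Empty.elim ‹_›
  all_goals
    rename_i h₁ h₂
    intro ω ν hm
    have e₁ := h₁ h.1 ω ν (hm.mono (by simp [Expr.vars]))
    have e₂ := h₂ h.2 ω ν (hm.mono (by simp [Expr.vars]))
    simp only [subst, trav, val_add, val_sub, val_mul, val_div, sat_cmp, sat_and, sat_or,
      sat_imp, sat_iff] at e₁ e₂ ⊢
    simp only [e₁, e₂]

theorem val_subst {e : DL .trm} {σ : Var → DL .trm} (h : Adm σ e) {ω ν : State}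
    (hm : Matches σ e.vars ω ν) : val (e.subst σ) ω = val e ν := substOK e σ h ω ν hm

theorem sat_subst {p : DL .fml} {σ : Var → DL .trm} (h : Adm σ p) {ω ν : State}
    (hm : Matches σ p.vars ω ν) : Sat (p.subst σ) ω ↔ Sat p ν := substOK p σ h ω ν hm

theorem matches_single (x : Var) (a : DL .trm) (V : Finset Var) (ω : State) :
    Matches (single x a) V ω (Function.update ω x (val a ω)) := by
  intro z _
  by_cases hz : z = x
  · subst hz; simp [single]
  · simp [single, hz]

theorem sat_subst_single {p : DL .fml} {x : Var} {a : DL .trm} (h : Adm (single x a) p)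
    (ω : State) : Sat (p.subst (single x a)) ω ↔ Sat p (Function.update ω x (val a ω)) :=
  sat_subst h (matches_single x a _ ω)

theorem val_subst_single {e : DL .trm} {x : Var} {a : DL .trm} (h : Adm (single x a) e)
    (ω : State) : val (e.subst (single x a)) ω = val e (Function.update ω x (val a ω)) :=
  val_subst h (matches_single x a _ ω)

/-! Coincidence -/

/-- Coincidence is the substitution lemma for the identity, which is always admissible: matched
states are then states that agree on the variables. -/
theorem sat_congr (p : DL .fml) {ω ν : State} (h : ∀ z ∈ p.vars, ω z = ν z) :
    Sat p ω ↔ Sat p ν := by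
  have := sat_subst (adm_var p) (ω := ω) (ν := ν) fun z hz => (h z hz).symm
  rwa [subst_var] at this

/-- Agreement survives on variables that do not occur in `a` as well, since these are not bound and
keep their values. -/
theorem run_congr (a : DL .prg) {ω ω' ν : State} (h : ∀ z ∈ a.vars, ω z = ν z)
    (hr : Run a ω ω') : ∃ ν', Run a ν ν' ∧ ∀ z, ω z = ν z → ω' z = ν' z := by
  have := (substOK a .var (adm_var a) a.vars ω ν (fun _ _ h => absurd rfl h)
    (fun z hz => (h z (by simpa using hz)).symm)).1 ω' (by rwa [subst_var])
  obtain ⟨ν', hr', hm⟩ := this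
  refine ⟨ν', hr', fun z hz => ?_⟩
  by_cases hza : z ∈ a.vars
  · exact (hm z hza).symm
  · have := mt (@bv_subset_vars _ a z) hza
    rw [run_eq a hr this, run_eq a hr' this, hz]

/-! Renaming -/

/-- The permutation of variables induced by a permutation of names. -/
def permVar (f : Equiv.Perm ℕ) : Equiv.Perm Var where
  toFun x := ⟨f x.name, x.primes⟩
  invFun x := ⟨f.symm x.name, x.primes⟩
  left_inv x := by simp
  right_inv x := by simp

theorem prime_permVar (f : Equiv.Perm ℕ) (x : Var) :
    (permVar f x).prime = permVar f x.prime := rfl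

theorem update_comp_permVar (f : Equiv.Perm ℕ) (ω : State) (x : Var) (r : ℝ) :
    Function.update ω (permVar f x) r ∘ permVar f = Function.update (ω ∘ permVar f) x r :=
  Function.update_comp_eq_of_injective _ (permVar f).injective _ _

/-- The states as seen through a permutation of names. -/
def permState (f : Equiv.Perm ℕ) : State ≃ State where
  toFun ω := ω ∘ permVar f
  invFun ω := ω ∘ (permVar f).symm
  left_inv ω := by funext z; simp
  right_inv ω := by funext z; simp

theorem fv_rename {k : Kind} (e : DL k) (hk : k = .trm) (f : Equiv.Perm ℕ) :
    (e.rename f).fv = e.fv.image (permVar f) := by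
  unfold rename
  induction e <;> simp_all [trav, fv, Finset.image_union, Finset.image_image]
  case var => rfl
  case diff => rfl
  all_goals exact Empty.elim ‹_›

theorem eqns_rename {k : Kind} (o : DL k) (hk : k = .ode) (f : Equiv.Perm ℕ) :
    (o.rename f).eqns = o.eqns.map fun p => (permVar f p.1, p.2.rename f) := by
  unfold rename
  induction o <;> cases hk
  case deq => rfl
  case comma h₁ h₂ => simp [trav, Expr.eqns, ← h₁, ← h₂]
  all_goals exact Empty.elim ‹_›

/-- The permutation of variables commutes with `prime`, so each equation is transported to its
image; surjectivity transports the clause on unmentioned variables. -/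
theorem flow_comp_permVar (π : Equiv.Perm ℕ) {L : List (Var × DL .trm)}
    {f g : DL .trm → State → ℝ} (hfg : ∀ p ∈ L, ∀ μ, f p.2 μ = g p.2 (μ ∘ permVar π))
    (ω : State) (T : ℝ) (φ : ℝ → State) :
    Flow (L.map fun p => (permVar π p.1, f p.2)) ω T φ ↔
      Flow (L.map fun p => (p.1, g p.2)) (ω ∘ permVar π) T fun s => φ s ∘ permVar π := by
  simp only [Flow, List.forall_mem_map, prime_permVar, Function.comp_apply]
  refine and_congr Iff.rfl (forall₂_congr fun s _ => and_congr ?_ ?_)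
  · exact forall₂_congr fun p hp => by rw [hfg p hp]
  · rw [(permVar π).surjective.forall]
    simp

theorem uniqueFlow_comp_permVar (π : Equiv.Perm ℕ) {L : List (Var × DL .trm)}
    {f g : DL .trm → State → ℝ} (hfg : ∀ p ∈ L, ∀ μ, f p.2 μ = g p.2 (μ ∘ permVar π))
    (ω : State) (T : ℝ) (φ : ℝ → State) :
    UniqueFlow (L.map fun p => (permVar π p.1, f p.2)) ω T φ ↔
      UniqueFlow (L.map fun p => (p.1, g p.2)) (ω ∘ permVar π) T fun s => φ s ∘ permVar π := by
  unfold UniqueFlow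
  refine and_congr (flow_comp_permVar π hfg ω T φ) (forall₂_congr fun s _ => ?_)
  constructor
  · intro h ψ hψ r hr
    have e : ∀ r, (ψ r ∘ (permVar π).symm) ∘ permVar π = ψ r := fun r => by funext z; simp
    have := h (fun r => ψ r ∘ (permVar π).symm)
      ((flow_comp_permVar π hfg _ _ _).2 (by simpa only [e] using hψ)) r hr
    simp only [← this, e]
  · intro h ψ hψ r hr
    exact (permVar π).surjective.injective_comp_right
      (h _ ((flow_comp_permVar π hfg _ _ _).1 hψ) r hr)

/-- The meaning of renaming, by kind. -/
def RenameOK (f : Equiv.Perm ℕ) : {k : Kind} → DL k → Prop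
  | .trm, e => ∀ ω, val (e.rename f) ω = val e (ω ∘ permVar f)
  | .fml, p => ∀ ω, Sat (p.rename f) ω ↔ Sat p (ω ∘ permVar f)
  | .ode, o => ∀ p ∈ o.eqns, ∀ ω, val (p.2.rename f) ω = val p.2 (ω ∘ permVar f)
  | .prg, a => ∀ ω ν, Run (a.rename f) ω ν ↔ Run a (ω ∘ permVar f) (ν ∘ permVar f)

theorem renameOK_evolve {f : Equiv.Perm ℕ} {o : DL .ode} {q : DL .fml} (ho : RenameOK f o)
    (hq : RenameOK f q) : RenameOK f (.evolve o q) := by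
  intro ω ν
  have e₁ : field (o.rename f) = o.eqns.map fun p => (permVar f p.1, val (p.2.rename f)) := by
    have := field_eq (o.rename f) rfl
    rw [eqns_rename o rfl] at this
    simpa [Function.comp_def] using this
  have e₂ : field o = o.eqns.map fun p => (p.1, val p.2) := field_eq o rfl
  change Run (.evolve (o.rename f) (q.rename f)) ω ν ↔ _
  simp only [run_evolve, e₁, e₂]
  have key := uniqueFlow_comp_permVar f (L := o.eqns) (f := fun e => val (e.rename f)) (g := val)
    fun p hp μ => ho p hp μ
  refine exists_congr fun T => and_congr_right fun _ => ⟨?_, ?_⟩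
  · rintro ⟨φ, hφ, hQ, rfl⟩
    exact ⟨fun s => φ s ∘ permVar f, (key _ _ _).1 hφ, fun s hs => (hq _).1 (hQ s hs), rfl⟩
  · rintro ⟨φ, hφ, hQ, hν⟩
    have e : ∀ r, (φ r ∘ (permVar f).symm) ∘ permVar f = φ r := fun r => by funext z; simp
    refine ⟨fun s => φ s ∘ (permVar f).symm, (key _ _ _).2 (by simpa only [e] using hφ),
      fun s hs => (hq _).2 (by simpa only [e] using hQ s hs), ?_⟩
    rw [← e] at hν
    exact (permVar f).surjective.injective_comp_right hν

/-- A permutation of names acts bijectively on states, so no admissibility is needed: quantification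
over successor states is reindexed by `permState`, and the sum in a differential by `permVar`. -/
theorem renameOK {k : Kind} (e : DL k) (f : Equiv.Perm ℕ) : RenameOK f e := by
  induction e
  case var x => exact fun _ => rfl
  case num => exact fun _ => rfl
  case diff a ih =>
    intro ω
    have e : (Expr.diff a).rename f = .diff (a.rename f) := rfl
    rw [e, val_diff, val_diff, fv_rename a rfl,
      Finset.sum_image fun _ _ _ _ h => (permVar f).injective h]
    refine Finset.sum_congr rfl fun x _ => ?_
    simp only [ih _, update_comp_permVar]
    rfl
  case pow a q ih => exact fun ω => congrArg (· ^ (q : ℝ)) (ih ω)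
  case not p ih => exact fun ω => not_congr (ih ω)
  case all x p ih =>
    refine fun ω => forall_congr' fun r => (ih _).trans ?_
    rw [← update_comp_permVar]; rfl
  case ex x p ih =>
    refine fun ω => exists_congr fun r => (ih _).trans ?_
    rw [← update_comp_permVar]; rfl
  case box a p iha ihp =>
    intro ω
    change (∀ ν, Run (a.rename f) ω ν → Sat (p.rename f) ν) ↔ ∀ ν, Run a _ ν → Sat p ν
    rw [(permState f).surjective.forall (p := fun ν => Run a (ω ∘ permVar f) ν → Sat p ν)]
    exact forall_congr' fun ν => imp_congr (iha ω ν) (ihp ν)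
  case dia a p iha ihp =>
    intro ω
    change (∃ ν, Run (a.rename f) ω ν ∧ Sat (p.rename f) ν) ↔ ∃ ν, Run a _ ν ∧ Sat p ν
    rw [(permState f).surjective.exists (p := fun ν => Run a (ω ∘ permVar f) ν ∧ Sat p ν)]
    exact exists_congr fun ν => and_congr (iha ω ν) (ihp ν)
  case deq x a ih =>
    intro p hp
    obtain rfl : p = (x, a) := List.mem_singleton.1 hp
    exact ih
  case comma h₁ h₂ => exact fun p hp => (List.mem_append.1 hp).elim (h₁ p) (h₂ p)
  case assign x a ih =>
    intro ω ν
    change ν = Function.update ω (permVar f x) (val (a.rename f) ω) ↔ ν ∘ permVar f = _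
    rw [ih, ← update_comp_permVar]
    exact (permState f).injective.eq_iff.symm
  case random x =>
    refine fun ω ν => exists_congr fun r => ?_
    change ν = Function.update ω (permVar f x) r ↔ _
    rw [← update_comp_permVar]
    exact (permState f).injective.eq_iff.symm
  case test p ih =>
    exact fun ω ν => and_congr (permState f).injective.eq_iff.symm (ih ω)
  case seq a b iha ihb =>
    intro ω ν
    change (∃ μ, Run (a.rename f) ω μ ∧ Run (b.rename f) μ ν) ↔ ∃ μ, Run a _ μ ∧ Run b μ _
    rw [(permState f).surjective.exists (p := fun μ => Run a (ω ∘ permVar f) μ ∧ Run b μ _)]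
    exact exists_congr fun μ => and_congr (iha ω μ) (ihb μ ν)
  case choice a b iha ihb => exact fun ω ν => or_congr (iha ω ν) (ihb ω ν)
  case star a ih =>
    intro ω ν
    change Relation.ReflTransGen (Run (a.rename f)) ω ν ↔ Relation.ReflTransGen (Run a) _ _
    constructor <;> intro h
    · exact h.lift (· ∘ permVar f) fun μ κ h => (ih μ κ).1 h
    · have := h.lift (p := Run (a.rename f)) (permState f).symm fun μ κ h => by
        refine (ih _ _).2 ?_
        change Run a (permState f _) (permState f _)
        simpa using h
      have e : ∀ μ : State, (permState f).symm (μ ∘ permVar f) = μ := (permState f).left_inv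
      rwa [Function.onFun, e, e] at this
  case evolve iho ihq => exact renameOK_evolve iho ihq
  case leaf => exact Empty.elim ‹_›
  case un => exact Empty.elim ‹_›
  case bin => exact Empty.elim ‹_›
  all_goals
    rename_i h₁ h₂
    intro ω
    have e₁ := h₁ ω
    have e₂ := h₂ ω
    simp only [rename, trav, val_add, val_sub, val_mul, val_div, sat_cmp, sat_and, sat_or,
      sat_imp, sat_iff] at e₁ e₂ ⊢
    simp only [e₁, e₂]

theorem val_rename (e : DL .trm) (f : Equiv.Perm ℕ) (ω : State) :
    val (e.rename f) ω = val e (ω ∘ permVar f) := renameOK e f ω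

theorem sat_rename (p : DL .fml) (f : Equiv.Perm ℕ) (ω : State) :
    Sat (p.rename f) ω ↔ Sat p (ω ∘ permVar f) := renameOK p f ω

/-! Ghosts -/

/-- The state `ν` with the values that the names `B` have in `ω` stored in their ghosts. -/
noncomputable def ghostState (B : Finset ℕ) (f : Equiv.Perm ℕ) (ω ν : State) : State :=
  fun z => if f z.name ∈ B then ω (permVar f z) else ν z

theorem mem_names {E : Ext} {k : Kind} {e : Expr E k} {z : Var} (hz : z ∈ e.vars) :
    z.name ∈ e.names := Finset.mem_image_of_mem _ hz

section Ghost

variable {B : Finset ℕ} {f : Equiv.Perm ℕ}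

theorem ghostState_of_notMem (hinv : ∀ n, f (f n) = n) (ω ν : State) {z : Var} {s : Finset Var}
    (hs : ∀ n ∈ B, f n ∉ s.image Var.name)
    (hz : z ∈ s) : ghostState B f ω ν z = ν z := by
  refine if_neg fun h => hs _ h ?_
  rw [hinv]
  exact Finset.mem_image_of_mem _ hz

/-- One half of the purpose of `ghostState`: formulas free of ghosts see the state after the
program. The other half is `sat_rename_ghostState`, by which their renamings see the state before
it. -/
theorem sat_ghostState (hinv : ∀ n, f (f n) = n) (ω ν : State) {p : DL .fml}
    (hp : ∀ n ∈ B, f n ∉ p.names) :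
    Sat p (ghostState B f ω ν) ↔ Sat p ν :=
  sat_congr p fun _ hz => ghostState_of_notMem hinv ω ν hp hz

/-- A name in `B` is sent to its ghost, which stores the value in `ω`. A name outside `B` that is
fixed by `f` is unaffected by the program. The only other names are ghosts, and `hs` excludes them.
-/
theorem ghostState_permVar (hinv : ∀ n, f (f n) = n) (ω ν : State)
    (hB : ∀ n, f n ≠ n → n ∈ B ∨ f n ∈ B)
    (hν : ∀ z : Var, z.name ∉ B → ν z = ω z)
    {s : Finset Var} (hs : ∀ n ∈ B, f n ∉ s.image Var.name) {z : Var} (hz : z ∈ s) :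
    ghostState B f ω ν (permVar f z) = ω z := by
  have e : permVar f (permVar f z) = z := by simp [permVar, hinv]
  unfold ghostState
  rw [e]
  by_cases h : z.name ∈ B
  · exact if_pos (by simpa [permVar, hinv] using h)
  · rw [if_neg (by simpa [permVar, hinv] using h)]
    by_cases hfz : f z.name = z.name
    · have : permVar f z = z := by simp [permVar, hfz]
      rw [this, hν z h]
    · refine absurd (Finset.mem_image_of_mem Var.name hz) ?_
      have := hs _ ((hB _ hfz).resolve_left h)
      rwa [hinv] at this

theorem sat_rename_ghostState (hinv : ∀ n, f (f n) = n) (ω ν : State)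
    (hB : ∀ n, f n ≠ n → n ∈ B ∨ f n ∈ B)
    (hν : ∀ z : Var, z.name ∉ B → ν z = ω z)
    {p : DL .fml} (hp : ∀ n ∈ B, f n ∉ p.names) :
    Sat (p.rename f) (ghostState B f ω ν) ↔ Sat p ω := by
  rw [sat_rename]
  exact sat_congr p fun z hz => ghostState_permVar hinv ω ν hB hν hp hz

end Ghost

/-! Contexts -/

@[simp] theorem facts_hyp (n : Option Ident) (φ : DL .fml) (Γ : Ctx) :
    facts (.hyp n φ :: Γ) = φ :: facts Γ := rfl
@[simp] theorem facts_abbr (X : Ident) {k : Kind} (e : DL k) (Γ : Ctx) :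
    facts (.abbr X e :: Γ) = facts Γ := rfl
@[simp] theorem facts_append (Γ₁ Γ₂ : Ctx) : facts (Γ₁ ++ Γ₂) = facts Γ₁ ++ facts Γ₂ :=
  List.filterMap_append

@[simp] theorem facts_renameCtx (f : Equiv.Perm ℕ) (Γ : Ctx) :
    facts (renameCtx f Γ) = (facts Γ).map (Expr.rename f) := by
  induction Γ with
  | nil => rfl
  | cons e Γ ih =>
    cases e <;> simpa [facts, renameCtx, Entry.rename] using ih

@[simp] theorem facts_invs (Js : List (Ident × DL .fml)) :
    facts (invs Js) = Js.map Prod.snd := by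
  induction Js with
  | nil => rfl
  | cons j Js ih => simp [facts, invs]

@[simp] theorem facts_boxedInvs (a : DL .prg) (Js : List (Ident × DL .fml)) :
    facts (boxedInvs a Js) = Js.map fun j => .box a j.2 := by
  induction Js with
  | nil => rfl
  | cons j Js ih => simp [facts, boxedInvs]

theorem exists_hyp_of_mem_facts {Γ : Ctx} {φ : DL .fml} (h : φ ∈ facts Γ) :
    ∃ n, Entry.hyp n φ ∈ Γ := by
  obtain ⟨e, he, h⟩ := List.mem_filterMap.1 h
  cases e <;> simp at h
  exact ⟨_, h ▸ he⟩

theorem Fresh.notMem_names_of_mem_facts {n : ℕ} {Γ : Ctx} {H : Trace} {Δ : List (DL .fml)}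
    (h : Fresh n Γ H Δ) {φ : DL .fml} (hφ : φ ∈ facts Γ) : n ∉ φ.names := by
  obtain ⟨m, hm⟩ := exists_hyp_of_mem_facts hφ
  exact h.1 _ hm

/-- Matching adds only abbreviations to a context, so patterns in proofs cannot affect validity. -/
theorem facts_pmatch {H : Trace} {k : Kind} {p : Pat k} {e : DL k} {Γ Γ₁ : Ctx}
    (h : pmatch H p e Γ = some Γ₁) : facts Γ₁ = facts Γ := by
  induction p generalizing Γ Γ₁
  case leaf l =>
    cases l <;> simp only [pmatch] at h <;> (repeat' split at h) <;> simp_all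
    rw [← h, facts_abbr]
  case un u p ih => cases u; simp only [pmatch] at h; split at h <;> simp_all
  case bin u p q ihp ihq =>
    cases u <;> simp only [pmatch] at h
    · rcases hp : pmatch H p e Γ with _ | Γ₂
      · rw [hp] at h; exact ihq h
      · rw [hp] at h; cases h; exact ihp hp
    · obtain ⟨Γ₂, h₁, h₂⟩ := Option.bind_eq_some_iff.1 h
      rw [ihq h₂, ihp h₁]
  all_goals
    simp only [pmatch] at h
    split at h
    all_goals (try split at h)
    all_goals first
      | cases h; done
      | cases h; rfl
      | solve_by_elim
      | skip
    all_goals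
      obtain ⟨Γ₂, h₁, h₂⟩ := Option.bind_eq_some_iff.1 h
      first
        | rename_i ihp ihq _ _ _
          exact (ihq h₂).trans (ihp h₁)
        | rename_i ihp ihq _ _ _ _ _
          exact (ihq h₂).trans (ihp h₁)

/-! Soundness of forward chaining and of the implicit conversions -/

/-- Truth in `ω` is one particular valuation of the non-propositional subformulas; a tautology is
true under all of them. -/
theorem propTrue_sat (p : DL .fml) (ω : State) : p.PropTrue (fun q => Sat q ω) ↔ Sat p ω := by
  suffices ∀ {k : Kind} (e : DL k) (hk : k = .fml),
      (hk ▸ e : DL .fml).PropTrue (fun q => Sat q ω) ↔ Sat (hk ▸ e) ω from this p rfl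
  intro k e hk
  induction e <;> cases hk <;> simp_all [PropTrue]

theorem Library.sat {p : DL .fml} (h : Library p) (ω : State) : Sat p ω := by
  rcases h with ⟨-, h⟩ | h
  · obtain ⟨q, hq, hs⟩ := h ω (by simp)
    rwa [List.mem_singleton.1 hq] at hs
  · exact (propTrue_sat p ω).1 (h _)

theorem FPChecks.sat {Γ : Ctx} {H : Trace} {f : FP} {p : DL .fml} (h : FPChecks Γ H f p)
    {ω : State} (hω : ∀ q ∈ facts Γ, Sat q ω) : Sat p ω := by
  induction h with
  | pat p φ hφ _ => exact hφ.elim (hω φ) fun h => h.sat ω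
  | app f g φ ψ _ _ ihg ihf => exact ihf ihg
  | inst f e x φ θ _ _ ha ih => exact (sat_subst_single ha ω).2 (ih _)

theorem Implicit.sat_iff {p q : DL .fml} (h : Implicit p q) (ω : State) :
    Sat p ω ↔ Sat q ω := by
  cases h <;> simp only [sat_box, sat_dia, run_seq, sat_all, sat_ex, run_random, sat_imp,
    run_test, sat_not, sat_and, sat_or, Kaisar.sat_iff]
  all_goals grind

/-! ### Validity of sequents -/

/-- `Γ ⊢ Δ` is valid. -/
def Sound (Γ : Ctx) (Δ : List (DL .fml)) : Prop :=
  ∀ ω, (∀ p ∈ facts Γ, Sat p ω) → ∃ q ∈ Δ, Sat q ω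

/-- By classical logic the side formulas may be assumed false, which lets each rule be argued for
its principal formula alone. -/
theorem sound_cons_iff {Γ : Ctx} {φ : DL .fml} {Δ : List (DL .fml)} :
    Sound Γ (φ :: Δ) ↔
      ∀ ω, (∀ p ∈ facts Γ, Sat p ω) → (∀ q ∈ Δ, ¬ Sat q ω) → Sat φ ω := by
  refine forall₂_congr fun ω _ => ?_
  simp only [List.mem_cons, exists_eq_or_imp]
  constructor
  · exact fun h hΔ => h.resolve_right fun ⟨q, hq, hs⟩ => hΔ q hq hs
  · intro h
    by_cases hΔ : ∃ q ∈ Δ, Sat q ω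
    · exact .inr hΔ
    · exact .inl (h fun q hq hs => hΔ ⟨q, hq, hs⟩)

theorem Sound.apply {Γ : Ctx} {φ : DL .fml} {Δ : List (DL .fml)} (h : Sound Γ (φ :: Δ))
    {ω : State} (hΓ : ∀ p ∈ facts Γ, Sat p ω) (hΔ : ∀ q ∈ Δ, ¬ Sat q ω) : Sat φ ω :=
  sound_cons_iff.1 h ω hΓ hΔ

theorem Method.Proves.sound {Γ : Ctx} {H : Trace} {ps : List (Pat .fml)} {fs : List FP}
    {m : Method} {φ : DL .fml} {Δ : List (DL .fml)} (h : m.Proves (Used Γ H ps fs) φ Δ) :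
    Sound Γ (φ :: Δ) := by
  intro ω hω
  have hU : ∀ ψ, Used Γ H ps fs ψ → Sat ψ ω := by
    rintro ψ (⟨hψ, -⟩ | ⟨f, -, hf⟩)
    · exact hω ψ hψ
    · exact hf.sat hω
  cases m with
  | id => exact ⟨φ, by simp, hU φ h⟩
  | real =>
    obtain ⟨χ, hχ, -, hs⟩ := h ω fun ψ hψ _ => hU ψ hψ
    exact ⟨χ, hχ, hs⟩
  | auto => exact h ω hU

/-! Rules that store old values in ghosts -/

/-- The interface to `ghostState`: rules that abstract a program running from `ω` to `ν` apply their
premise in `κ`, where the renamed context has its truth values from `ω` and fresh unrenamed formulas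
have theirs from `ν`. -/
theorem Ghosting.elim {B : Finset ℕ} {f : Equiv.Perm ℕ} {Γ : Ctx} {H : Trace}
    {Δ : List (DL .fml)} (hf : Ghosting B f Γ H Δ) {ω ν : State}
    (hν : ∀ z : Var, z.name ∉ B → ν z = ω z) : ∃ κ : State,
      (∀ p : DL .fml, (∀ n ∈ B, f n ∉ p.names) →
        (Sat p κ ↔ Sat p ν) ∧ (Sat (p.rename f) κ ↔ Sat p ω)) ∧
      ((∀ p ∈ facts Γ, Sat p ω) → ∀ p ∈ facts Γ, Sat (p.rename f) κ) ∧
      ((∀ q ∈ Δ, ¬ Sat q ω) → ∀ q ∈ Δ, ¬ Sat (q.rename f) κ) ∧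
      ∀ p : DL .fml, p ∈ facts Γ ∨ p ∈ Δ → (Sat p κ ↔ Sat p ν) := by
  have key : ∀ p : DL .fml, (∀ n ∈ B, f n ∉ p.names) →
      (Sat p (ghostState B f ω ν) ↔ Sat p ν) ∧
        (Sat (p.rename f) (ghostState B f ω ν) ↔ Sat p ω) := fun p hp =>
    ⟨sat_ghostState hf.1 ω ν hp, sat_rename_ghostState hf.1 ω ν hf.2.1 hν hp⟩
  have hΓ : ∀ p ∈ facts Γ, ∀ n ∈ B, f n ∉ p.names := fun p hp n hn =>
    (hf.2.2 n hn).2.notMem_names_of_mem_facts hp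
  have hΔ : ∀ p ∈ Δ, ∀ n ∈ B, f n ∉ p.names := fun p hp n hn => (hf.2.2 n hn).2.2.2 p hp
  refine ⟨ghostState B f ω ν, key, fun h p hp => ((key p (hΓ p hp)).2).2 (h p hp),
    fun h q hq hs => h q hq (((key q (hΔ q hq)).2).1 hs), fun p hp => ?_⟩
  exact (key p (hp.elim (hΓ p) (hΔ p))).1

theorem names_mono {E : Ext} {k l : Kind} {e : Expr E k} {e' : Expr E l} (h : e.vars ⊆ e'.vars) :
    e.names ⊆ e'.names := Finset.image_subset_image h

theorem name_notMem_bv {E : Ext} {k : Kind} {a : Expr E k} {z : Var}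
    (h : z.name ∉ a.bv.image Var.name) : z ∉ a.bv :=
  fun hz => h (Finset.mem_image_of_mem _ hz)

/-- The state after an assignment, with the old value in the ghost. -/
theorem GhostVar.elim {x : Var} {xi : ℕ} {f : Equiv.Perm ℕ} {Γ : Ctx} {H : Trace} {θ : DL .trm}
    {goal : DL .fml} {Δ : List (DL .fml)} (hf : GhostVar x xi f Γ H θ goal Δ) (ω : State) (r : ℝ) :
    ∃ κ : State, (∀ p : DL .fml, xi ∉ p.names → (Sat p κ ↔ Sat p (Function.update ω x r))) ∧
      ((∀ p ∈ facts Γ, Sat p ω) → ∀ p ∈ facts Γ, Sat (p.rename f) κ) ∧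
      ((∀ q ∈ Δ, ¬ Sat q ω) → ∀ q ∈ Δ, ¬ Sat (q.rename f) κ) ∧
      κ x = r ∧ val (θ.rename f) κ = val θ ω := by
  obtain ⟨hfr, hθ, hne, rfl | ⟨rfl, -, h₁, h₂, h₃⟩⟩ := hf
  · have hinv : ∀ n, Equiv.swap x.name xi (Equiv.swap x.name xi n) = n := fun n => by
      rw [← Equiv.Perm.mul_apply, Equiv.swap_mul_self, Equiv.Perm.one_apply]
    have hB : ∀ n, Equiv.swap x.name xi n ≠ n →
        n ∈ ({x.name} : Finset ℕ) ∨ Equiv.swap x.name xi n ∈ ({x.name} : Finset ℕ) := by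
      intro n hn
      simp only [Finset.mem_singleton]
      by_contra! h
      by_cases hx : n = xi
      · exact h.2 (by rw [hx, Equiv.swap_apply_right])
      · exact hn (Equiv.swap_apply_of_ne_of_ne h.1 hx)
    have hfresh : ∀ s : Finset ℕ, xi ∉ s →
        ∀ n ∈ ({x.name} : Finset ℕ), Equiv.swap x.name xi n ∉ s := by
      intro s hs n hn
      rwa [Finset.mem_singleton.1 hn, Equiv.swap_apply_left]
    have hν : ∀ z : Var, z.name ∉ ({x.name} : Finset ℕ) → Function.update ω x r z = ω z :=
      fun z hz => Function.update_of_ne (fun h => hz (by simp [h])) _ _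
    refine ⟨ghostState {x.name} (Equiv.swap x.name xi) ω (Function.update ω x r),
      fun p hp => sat_ghostState hinv _ _ (hfresh _ hp), fun h p hp => ?_, fun h q hq hs => ?_,
      ?_, ?_⟩
    · exact (sat_rename_ghostState hinv _ _ hB hν
        (hfresh _ (hfr.notMem_names_of_mem_facts hp))).2 (h p hp)
    · exact h q hq ((sat_rename_ghostState hinv _ _ hB hν
        (hfresh _ (hfr.2.2 q (by simp [hq])))).1 hs)
    · rw [ghostState_of_notMem hinv _ _ (s := {x}) _ (by simp), Function.update_self]
      exact hfresh _ (by simpa using hne)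
    · rw [val_rename]
      exact val_congr _ fun z hz => ghostState_permVar hinv _ _ hB hν (hfresh _ hθ) hz
  -- The case without renaming: `x` occurs neither in the context nor in `θ`, so the updated state
  -- itself serves as `κ`.
  · have hpv : permVar (1 : Equiv.Perm ℕ) = 1 := rfl
    have key : ∀ p : DL .fml, x ∉ p.vars →
        (Sat (p.rename 1) (Function.update ω x r) ↔ Sat p ω) := by
      intro p hp
      rw [sat_rename, hpv]
      exact sat_congr p fun z hz => Function.update_of_ne (by rintro rfl; exact hp hz) _ _
    refine ⟨Function.update ω x r, fun _ _ => Iff.rfl, fun h p hp => ?_, fun h q hq hs => ?_,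
      by simp, ?_⟩
    · obtain ⟨n, hn⟩ := exists_hyp_of_mem_facts hp
      exact (key p (h₁ _ hn)).2 (h p hp)
    · exact h q hq ((key q (h₂ q hq)).1 hs)
    · rw [val_rename, hpv]
      exact val_congr _ fun z hz => Function.update_of_ne (by rintro rfl; exact h₃ hz) _ _

theorem forall_mem_renameAll {f : Equiv.Perm ℕ} {Δ : List (DL .fml)} {P : DL .fml → Prop} :
    (∀ q ∈ renameAll f Δ, P q) ↔ ∀ q ∈ Δ, P (q.rename f) := List.forall_mem_map

/-- An assignment has exactly one run, so box and diamond have the same meaning and share the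
argument. In `κ` the variable `x` has its new value and the renamed `θ` has the value of `θ` before
the assignment, which is the assumed equation. -/
theorem sound_boxEq {Γ : Ctx} {H : Trace} {x : Var} {θ : DL .trm} {φ : DL .fml}
    {Δ : List (DL .fml)} {xi : ℕ} {f : Equiv.Perm ℕ} {goal : DL .fml}
    (hg : goal = .box (.assign x θ) φ ∨ goal = .dia (.assign x θ) φ)
    (hf : GhostVar x xi f Γ H θ goal Δ)
    (h : Sound (.hyp none (.cmp .eq (.var x) (θ.rename f)) :: renameCtx f Γ)
      (φ :: renameAll f Δ)) : Sound Γ (goal :: Δ) := by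
  refine sound_cons_iff.2 fun ω hΓ hΔ => ?_
  obtain ⟨κ, h₁, h₂, h₃, h₄, h₅⟩ := hf.elim ω (val θ ω)
  have hφ : xi ∉ φ.names := by
    refine fun hn => hf.1.2.2 goal (by simp) (names_mono ?_ hn)
    rcases hg with rfl | rfl <;> exact Finset.subset_union_right
  have : Sat φ (Function.update ω x (val θ ω)) := by
    refine (h₁ φ hφ).1 (h.apply ?_ (forall_mem_renameAll.2 (h₃ hΔ)))
    simp only [facts_hyp, facts_renameCtx, List.forall_mem_cons, List.forall_mem_map]
    exact ⟨by simp [Cmp.Holds, h₄, h₅], h₂ hΓ⟩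
  rcases hg with rfl | rfl <;> simpa using this

theorem sound_boxAny {Γ : Ctx} {H : Trace} {x : Var} {θ : DL .trm} {φ : DL .fml}
    {Δ : List (DL .fml)} {xi : ℕ} {f : Equiv.Perm ℕ}
    (hf : GhostVar x xi f Γ H θ (.box (.random x) φ) Δ)
    (h : Sound (renameCtx f Γ) (φ :: renameAll f Δ)) : Sound Γ (.box (.random x) φ :: Δ) := by
  refine sound_cons_iff.2 fun ω hΓ hΔ => ?_
  rintro _ ⟨r, rfl⟩
  obtain ⟨κ, h₁, h₂, h₃, -⟩ := hf.elim ω r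
  refine (h₁ φ ?_).1 (h.apply (by simpa using h₂ hΓ) (forall_mem_renameAll.2 (h₃ hΔ)))
  exact fun hn => hf.1.2.2 _ List.mem_cons_self (names_mono Finset.subset_union_right hn)

theorem Ghosting.fresh_of_subset {B : Finset ℕ} {f : Equiv.Perm ℕ} {Γ : Ctx} {H : Trace}
    {Δ : List (DL .fml)} (hf : Ghosting B f Γ H Δ) {q p : DL .fml} (hq : q ∈ facts Γ ∨ q ∈ Δ)
    (h : p.names ⊆ q.names) : ∀ n ∈ B, f n ∉ p.names := by
  intro n hn hp
  rcases hq with hq | hq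
  · exact (hf.2.2 n hn).2.notMem_names_of_mem_facts hq (h hp)
  · exact (hf.2.2 n hn).2.2.2 q hq (h hp)

/-- The first premise gives `ψ` after the run. The second is used in the ghost state of the run,
where `ψ` is still true and the renamed context is as it was before `a`; `φ` is free of ghosts and
can be carried back to the final state. -/
theorem sound_boxAfter {Γ : Ctx} {H : Trace} {ψ : DL .fml} {a : DL .prg} {φ : DL .fml}
    {Δ : List (DL .fml)} {f : Equiv.Perm ℕ}
    (hf : Ghosting (a.bv.image Var.name) f Γ H (ψ :: .box a φ :: Δ))
    (h₁ : Sound Γ (.box a ψ :: Δ))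
    (h₂ : Sound (.hyp none ψ :: renameCtx f Γ) (φ :: renameAll f Δ)) :
    Sound Γ (.box a φ :: Δ) := by
  refine sound_cons_iff.2 fun ω hΓ hΔ ν hν => ?_
  obtain ⟨κ, k₁, k₂, -, k₄⟩ := hf.elim (ω := ω) (ν := ν) fun z hz => run_eq a hν (name_notMem_bv hz)
  have hψ : Sat ψ ν := h₁.apply hΓ hΔ ν hν
  have hφ := hf.fresh_of_subset (p := φ) (q := .box a φ) (by simp)
    (names_mono (by simp [Expr.vars]))
  refine (k₁ φ hφ).1.1 (h₂.apply ?_ (forall_mem_renameAll.2 fun q hq hs => ?_))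
  · simp only [facts_hyp, facts_renameCtx, List.forall_mem_cons, List.forall_mem_map]
    exact ⟨(k₄ ψ (by simp)).2 hψ, k₂ hΓ⟩
  · exact hΔ q hq ((k₁ q (hf.fresh_of_subset (q := q) (by simp [hq]) subset_rfl)).2.1 hs)

theorem sound_diaAfter {Γ : Ctx} {H : Trace} {ψ : DL .fml} {a : DL .prg} {φ : DL .fml}
    {Δ : List (DL .fml)} {f : Equiv.Perm ℕ}
    (hf : Ghosting (a.bv.image Var.name) f Γ H (ψ :: .dia a φ :: Δ))
    (h₁ : Sound Γ (.dia a ψ :: Δ))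
    (h₂ : Sound (.hyp none ψ :: renameCtx f Γ) (φ :: renameAll f Δ)) :
    Sound Γ (.dia a φ :: Δ) := by
  refine sound_cons_iff.2 fun ω hΓ hΔ => ?_
  obtain ⟨ν, hν, hψ⟩ := h₁.apply hΓ hΔ
  refine ⟨ν, hν, ?_⟩
  obtain ⟨κ, k₁, k₂, -, k₄⟩ := hf.elim (ω := ω) (ν := ν) fun z hz => run_eq a hν (name_notMem_bv hz)
  have hφ := hf.fresh_of_subset (p := φ) (q := .dia a φ) (by simp)
    (names_mono (by simp [Expr.vars]))
  refine (k₁ φ hφ).1.1 (h₂.apply ?_ (forall_mem_renameAll.2 fun q hq hs => ?_))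
  · simp only [facts_hyp, facts_renameCtx, List.forall_mem_cons, List.forall_mem_map]
    exact ⟨(k₄ ψ (by simp)).2 hψ, k₂ hΓ⟩
  · exact hΔ q hq ((k₁ q (hf.fresh_of_subset (q := q) (by simp [hq]) subset_rfl)).2.1 hs)

/-! Loops -/

/-- Induction along the iterations. Each intermediate state is paired with the initial state `ω` in
a ghost state, so the context is always renamed from `ω`. Earlier invariants are assumed under the
box of the loop, hence are true in every intermediate state. -/
theorem sound_invLoop {Γ : Ctx} {H : Trace} {ψ : DL .fml} {a : DL .prg} {φ : DL .fml}
    {Δ : List (DL .fml)} {f : Equiv.Perm ℕ} {Js : List (Ident × DL .fml)} {x : Ident}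
    (hf : Ghosting (a.bv.image Var.name) f (boxedInvs (.star a) Js ++ Γ) H
      (ψ :: .box (.star a) φ :: Δ))
    (h₁ : Sound (invs Js ++ Γ) (ψ :: Δ))
    (h₂ : Sound (.hyp none ψ :: (invs Js ++ renameCtx f Γ)) (.box a ψ :: renameAll f Δ))
    (h₃ : Sound (boxedInvs (.star a) ((x, ψ) :: Js) ++ Γ) (.box (.star a) φ :: Δ)) :
    Sound (boxedInvs (.star a) Js ++ Γ) (.box (.star a) φ :: Δ) := by
  refine sound_cons_iff.2 fun ω hΓ hΔ => ?_
  have hJ : ∀ j ∈ Js, Sat (.box (.star a) j.2) ω := fun j hj =>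
    hΓ _ (by simpa using .inl ⟨_, hj⟩)
  have hΓ' : ∀ p ∈ facts Γ, Sat p ω := fun p hp => hΓ p (by simp [hp])
  suffices Sat (.box (.star a) ψ) ω by
    refine h₃.apply ?_ hΔ
    rw [facts_append, facts_boxedInvs, List.map_cons, List.cons_append, List.forall_mem_cons]
    exact ⟨this, by simpa using hΓ⟩
  have hψ : Sat ψ ω := by
    refine h₁.apply ?_ hΔ
    simp only [facts_append, facts_invs, List.forall_mem_append, List.forall_mem_map]
    exact ⟨fun j hj => hJ j hj ω .refl, hΓ'⟩
  intro ν hν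
  replace hν : Relation.ReflTransGen (Run a) ω ν := hν
  induction hν with
  | refl => exact hψ
  | @tail ν μ h₁' h₂' ih =>
    obtain ⟨κ, k₁, -, -, k₄⟩ := hf.elim (ω := ω) (ν := ν) fun z hz =>
      run_eq (.star a) h₁' (name_notMem_bv hz)
    have hbox : Sat (.box a ψ) κ := by
      refine h₂.apply ?_ (forall_mem_renameAll.2 fun q hq hs => ?_)
      · simp only [facts_hyp, facts_append, facts_invs, facts_renameCtx, List.forall_mem_cons,
          List.forall_mem_append, List.forall_mem_map]
        refine ⟨(k₄ ψ (by simp)).2 ih, fun j hj => ?_, fun p hp => ?_⟩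
        · refine (k₁ j.2 (hf.fresh_of_subset (q := .box (.star a) j.2) (.inl ?_)
            (names_mono Finset.subset_union_right))).1.2 (hJ j hj ν h₁')
          simpa using .inl ⟨_, hj⟩
        · exact (k₁ p (hf.fresh_of_subset (q := p) (by simp [hp]) subset_rfl)).2.2 (hΓ' p hp)
      · exact hΔ q hq ((k₁ q (hf.fresh_of_subset (q := q) (by simp [hq]) subset_rfl)).2.1 hs)
    refine (k₁ (.box a ψ) fun n hn => ?_).1.1 hbox μ h₂'
    have e : (Expr.box a ψ).names = a.names ∪ ψ.names := Finset.image_union _ _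
    rw [e, Finset.notMem_union]
    -- A loop has the same variables as its body, so freshness for the goal covers `a`.
    exact ⟨hf.fresh_of_subset (p := .box a φ) (q := .box (.star a) φ) (by simp) subset_rfl n hn ∘
      (names_mono Finset.subset_union_left ·),
      hf.fresh_of_subset (q := ψ) (by simp) subset_rfl n hn⟩

theorem sound_finLoop {Γ : Ctx} {H : Trace} {a : DL .prg} {φ : DL .fml}
    {Δ : List (DL .fml)} {f : Equiv.Perm ℕ} {Js : List (Ident × DL .fml)}
    (hf : Ghosting (a.bv.image Var.name) f (boxedInvs (.star a) Js ++ Γ) H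
      (.box (.star a) φ :: Δ))
    (h : Sound (invs Js ++ renameCtx f Γ) (φ :: renameAll f Δ)) :
    Sound (boxedInvs (.star a) Js ++ Γ) (.box (.star a) φ :: Δ) := by
  refine sound_cons_iff.2 fun ω hΓ hΔ ν hν => ?_
  obtain ⟨κ, k₁, -, -, k₄⟩ := hf.elim (ω := ω) (ν := ν) fun z hz =>
    run_eq (.star a) hν (name_notMem_bv hz)
  refine (k₁ φ (hf.fresh_of_subset (q := .box (.star a) φ) (by simp)
    (names_mono Finset.subset_union_right))).1.1
      (h.apply ?_ (forall_mem_renameAll.2 fun q hq hs => ?_))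
  · simp only [facts_append, facts_invs, facts_renameCtx,
      List.forall_mem_append, List.forall_mem_map]
    refine ⟨fun j hj => ?_, fun p hp => ?_⟩
    · have hj' : Expr.box (.star a) j.2 ∈ facts (boxedInvs (.star a) Js ++ Γ) := by
        simpa using .inl ⟨_, hj⟩
      exact (k₁ j.2 (hf.fresh_of_subset (.inl hj')
        (names_mono Finset.subset_union_right))).1.2 (hΓ _ hj' ν hν)
    · have hp' : p ∈ facts (boxedInvs (.star a) Js ++ Γ) := by simp [hp]
      exact (k₁ p (hf.fresh_of_subset (.inl hp') subset_rfl)).2.2 (hΓ p hp')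
  · exact hΔ q hq ((k₁ q (hf.fresh_of_subset (q := q) (by simp [hq]) subset_rfl)).2.1 hs)

/-! ### Convergence of loops -/

theorem run_update {a : DL .prg} {x : Var} (hx : x ∉ a.vars) {ω ν : State} (h : Run a ω ν)
    (r : ℝ) : Run a (Function.update ω x r) (Function.update ν x r) := by
  obtain ⟨μ, hr, hμ⟩ := run_congr a (ν := Function.update ω x r)
    (fun z hz => (Function.update_of_ne (by rintro rfl; exact hx hz) _ _).symm) h
  convert hr using 1
  funext z
  by_cases hz : z = x
  · subst hz
    rw [run_eq a hr (mt (@bv_subset_vars _ a z) hx)]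
    simp
  · rw [Function.update_of_ne hz]
    exact hμ z (Function.update_of_ne hz _ _).symm

theorem sat_update {p : DL .fml} {x : Var} (hx : x ∉ p.vars) (ω : State) (r : ℝ) :
    Sat p (Function.update ω x r) ↔ Sat p ω :=
  sat_congr p fun _ hz => Function.update_of_ne (by rintro rfl; exact hx hz) _ _

theorem notMem_vars_of_name {E : Ext} {k : Kind} {e : Expr E k} {x : Var} (h : x.name ∉ e.names) :
    x ∉ e.vars := fun hx => h (mem_names hx)

/-- Induction on a natural bound for the value of the variant. Once it is at most 0 the last premise
reaches `φ`; until then the step premise runs the body once and restores `ψ` with the variant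
lowered by 1. The variant does not occur in the loop or the goal, so its value can be changed
freely. -/
theorem sound_con {Γ : Ctx} {H : Trace} {x : ℕ} {ψ : DL .fml} {a : DL .prg} {φ : DL .fml}
    {Δ : List (DL .fml)} {f : Equiv.Perm ℕ} (hx : Fresh x Γ H (.dia (.star a) φ :: Δ))
    (hf : Ghosting (a.bv.image Var.name) f Γ H (ψ :: .dia (.star a) φ :: Δ)) (hfx : f x = x)
    (ha : Adm (single ⟨x, 0⟩ (.sub (.var ⟨x, 0⟩) (.num 1))) ψ)
    (h₁ : Sound Γ (.ex ⟨x, 0⟩ ψ :: Δ))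
    (h₂ : Sound (.hyp none (.cmp .gt (.var ⟨x, 0⟩) (.num 0)) :: .hyp none ψ :: renameCtx f Γ)
      (.dia a (ψ.subst (single ⟨x, 0⟩ (.sub (.var ⟨x, 0⟩) (.num 1)))) :: renameAll f Δ))
    (h₃ : Sound (.hyp none (.cmp .le (.var ⟨x, 0⟩) (.num 0)) :: .hyp none ψ :: renameCtx f Γ)
      [.dia (.star a) φ]) :
    Sound Γ (.dia (.star a) φ :: Δ) := by
  refine sound_cons_iff.2 fun ω hΓ hΔ => ?_
  have hxg : (⟨x, 0⟩ : Var) ∉ (Expr.dia (.star a) φ).vars :=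
    notMem_vars_of_name (hx.2.2 _ List.mem_cons_self)
  have hxa : (⟨x, 0⟩ : Var) ∉ a.vars := fun h => hxg (Finset.mem_union_left _ h)
  have hxB : x ∉ a.bv.image Var.name := fun h =>
    hx.2.2 _ List.mem_cons_self (Finset.image_subset_image
      ((bv_subset_vars a).trans Finset.subset_union_left) h)
  have hfn : ∀ n ∈ a.bv.image Var.name, f n ≠ x := by
    rintro n hn rfl
    rw [hf.1] at hfx
    exact hxB (hfx ▸ hn)
  -- The run so far starts at `ω` with the variant preset to its present value `r`. As `a` ignores
  -- the variant, the whole run can be replayed from the value `r - 1` for the next round.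
  have key : ∀ n : ℕ, ∀ r : ℝ, r ≤ n → ∀ ν, Run (.star a) (Function.update ω ⟨x, 0⟩ r) ν →
      Sat ψ ν → Sat (.dia (.star a) φ) ω := by
    intro n
    induction n with
    | zero | succ n ih =>
      intro r hr ν hν hψ
      obtain ⟨κ, k₁, k₂, k₃, k₄⟩ := hf.elim (ω := Function.update ω ⟨x, 0⟩ r) (ν := ν) fun z hz =>
        run_eq (.star a) hν (name_notMem_bv hz)
      have hνx : ν ⟨x, 0⟩ = r := by
        rw [run_eq (.star a) hν (mt (@bv_subset_vars _ a _) hxa), Function.update_self]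
      have hΓ₁ := k₂ fun p hp =>
        (sat_update (notMem_vars_of_name (hx.notMem_names_of_mem_facts hp)) _ _).2 (hΓ p hp)
      have hΔ₁ : ∀ q ∈ Δ, ¬ Sat (q.rename f) κ := fun q hq hs => by
        refine hΔ q hq ?_
        have := (k₁ q (hf.fresh_of_subset (q := q) (by simp [hq]) subset_rfl)).2.1 hs
        rwa [sat_update (notMem_vars_of_name (hx.2.2 q (by simp [hq])))] at this
      have hcmp : ∀ c, Sat (.cmp c (.var ⟨x, 0⟩) (.num 0)) κ ↔ c.Holds r 0 := fun c => by
        rw [(k₁ (.cmp c (.var ⟨x, 0⟩) (.num 0)) ?_).1]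
        · simp [hνx]
        · intro n hn
          simpa [names, Expr.vars] using hfn n hn
      by_cases hr₀ : r ≤ 0
      · obtain ⟨μ, hμ, hφ⟩ : Sat (.dia (.star a) φ) ν := by
          refine (k₄ _ (by simp)).1 (h₃.apply ?_ (by simp))
          simp only [facts_hyp, facts_renameCtx, List.forall_mem_cons, List.forall_mem_map]
          exact ⟨(hcmp _).2 hr₀, (k₄ ψ (by simp)).2 hψ, hΓ₁⟩
        exact (sat_update hxg ω r).1
          ⟨μ, Relation.ReflTransGen.trans (r := Run a) hν hμ, hφ⟩
      -- At bound 0 a positive variant is contradictory; in the successor case the body is run once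
      -- more.
      · first
        | exact absurd (by simpa using hr) hr₀
        | have hd : Sat (.dia a (ψ.subst (single ⟨x, 0⟩ (.sub (.var ⟨x, 0⟩) (.num 1))))) κ := by
            refine h₂.apply ?_ (forall_mem_renameAll.2 hΔ₁)
            simp only [facts_hyp, facts_renameCtx, List.forall_mem_cons, List.forall_mem_map]
            exact ⟨(hcmp _).2 (not_le.1 hr₀), (k₄ ψ (by simp)).2 hψ, hΓ₁⟩
          -- The substitution is traded for an assignment, whose names are visible, so that
          -- freshness allows the return from `κ` to `ν`.
          have hd' : Sat (.dia a (.box (.assign ⟨x, 0⟩ (.sub (.var ⟨x, 0⟩) (.num 1))) ψ)) κ := by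
            obtain ⟨μ, hμ, hs⟩ := hd
            refine ⟨μ, hμ, ?_⟩
            rintro _ rfl
            exact (sat_subst_single ha μ).1 hs
          rw [(k₁ _ ?_).1] at hd'
          · obtain ⟨μ, hμ, hs⟩ := hd'
            have hμx : μ ⟨x, 0⟩ = r := by
              rw [run_eq a hμ (mt (@bv_subset_vars _ a _) hxa), hνx]
            have hs' : Sat ψ (Function.update μ ⟨x, 0⟩ (μ ⟨x, 0⟩ - (1 : ℚ))) := hs _ rfl
            rw [hμx, Rat.cast_one] at hs'
            refine ih (r - 1) (by push_cast at hr; linarith)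
              (Function.update μ ⟨x, 0⟩ (r - 1)) ?_ hs'
            have := run_update (a := .star a) hxa
              (Relation.ReflTransGen.tail (r := Run a) hν hμ) (r - 1)
            rwa [Function.update_idem] at this
          · intro n hn hmem
            have h₁ := hf.fresh_of_subset (p := .dia (.star a) φ) (q := .dia (.star a) φ)
              (by simp) subset_rfl n hn
            have h₂ := hf.fresh_of_subset (p := ψ) (q := ψ) (by simp) subset_rfl n hn
            have h₃ := hfn n hn
            simp only [names, Expr.vars, Finset.image_union, Finset.mem_union,
              Finset.image_singleton, Finset.mem_singleton, Finset.union_empty] at h₁ h₂ hmem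
            tauto
  obtain ⟨r, hr⟩ := h₁.apply hΓ hΔ
  exact key ⌈r⌉₊ r (Nat.le_ceil r) _ .refl hr

/-! Differential equations -/

theorem Flow.restrict {sys : List (Var × (State → ℝ))} {ω : State} {T s : ℝ} {φ : ℝ → State}
    (h : Flow sys ω T φ) (hs : s ∈ Set.Icc 0 T) : Flow sys ω s φ := by
  refine ⟨h.1, fun r hr => ?_⟩
  have hr' : r ∈ Set.Icc 0 T := ⟨hr.1, hr.2.trans hs.2⟩
  exact ⟨fun p hp => ⟨((h.2 r hr').1 p hp).1,
    ((h.2 r hr').1 p hp).2.mono (Set.Icc_subset_Icc_right hs.2)⟩, (h.2 r hr').2⟩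

theorem UniqueFlow.restrict {sys : List (Var × (State → ℝ))} {ω : State} {T s : ℝ}
    {φ : ℝ → State} (h : UniqueFlow sys ω T φ) (hs : s ∈ Set.Icc 0 T) : UniqueFlow sys ω s φ :=
  ⟨h.1.restrict hs, fun r hr => h.2 r ⟨hr.1, hr.2.trans hs.2⟩⟩

/-- Every point of an evolution ends a shorter evolution, so what holds after all runs holds
throughout each run. -/
theorem run_evolve_prefix {o : DL .ode} {q : DL .fml} {ω : State} {T : ℝ} {φ : ℝ → State}
    (h : UniqueFlow (field o) ω T φ) (hq : ∀ s ∈ Set.Icc 0 T, Sat q (φ s)) {s : ℝ}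
    (hs : s ∈ Set.Icc 0 T) : Run (.evolve o q) ω (φ s) :=
  (run_evolve _ _ _ _).2 ⟨s, hs.1, φ, h.restrict hs,
    fun r hr => hq r ⟨hr.1, hr.2.trans hs.2⟩, rfl⟩

theorem Var.prime_injective : Function.Injective Var.prime := by
  rintro ⟨a, b⟩ ⟨c, d⟩ h
  simpa [Var.prime] using h

theorem mem_evolved {o : DL .ode} {z : Var} : z ∈ o.evolved ↔ ∃ p ∈ o.eqns, p.1 = z := by
  simp [evolved]

theorem mem_evolvedPrimes {o : DL .ode} {z : Var} :
    z ∈ o.evolvedPrimes ↔ ∃ p ∈ o.eqns, p.1.prime = z := by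
  simp [evolvedPrimes, evolved]

theorem mem_bv_ode {o : DL .ode} {z : Var} : z ∈ o.bv ↔ z ∈ o.evolved ∨ z ∈ o.evolvedPrimes := by
  rw [mem_bv_iff o rfl, mem_evolved, mem_evolvedPrimes]
  grind

section FlowFacts

variable {o : DL .ode} {ω : State} {T s : ℝ} {φ : ℝ → State}

theorem Flow.eq_off_bv (h : Flow (field o) ω T φ) (hs : s ∈ Set.Icc 0 T) {z : Var}
    (hz : z ∉ o.bv) : φ s z = ω z := by
  refine (h.2 s hs).2 z ?_
  rw [field_eq o rfl, List.forall_mem_map]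
  rw [mem_bv_iff o rfl] at hz
  grind

theorem Flow.prime_eq (h : Flow (field o) ω T φ) (hs : s ∈ Set.Icc 0 T) {p : Var × DL .trm}
    (hp : p ∈ o.eqns) : φ s p.1.prime = val p.2 (φ s) := by
  have := (h.2 s hs).1 (p.1, val p.2)
    (by rw [field_eq o rfl]; exact List.mem_map.2 ⟨p, hp, rfl⟩)
  exact this.1

theorem Flow.hasDerivWithinAt (h : Flow (field o) ω T φ) (hs : s ∈ Set.Icc 0 T) {z : Var}
    (hz : z ∈ o.evolved) :
    HasDerivWithinAt (fun r => φ r z) (φ s z.prime) (Set.Icc 0 T) s := by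
  obtain ⟨p, hp, rfl⟩ := mem_evolved.1 hz
  have := (h.2 s hs).1 (p.1, val p.2)
    (by rw [field_eq o rfl]; exact List.mem_map.2 ⟨p, hp, rfl⟩)
  rw [this.1]
  exact this.2

theorem Flow.hasDerivWithinAt_zero (h : Flow (field o) ω T φ) (hs : s ∈ Set.Icc 0 T) {z : Var}
    (hz : z ∉ o.bv) : HasDerivWithinAt (fun r => φ r z) 0 (Set.Icc 0 T) s :=
  (hasDerivWithinAt_const s _ (ω z)).congr (fun _ hr => h.eq_off_bv hr hz) (h.eq_off_bv hs hz)

/-- At time 0 only the differential variables of the system may jump, to the values of the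
right-hand sides. This is why the ODE invariants have to avoid `evolvedPrimes`. -/
theorem Flow.zero_eq (h : Flow (field o) ω T φ) (hT : 0 ≤ T) {z : Var}
    (hz : z ∉ o.evolvedPrimes) : φ 0 z = ω z := by
  by_cases hz' : z ∈ o.evolved
  · obtain ⟨p, hp, rfl⟩ := mem_evolved.1 hz'
    exact h.1 (p.1, val p.2) (by rw [field_eq o rfl]; exact List.mem_map.2 ⟨p, hp, rfl⟩)
  · exact h.eq_off_bv ⟨le_rfl, hT⟩ (by simp [mem_bv_ode, hz, hz'])

end FlowFacts

/-! Differentials -/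

/-- A regular term has a total derivative along every path through the state. -/
theorem exists_gradient {k : Kind} (a : DL k) (hk : k = .trm) {ω : State} (h : Regular ω a) :
    ∃ G : State →ₗ[ℝ] ℝ, (∀ d d' : State, (∀ z ∈ a.vars, d z = d' z) → G d = G d') ∧
      ∀ (φ : ℝ → State) (S : Set ℝ) (s : ℝ) (d : State), φ s = ω →
        (∀ z ∈ a.vars, HasDerivWithinAt (fun r => φ r z) (d z) S s) →
        HasDerivWithinAt (fun r => val (hk ▸ a) (φ r)) (G d) S s := by
  induction a <;> cases hk
  case var x =>
    exact ⟨LinearMap.proj x, fun d d' h => h x (by simp [Expr.vars]),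
      fun φ S s d _ h => h x (by simp [Expr.vars])⟩
  case num q =>
    exact ⟨0, fun _ _ _ => rfl, fun φ S s d _ _ => hasDerivWithinAt_const _ _ _⟩
  case add a b iha ihb =>
    obtain ⟨G₁, h₁, k₁⟩ := iha rfl h.1
    obtain ⟨G₂, h₂, k₂⟩ := ihb rfl h.2
    simp only [Expr.vars, Finset.mem_union]
    refine ⟨G₁ + G₂, fun d d' hd => ?_, fun φ S s d hφ hd => ?_⟩
    · simp [h₁ d d' fun z hz => hd z (.inl hz), h₂ d d' fun z hz => hd z (.inr hz)]
    · exact (k₁ φ S s d hφ fun z hz => hd z (.inl hz)).add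
        (k₂ φ S s d hφ fun z hz => hd z (.inr hz))
  case sub a b iha ihb =>
    obtain ⟨G₁, h₁, k₁⟩ := iha rfl h.1
    obtain ⟨G₂, h₂, k₂⟩ := ihb rfl h.2
    simp only [Expr.vars, Finset.mem_union]
    refine ⟨G₁ - G₂, fun d d' hd => ?_, fun φ S s d hφ hd => ?_⟩
    · simp [h₁ d d' fun z hz => hd z (.inl hz), h₂ d d' fun z hz => hd z (.inr hz)]
    · exact (k₁ φ S s d hφ fun z hz => hd z (.inl hz)).sub
        (k₂ φ S s d hφ fun z hz => hd z (.inr hz))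
  case mul a b iha ihb =>
    obtain ⟨G₁, h₁, k₁⟩ := iha rfl h.1
    obtain ⟨G₂, h₂, k₂⟩ := ihb rfl h.2
    simp only [Expr.vars, Finset.mem_union]
    refine ⟨val b ω • G₁ + val a ω • G₂, fun d d' hd => ?_, fun φ S s d hφ hd => ?_⟩
    · simp [h₁ d d' fun z hz => hd z (.inl hz), h₂ d d' fun z hz => hd z (.inr hz)]
    · refine ((k₁ φ S s d hφ fun z hz => hd z (.inl hz)).mul
        (k₂ φ S s d hφ fun z hz => hd z (.inr hz))).congr_deriv ?_
      change G₁ d * val b (φ s) + val a (φ s) * G₂ d = val b ω * G₁ d + val a ω * G₂ d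
      rw [hφ]
      ring
  case div a b iha ihb =>
    obtain ⟨G₁, h₁, k₁⟩ := iha rfl h.1
    obtain ⟨G₂, h₂, k₂⟩ := ihb rfl h.2.1
    have hb : val b ω ≠ 0 := h.2.2
    simp only [Expr.vars, Finset.mem_union]
    refine ⟨(val b ω / val b ω ^ 2) • G₁ - (val a ω / val b ω ^ 2) • G₂, fun d d' hd => ?_,
      fun φ S s d hφ hd => ?_⟩
    · simp [h₁ d d' fun z hz => hd z (.inl hz), h₂ d d' fun z hz => hd z (.inr hz)]
    · refine ((k₁ φ S s d hφ fun z hz => hd z (.inl hz)).div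
        (k₂ φ S s d hφ fun z hz => hd z (.inr hz)) (hφ ▸ hb)).congr_deriv ?_
      change (G₁ d * val b (φ s) - val a (φ s) * G₂ d) / val b (φ s) ^ 2 =
        (val b ω / val b ω ^ 2) * G₁ d - (val a ω / val b ω ^ 2) * G₂ d
      rw [hφ]
      ring
  case pow a q iha =>
    obtain ⟨G₁, h₁, k₁⟩ := iha rfl h.1
    have hq : val a ω ≠ 0 ∨ 1 ≤ q ∨ q = 0 := h.2
    -- With exponent 0 the power is constantly 1, even at base 0, where the power rule below would
    -- need an exponent of at least 1.
    by_cases hq0 : q = 0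
    · refine ⟨0, fun _ _ _ => rfl, fun φ S s d _ _ => ?_⟩
      simpa [hq0] using hasDerivWithinAt_const s S (1 : ℝ)
    · refine ⟨((q : ℝ) * val a ω ^ ((q : ℝ) - 1)) • G₁, fun d d' hd => ?_,
        fun φ S s d hφ hd => ?_⟩
      · simp [h₁ d d' hd]
      · refine ((k₁ φ S s d hφ hd).rpow_const (p := (q : ℝ)) ?_).congr_deriv ?_
        · rcases hq with h | h | h
          · exact .inl (hφ ▸ h)
          · exact .inr (by exact_mod_cast h)
          · exact absurd h hq0
        · change G₁ d * q * val a (φ s) ^ ((q : ℝ) - 1) = (q * val a ω ^ ((q : ℝ) - 1)) * G₁ d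
          rw [hφ]
          ring
  case diff => exact h.elim
  all_goals exact Empty.elim ‹_›

/-- The differential of a term is its derivative along a path whose velocity is given by the
differential variables. -/
theorem hasDerivWithinAt_val {a : DL .trm} {φ : ℝ → State} {S : Set ℝ} {s : ℝ} {ν : State}
    (h : Regular (φ s) a) (hν : ∀ z ∈ a.vars, ν z = φ s z)
    (hφ : ∀ z ∈ a.vars, HasDerivWithinAt (fun r => φ r z) (ν z.prime) S s) :
    HasDerivWithinAt (fun r => val a (φ r)) (val (.diff a) ν) S s := by
  obtain ⟨G, h₁, h₂⟩ := exists_gradient a rfl h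
  suffices val (.diff a) ν = G fun z => ν z.prime by
    rw [this]
    exact h₂ φ S s _ rfl hφ
  -- A coordinate path moves `x` alone, so the partial derivative is the value of `G` on a unit
  -- vector.
  have hpart : ∀ x ∈ a.vars,
      deriv (fun r => val a (Function.update ν x r)) (ν x) = G (Pi.single x 1) := by
    intro x hx
    have e : (fun r => val a (Function.update ν x r)) =
        fun r => val a (Function.update (φ s) x r) := by
      funext r
      refine val_congr _ fun z hz => ?_
      by_cases hzx : z = x
      · simp [hzx]
      · simp [hzx, hν z hz]
    rw [e, hν x hx]
    refine (hasDerivWithinAt_univ.1 (h₂ _ Set.univ _ _ (by simp) fun z _ => ?_)).deriv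
    by_cases hzx : z = x
    · subst hzx
      simpa using hasDerivAt_id' (φ s z)
    · simpa [hzx] using hasDerivWithinAt_const (φ s x) Set.univ (φ s z)
  rw [val_diff, fv_trm, Finset.sum_congr rfl fun x hx => by rw [hpart x hx]]
  -- Linearity collects the partial derivatives into one vector. It agrees with the velocity on
  -- `a.vars`, and `G` depends on nothing else.
  have := map_sum G (fun x => ν x.prime • (Pi.single x 1 : State)) a.vars
  simp only [map_smul, smul_eq_mul] at this
  simp only [mul_comm (G _)]
  rw [← this]
  refine h₁ _ _ fun z hz => ?_
  rw [Finset.sum_apply, Finset.sum_eq_single z]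
  · simp
  · intro b _ hb
    simp [Pi.single_eq_of_ne hb.symm]
  · exact fun h => absurd hz h

theorem antitoneOn_of_hasDerivWithinAt {T : ℝ} {g g' : ℝ → ℝ}
    (h : ∀ s ∈ Set.Icc 0 T, HasDerivWithinAt g (g' s) (Set.Icc 0 T) s)
    (h' : ∀ s ∈ Set.Icc 0 T, g' s ≤ 0) {s : ℝ} (hs : s ∈ Set.Icc 0 T) : g s ≤ g 0 := by
  have hd : ∀ r ∈ interior (Set.Icc 0 T), HasDerivAt g (g' r) r := fun r hr =>
    (h r (interior_subset hr)).hasDerivAt (mem_interior_iff_mem_nhds.1 hr)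
  refine antitoneOn_of_deriv_nonpos (convex_Icc 0 T) (fun r hr => (h r hr).continuousWithinAt)
    (fun r hr => (hd r hr).differentiableAt.differentiableWithinAt)
    (fun r hr => by rw [(hd r hr).deriv]; exact h' r (interior_subset hr))
    ⟨le_rfl, hs.1.trans hs.2⟩ hs hs.1

/-- Differential invariants. -/
theorem dform_invariant {T : ℝ} {φ ν : ℝ → State} {k : Kind} (p : DL k) (hk : k = .fml)
    {p' : DL .fml} (hp : dform (hk ▸ p) = some p') (hr : ∀ s ∈ Set.Icc 0 T, Regular (φ s) p)
    (hν : ∀ s ∈ Set.Icc 0 T, ∀ z ∈ p.vars, ν s z = φ s z)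
    (hφ : ∀ s ∈ Set.Icc 0 T, ∀ z ∈ p.vars,
      HasDerivWithinAt (fun r => φ r z) (ν s z.prime) (Set.Icc 0 T) s)
    (hp' : ∀ s ∈ Set.Icc 0 T, Sat p' (ν s)) (h₀ : Sat (hk ▸ p) (φ 0)) {s : ℝ}
    (hs : s ∈ Set.Icc 0 T) : Sat (hk ▸ p) (φ s) := by
  induction p generalizing p' <;> cases hk
  case cmp c a b _ _ =>
    simp only [Expr.vars, Finset.mem_union] at hν hφ
    have ha : ∀ s ∈ Set.Icc 0 T, HasDerivWithinAt (fun r => val a (φ r)) (val (.diff a) (ν s))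
        (Set.Icc 0 T) s := fun s hs => hasDerivWithinAt_val (hr s hs).1
      (fun z hz => hν s hs z (.inl hz)) fun z hz => hφ s hs z (.inl hz)
    have hb : ∀ s ∈ Set.Icc 0 T, HasDerivWithinAt (fun r => val b (φ r)) (val (.diff b) (ν s))
        (Set.Icc 0 T) s := fun s hs => hasDerivWithinAt_val (hr s hs).2
      (fun z hz => hν s hs z (.inr hz)) fun z hz => hφ s hs z (.inr hz)
    -- The comparison of differentials gives the sign of the derivative of `a - b`, hence its
    -- monotonicity. The first difference serves `<` and `≤`, the reversed one `≥` and `>`; `=` and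
    -- `≠` need both, as the difference is then constant.
    have hab := antitoneOn_of_hasDerivWithinAt (fun s hs => (ha s hs).sub (hb s hs)) (hs := hs)
    have hba := antitoneOn_of_hasDerivWithinAt (fun s hs => (hb s hs).sub (ha s hs)) (hs := hs)
    simp only [Pi.sub_apply] at hab hba
    replace hp : dform (.cmp c a b) = some p' := hp
    change c.Holds (val a (φ 0)) (val b (φ 0)) at h₀
    change c.Holds (val a (φ s)) (val b (φ s))
    cases c <;> simp only [dform, Option.some.injEq] at hp <;> subst hp <;>
      simp only [sat_cmp, Cmp.Holds] at hp' h₀ ⊢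
    · have := hab fun s hs => by have := hp' s hs; linarith
      linarith
    · have := hab fun s hs => by have := hp' s hs; linarith
      linarith
    · have := hab fun s hs => by have := hp' s hs; linarith
      have := hba fun s hs => by have := hp' s hs; linarith
      linarith
    · have := hba fun s hs => by have := hp' s hs; linarith
      linarith
    · have := hba fun s hs => by have := hp' s hs; linarith
      linarith
    · have h₁ := hab fun s hs => by have := hp' s hs; linarith
      have h₂ := hba fun s hs => by have := hp' s hs; linarith
      intro h
      exact h₀ (by linarith)
  case and p q ihp ihq =>
    simp only [Expr.vars, Finset.mem_union] at hν hφ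
    simp only [dform, Option.bind_eq_bind, Option.bind_eq_some_iff, Option.pure_def,
      Option.some.injEq] at hp
    obtain ⟨p₁, e₁, p₂, e₂, rfl⟩ := hp
    exact ⟨ihp rfl e₁ (fun s hs => (hr s hs).1) (fun s hs z hz => hν s hs z (.inl hz))
        (fun s hs z hz => hφ s hs z (.inl hz)) (fun s hs => (hp' s hs).1) h₀.1,
      ihq rfl e₂ (fun s hs => (hr s hs).2) (fun s hs z hz => hν s hs z (.inr hz))
        (fun s hs z hz => hφ s hs z (.inr hz)) (fun s hs => (hp' s hs).2) h₀.2⟩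
  case or p q ihp ihq =>
    simp only [Expr.vars, Finset.mem_union] at hν hφ
    simp only [dform, Option.bind_eq_bind, Option.bind_eq_some_iff, Option.pure_def,
      Option.some.injEq] at hp
    obtain ⟨p₁, e₁, p₂, e₂, rfl⟩ := hp
    -- The differential of a disjunction is a conjunction, so whichever disjunct holds initially is
    -- itself invariant.
    exact h₀.imp
      (ihp rfl e₁ (fun s hs => (hr s hs).1) (fun s hs z hz => hν s hs z (.inl hz))
        (fun s hs z hz => hφ s hs z (.inl hz)) (fun s hs => (hp' s hs).1))
      (ihq rfl e₂ (fun s hs => (hr s hs).2) (fun s hs z hz => hν s hs z (.inr hz))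
        (fun s hs z hz => hφ s hs z (.inr hz)) (fun s hs => (hp' s hs).2))
  all_goals first | exact Empty.elim ‹_› | simp [dform] at hp

/-- Formulas with a differential are quantifier-free, and differentials add only primes of variables
already present, hence no new names. -/
theorem dform_vars {k : Kind} (p : DL k) (hk : k = .fml) {p' : DL .fml}
    (hp : dform (hk ▸ p) = some p') : p.fv = p.vars ∧ p'.names ⊆ p.names := by
  have key : ∀ a b : DL .trm, (a.vars ∪ a.vars.image Var.prime ∪
      (b.vars ∪ b.vars.image Var.prime)).image Var.name ⊆ (a.vars ∪ b.vars).image Var.name := by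
    intro a b n
    simp only [Finset.mem_image, Finset.mem_union]
    rintro ⟨z, (h | ⟨y, h, rfl⟩) | (h | ⟨y, h, rfl⟩), rfl⟩
    · exact ⟨z, .inl h, rfl⟩
    · exact ⟨y, .inl h, rfl⟩
    · exact ⟨z, .inr h, rfl⟩
    · exact ⟨y, .inr h, rfl⟩
  induction p generalizing p' <;> cases hk
  case cmp c a b _ _ =>
    refine ⟨by simp [fv, Expr.vars, fv_trm], ?_⟩
    replace hp : dform (.cmp c a b) = some p' := hp
    cases c <;> simp only [dform, Option.some.injEq] at hp <;> subst hp <;> exact key a b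
  case and p q ihp ihq =>
    simp only [dform, Option.bind_eq_bind, Option.bind_eq_some_iff, Option.pure_def,
      Option.some.injEq] at hp
    obtain ⟨p₁, e₁, p₂, e₂, rfl⟩ := hp
    obtain ⟨h₁, h₂⟩ := ihp rfl e₁
    obtain ⟨h₃, h₄⟩ := ihq rfl e₂
    refine ⟨by simp [fv, Expr.vars, h₁, h₃], ?_⟩
    simp only [names, Expr.vars, Finset.image_union] at h₂ h₄ ⊢
    exact Finset.union_subset_union h₂ h₄
  case or p q ihp ihq =>
    simp only [dform, Option.bind_eq_bind, Option.bind_eq_some_iff, Option.pure_def,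
      Option.some.injEq] at hp
    obtain ⟨p₁, e₁, p₂, e₂, rfl⟩ := hp
    obtain ⟨h₁, h₂⟩ := ihp rfl e₁
    obtain ⟨h₃, h₄⟩ := ihq rfl e₂
    refine ⟨by simp [fv, Expr.vars, h₁, h₃], ?_⟩
    simp only [names, Expr.vars, Finset.image_union] at h₂ h₄ ⊢
    exact Finset.union_subset_union h₂ h₄
  all_goals first | exact Empty.elim ‹_› | simp [dform] at hp

/-! Assignments of the right-hand sides to the differential variables -/

/-- Along a flow each `x'` already has the value of its right-hand side, so assigning it again does
nothing. -/
theorem sat_boxAssigns_append {l l₂ : List (Var × DL .trm)} {p : DL .fml} {ω : State}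
    (h : ∀ e ∈ l, ω e.1.prime = val e.2 ω) :
    Sat (boxAssigns (l ++ l₂) p) ω ↔ Sat (boxAssigns l₂ p) ω := by
  induction l with
  | nil => rfl
  | cons e l ih =>
    rw [List.forall_mem_cons] at h
    rw [← ih h.2]
    change (∀ ν, ν = Function.update ω e.1.prime (val e.2 ω) → Sat (boxAssigns (l ++ l₂) p) ν) ↔ _
    rw [forall_eq, ← h.1, Function.update_eq_self]

open Classical in
/-- The state with the differential variables of `vs` set to zero. -/
noncomputable def zeroPrimes (vs : List Var) (ω : State) : State :=
  fun z => if ∃ v ∈ vs, z = v.prime then 0 else ω z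

theorem sat_boxAssigns_zero {vs : List Var} {p : DL .fml} {ω : State} :
    Sat (boxAssigns (vs.map fun v => (v, .num 0)) p) ω ↔ Sat p (zeroPrimes vs ω) := by
  induction vs generalizing ω with
  | nil =>
    have : zeroPrimes [] ω = ω := by funext z; simp [zeroPrimes]
    rw [this]; rfl
  | cons v vs ih =>
    change (∀ ν, ν = Function.update ω v.prime (val (.num 0) ω) →
      Sat (boxAssigns (vs.map fun v => (v, .num 0)) p) ν) ↔ _
    rw [forall_eq, ih]
    refine iff_of_eq (congrArg _ ?_)
    funext z
    by_cases h₁ : ∃ v ∈ vs, z = v.prime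
    · simp [zeroPrimes, h₁]
    · by_cases h₂ : z = v.prime
      · simp [zeroPrimes, h₂]
      · simp [zeroPrimes, h₁, h₂]

theorem mem_vars_boxAssigns {l : List (Var × DL .trm)} {p : DL .fml} {z : Var}
    (hz : z ∈ (boxAssigns l p).vars) :
    z ∈ p.vars ∨ ∃ e ∈ l, z = e.1.prime ∨ z ∈ e.2.vars := by
  induction l with
  | nil => exact .inl hz
  | cons e l ih =>
    change z ∈ ({e.1.prime} ∪ e.2.vars) ∪ (boxAssigns l p).vars at hz
    grind

/-- Each point of the flow ends a run, so the domain constraint and the earlier invariants hold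
there. The differential premise, used in the ghost state for `ω` and that point, yields the
differential of `ψ` all along the flow; `dform_invariant` then carries `ψ` from time 0 to the end.
-/
theorem sound_invOde {Γ : Ctx} {H : Trace} {x : Ident} {ψ ψ' : DL .fml} {o : DL .ode}
    {Q φ : DL .fml} {Δ : List (DL .fml)} {f : Equiv.Perm ℕ} {Js : List (Ident × DL .fml)}
    {vs : List Var} (hψ : dform ψ = some ψ')
    (hf : Ghosting (o.bv.image Var.name) f (boxedInvs (.evolve o Q) Js ++ Γ) H
      (ψ :: .box (.evolve o Q) φ :: Δ))
    (hd : Disjoint o.evolvedPrimes ψ.vars ∧ ∀ j ∈ Js, Disjoint o.evolvedPrimes j.2.vars)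
    (hd' : Disjoint (ψ.vars.image Var.prime) ψ.vars)
    (hr : RegularAlong (boxedInvs (.evolve o Q) Js ++ Γ) Δ (.evolve o Q) ψ)
    (hv : ∀ v, v ∈ vs ↔ v ∈ ψ.fv ∧ v ∉ o.evolved)
    (h₁ : Sound (invs Js ++ Γ) (ψ :: Δ))
    (h₂ : Sound (.hyp none Q :: (invs Js ++ renameCtx f Γ))
      (boxAssigns (o.eqns ++ vs.map fun v => (v, .num 0)) ψ' :: renameAll f Δ))
    (h₃ : Sound (boxedInvs (.evolve o Q) ((x, ψ) :: Js) ++ Γ) (.box (.evolve o Q) φ :: Δ)) :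
    Sound (boxedInvs (.evolve o Q) Js ++ Γ) (.box (.evolve o Q) φ :: Δ) := by
  refine sound_cons_iff.2 fun ω hΓ hΔ => ?_
  have hJmem : ∀ j ∈ Js, Expr.box (.evolve o Q) j.2 ∈
      facts (boxedInvs (.evolve o Q) Js ++ Γ) := fun j hj => by
    simpa using .inl ⟨_, hj⟩
  have hΓmem : ∀ p ∈ facts Γ, p ∈ facts (boxedInvs (.evolve o Q) Js ++ Γ) := fun p hp => by
    simp [hp]
  suffices Sat (.box (.evolve o Q) ψ) ω by
    refine h₃.apply ?_ hΔ
    rw [facts_append, facts_boxedInvs, List.map_cons, List.cons_append, List.forall_mem_cons]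
    exact ⟨this, by simpa using hΓ⟩
  intro ν (hν : Run (.evolve o Q) ω ν)
  obtain ⟨T, hT, χ, hχ, hQ, rfl⟩ := (run_evolve _ _ _ _).1 hν
  have hrun : ∀ s ∈ Set.Icc 0 T, Run (.evolve o Q) ω (χ s) := fun s hs =>
    run_evolve_prefix hχ hQ hs
  have hJ : ∀ s ∈ Set.Icc 0 T, ∀ j ∈ Js, Sat j.2 (χ s) := fun s hs j hj =>
    hΓ _ (hJmem j hj) _ (hrun s hs)
  have h0 : (0 : ℝ) ∈ Set.Icc 0 T := ⟨le_rfl, hT⟩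
  have hzero : ∀ p : DL .fml, Disjoint o.evolvedPrimes p.vars → (Sat p (χ 0) ↔ Sat p ω) :=
    fun p hp => sat_congr p fun z hz => hχ.1.zero_eq hT (Finset.disjoint_right.1 hp hz)
  have hψ₀ : Sat ψ (χ 0) := by
    refine (hzero ψ hd.1).2 (h₁.apply ?_ hΔ)
    simp only [facts_append, facts_invs, List.forall_mem_append, List.forall_mem_map]
    exact ⟨fun j hj => (hzero j.2 (hd.2 j hj)).1 (hJ 0 h0 j hj), fun p hp => hΓ p (hΓmem p hp)⟩
  obtain ⟨hfv, hnames⟩ := dform_vars ψ rfl hψ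
  -- Variables of `ψ` that the system does not evolve are constant, so their differential variables
  -- must count as 0, whatever value the state gives them.
  refine dform_invariant (ν := fun s => zeroPrimes vs (χ s)) ψ rfl hψ
    (fun s hs => hr ω (χ s) hΓ hΔ (hrun s hs)) (fun s hs z hz => ?_) (fun s hs z hz => ?_)
    (fun s hs => ?_) hψ₀ ⟨hT, le_rfl⟩
  -- By `hd'` no prime of a variable of `ψ` occurs in `ψ`, so setting primes to zero does not
  -- disturb its variables.
  · refine if_neg ?_
    rintro ⟨v, hv', rfl⟩
    have := ((hv v).1 hv').1
    rw [hfv] at this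
    exact Finset.disjoint_left.1 hd' (Finset.mem_image_of_mem _ this) hz
  · have hzp : z ∉ o.evolvedPrimes := Finset.disjoint_right.1 hd.1 hz
    by_cases hze : z ∈ o.evolved
    · have : zeroPrimes vs (χ s) z.prime = χ s z.prime := by
        refine if_neg ?_
        rintro ⟨v, hv', e⟩
        rw [Var.prime_injective e] at hze
        exact ((hv v).1 hv').2 hze
      rw [this]
      exact hχ.1.hasDerivWithinAt hs hze
    · have : zeroPrimes vs (χ s) z.prime = 0 :=
        if_pos ⟨z, (hv z).2 ⟨hfv ▸ hz, hze⟩, rfl⟩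
      rw [this]
      exact hχ.1.hasDerivWithinAt_zero hs (by simp [mem_bv_ode, hzp, hze])
  -- Of the assignments in the premise, those for the equations are vacuous on the flow and the
  -- others produce exactly the state with zeroed primes.
  · rw [← sat_boxAssigns_zero, ← sat_boxAssigns_append (l := o.eqns)
      fun e he => hχ.1.prime_eq hs he]
    obtain ⟨κ, k₁, -, -, k₄⟩ := hf.elim (ω := ω) (ν := χ s) fun z hz =>
      run_eq (.evolve o Q) (hrun s hs) (name_notMem_bv hz)
    have hg : ∀ {q : DL .fml}, q.names ⊆ (Expr.box (.evolve o Q) φ).names →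
        ∀ n ∈ o.bv.image Var.name, f n ∉ q.names := fun hq =>
      hf.fresh_of_subset (q := .box (.evolve o Q) φ) (by simp) hq
    refine (k₁ _ fun n hn hmem => ?_).1.1
      (h₂.apply ?_ (forall_mem_renameAll.2 fun q hq hs => ?_))
    · obtain ⟨z, hz, hzn⟩ := Finset.mem_image.1 hmem
      have hgψ := hf.fresh_of_subset (p := ψ) (q := ψ) (by simp) subset_rfl n hn
      have hgo : ∀ y ∈ o.vars, y.name ≠ f n := fun y hy e =>
        hg subset_rfl n hn (Finset.mem_image.2
          ⟨y, Finset.mem_union_left _ (Finset.mem_union_left _ hy), e⟩)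
      rcases mem_vars_boxAssigns hz with hz | ⟨e, he, hz⟩
      · exact hgψ (hnames (hzn ▸ mem_names hz))
      · rcases List.mem_append.1 he with he | he
        · obtain ⟨-, e₁, e₂⟩ := vars_of_mem_eqns o e he
          exact hz.elim (fun h => hgo _ e₁ (h ▸ hzn)) fun h => hgo _ (e₂ h) hzn
        · obtain ⟨v, hv', rfl⟩ := List.mem_map.1 he
          have hvψ := ((hv v).1 hv').1
          rw [hfv] at hvψ
          rcases hz with rfl | hz
          · exact hgψ (hzn ▸ mem_names (z := v) hvψ)
          · simp [Expr.vars] at hz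
    · simp only [facts_hyp, facts_append, facts_invs, facts_renameCtx, List.forall_mem_cons,
        List.forall_mem_append, List.forall_mem_map]
      refine ⟨(k₁ Q (hg (names_mono ?_))).1.2 (hQ s hs), fun j hj => ?_, fun p hp => ?_⟩
      · exact Finset.subset_union_right.trans Finset.subset_union_left
      · exact (k₁ j.2 (hf.fresh_of_subset (.inl (hJmem j hj))
          (names_mono Finset.subset_union_right))).1.2 (hJ s hs j hj)
      · exact (k₁ p (hf.fresh_of_subset (.inl (hΓmem p hp)) subset_rfl)).2.2 (hΓ p (hΓmem p hp))
    · exact hΔ q hq ((k₁ q (hf.fresh_of_subset (q := q) (by simp [hq]) subset_rfl)).2.1 hs)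

theorem sound_finOde {Γ : Ctx} {H : Trace} {o : DL .ode} {Q φ : DL .fml} {Δ : List (DL .fml)}
    {f : Equiv.Perm ℕ} {Js : List (Ident × DL .fml)}
    (hf : Ghosting (o.bv.image Var.name) f (boxedInvs (.evolve o Q) Js ++ Γ) H
      (.box (.evolve o Q) φ :: Δ))
    (h : Sound (.hyp none Q :: (invs Js ++ renameCtx f Γ)) (φ :: renameAll f Δ)) :
    Sound (boxedInvs (.evolve o Q) Js ++ Γ) (.box (.evolve o Q) φ :: Δ) := by
  refine sound_cons_iff.2 fun ω hΓ hΔ ν (hν : Run (.evolve o Q) ω ν) => ?_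
  obtain ⟨κ, k₁, -, -, k₄⟩ := hf.elim (ω := ω) (ν := ν) fun z hz =>
    run_eq (.evolve o Q) hν (name_notMem_bv hz)
  have hQ : Sat Q ν := by
    obtain ⟨T, hT, χ, hχ, hQ, rfl⟩ := (run_evolve _ _ _ _).1 hν
    exact hQ T ⟨hT, le_rfl⟩
  have hg : ∀ {q : DL .fml}, q.names ⊆ (Expr.box (.evolve o Q) φ).names →
      ∀ n ∈ o.bv.image Var.name, f n ∉ q.names := fun hq =>
    hf.fresh_of_subset (q := .box (.evolve o Q) φ) (by simp) hq
  refine (k₁ φ (hg (names_mono Finset.subset_union_right))).1.1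
      (h.apply ?_ (forall_mem_renameAll.2 fun q hq hs => ?_))
  · simp only [facts_hyp, facts_append, facts_invs, facts_renameCtx, List.forall_mem_cons,
      List.forall_mem_append, List.forall_mem_map]
    refine ⟨(k₁ Q (hg (names_mono ?_))).1.2 hQ, fun j hj => ?_, fun p hp => ?_⟩
    · exact Finset.subset_union_right.trans Finset.subset_union_left
    · have hj' : Expr.box (.evolve o Q) j.2 ∈ facts (boxedInvs (.evolve o Q) Js ++ Γ) := by
        simpa using .inl ⟨_, hj⟩
      exact (k₁ j.2 (hf.fresh_of_subset (.inl hj')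
        (names_mono Finset.subset_union_right))).1.2 (hΓ _ hj' ν hν)
    · have hp' : p ∈ facts (boxedInvs (.evolve o Q) Js ++ Γ) := by simp [hp]
      exact (k₁ p (hf.fresh_of_subset (.inl hp') subset_rfl)).2.2 (hΓ p hp')
  · exact hΔ q hq ((k₁ q (hf.fresh_of_subset (q := q) (by simp [hq]) subset_rfl)).2.1 hs)

/-! Differential ghosts -/

/-- Linear differential equations with continuous coefficients have unique solutions. -/
theorem exists_linear_solution {A B : ℝ → ℝ} {T : ℝ} (hT : 0 ≤ T)
    (hA : ContinuousOn A (Set.Icc 0 T)) (hB : ContinuousOn B (Set.Icc 0 T)) (y₀ : ℝ) :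
    ∃ Y : ℝ → ℝ, Y 0 = y₀ ∧
      (∀ s ∈ Set.Icc 0 T, HasDerivWithinAt Y (A s * Y s + B s) (Set.Icc 0 T) s) ∧
      ∀ S ∈ Set.Icc 0 T, ∀ Z : ℝ → ℝ, Z 0 = y₀ →
        (∀ s ∈ Set.Icc 0 S, HasDerivWithinAt Z (A s * Z s + B s) (Set.Icc 0 S) s) →
        ∀ r ∈ Set.Icc 0 S, Z r = Y r := by
  -- The coefficients are extended continuously to the whole line, so that their integrals are
  -- differentiable everywhere, including at the endpoints.
  have hA' : Continuous (Set.IccExtend hT ((Set.Icc 0 T).domRestrict A)) :=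
    hA.domRestrict.Icc_extend'
  have hB' : Continuous (Set.IccExtend hT ((Set.Icc 0 T).domRestrict B)) :=
    hB.domRestrict.Icc_extend'
  have eA : ∀ s ∈ Set.Icc 0 T, Set.IccExtend hT ((Set.Icc 0 T).domRestrict A) s = A s :=
    fun s hs => Set.IccExtend_of_mem hT _ hs
  have eB : ∀ s ∈ Set.Icc 0 T, Set.IccExtend hT ((Set.Icc 0 T).domRestrict B) s = B s :=
    fun s hs => Set.IccExtend_of_mem hT _ hs
  set A' := Set.IccExtend hT ((Set.Icc 0 T).domRestrict A)
  set B' := Set.IccExtend hT ((Set.Icc 0 T).domRestrict B)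
  set E : ℝ → ℝ := fun s => ∫ r in (0 : ℝ)..s, A' r with hE_def
  have hE : ∀ s, HasDerivAt E (A' s) s := fun s => (hA'.integral_hasStrictDerivAt 0 s).hasDerivAt
  have hEc : Continuous E := continuous_iff_continuousAt.2 fun s => (hE s).continuousAt
  have hGc : Continuous fun r => Real.exp (-E r) * B' r := (hEc.neg.rexp).mul hB'
  set G : ℝ → ℝ := fun s => ∫ r in (0 : ℝ)..s, Real.exp (-E r) * B' r
  have hG : ∀ s, HasDerivAt G (Real.exp (-E s) * B' s) s := fun s =>
    (hGc.integral_hasStrictDerivAt 0 s).hasDerivAt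
  -- Variation of constants.
  have hY : ∀ s ∈ Set.Icc 0 T, HasDerivAt (fun s => Real.exp (E s) * (y₀ + G s))
      (A s * (Real.exp (E s) * (y₀ + G s)) + B s) s := by
    intro s hs
    refine (((hE s).exp).mul ((hG s).const_add y₀)).congr_deriv ?_
    have : Real.exp (E s) * Real.exp (-E s) = 1 := by rw [← Real.exp_add]; simp
    rw [eA s hs, eB s hs]
    linear_combination B s * this
  refine ⟨fun s => Real.exp (E s) * (y₀ + G s), by simp [E, G],
    fun s hs => (hY s hs).hasDerivWithinAt, fun S hS Z hZ₀ hZ r hr => ?_⟩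
  -- The difference of two solutions solves the homogeneous equation; multiplied by the integrating
  -- factor it has derivative 0, and it vanishes at time 0.
  have hW : ∀ s ∈ Set.Icc 0 S, HasDerivWithinAt
      (fun s => (Z s - Real.exp (E s) * (y₀ + G s)) * Real.exp (-E s)) 0 (Set.Icc 0 S) s := by
    intro s hs
    have hs' : s ∈ Set.Icc 0 T := ⟨hs.1, hs.2.trans hS.2⟩
    refine (((hZ s hs).sub (hY s hs').hasDerivWithinAt).mul
      ((hE s).neg.exp.hasDerivWithinAt)).congr_deriv ?_
    simp only [Pi.sub_apply, Pi.neg_apply]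
    rw [eA s hs']
    ring
  have h₁ := antitoneOn_of_hasDerivWithinAt hW (fun _ _ => le_rfl) hr
  have h₂ := antitoneOn_of_hasDerivWithinAt (fun s hs => (hW s hs).neg)
    (fun _ _ => by simp) hr
  simp only [Pi.neg_apply] at h₂
  have h₀ : (Z 0 - Real.exp (E 0) * (y₀ + G 0)) * Real.exp (-E 0) = 0 := by simp [E, G, hZ₀]
  have : (Z r - Real.exp (E r) * (y₀ + G r)) * Real.exp (-E r) = 0 := by
    apply le_antisymm <;> linarith
  exact sub_eq_zero.1 ((mul_eq_zero.1 this).resolve_right (Real.exp_ne_zero _))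

theorem flow_iff {o : DL .ode} {ω : State} {T : ℝ} {φ : ℝ → State} :
    Flow (field o) ω T φ ↔ (∀ p ∈ o.eqns, φ 0 p.1 = ω p.1) ∧ ∀ s ∈ Set.Icc 0 T,
      (∀ p ∈ o.eqns, φ s p.1.prime = val p.2 (φ s) ∧
        HasDerivWithinAt (fun r => φ r p.1) (val p.2 (φ s)) (Set.Icc 0 T) s) ∧
      ∀ z, z ∉ o.bv → φ s z = ω z := by
  rw [field_eq o rfl]
  simp only [Flow, List.forall_mem_map, mem_bv_iff o rfl]
  refine and_congr Iff.rfl (forall₂_congr fun s _ => and_congr Iff.rfl (forall_congr' fun z => ?_))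
  exact imp_congr_left (by push Not; rfl)

/-- Supplies the continuous coefficients for a linear ghost. Regularity makes the term
differentiable along the flow; differential variables of the system are excluded because the flow is
not known to be differentiable in them. -/
theorem continuousOn_val {o : DL .ode} {ω : State} {T : ℝ} {φ : ℝ → State} {a : DL .trm}
    (hφ : Flow (field o) ω T φ) (hd : Disjoint o.evolvedPrimes a.fv)
    (hr : ∀ s ∈ Set.Icc 0 T, Regular (φ s) a) :
    ContinuousOn (fun s => val a (φ s)) (Set.Icc 0 T) := by
  intro s hs
  obtain ⟨G, -, hG⟩ := exists_gradient a rfl (hr s hs)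
  refine (hG φ _ s (fun z => if z ∈ o.evolved then φ s z.prime else 0) rfl
    fun z hz => ?_).continuousWithinAt
  rw [← fv_trm] at hz
  have hzp := Finset.disjoint_right.1 hd hz
  by_cases hze : z ∈ o.evolved
  · simpa only [hze, if_true] using hφ.hasDerivWithinAt hs hze
  · simpa only [hze, if_false] using hφ.hasDerivWithinAt_zero hs (by simp [mem_bv_ode, hzp, hze])

/-- An evolution extended by a linear equation for a fresh variable. -/
theorem exists_ghost_flow {o : DL .ode} {ω : State} {T : ℝ} {χ : ℝ → State} {y : ℕ}
    {θ₁ a b : DL .trm} (hT : 0 ≤ T) (hχ : UniqueFlow (field o) ω T χ) (hy : y ∉ o.names)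
    (ha : y ∉ a.names) (hb : y ∉ b.names)
    (hca : ContinuousOn (fun s => val a (χ s)) (Set.Icc 0 T))
    (hcb : ContinuousOn (fun s => val b (χ s)) (Set.Icc 0 T))
    (hl : ∀ ω : State, val θ₁ ω = val a ω * ω ⟨y, 0⟩ + val b ω) (y₀ : ℝ) :
    ∃ φ : ℝ → State, UniqueFlow (field (.comma o (.deq ⟨y, 0⟩ θ₁)))
      (Function.update ω ⟨y, 0⟩ y₀) T φ ∧ ∀ s, ∀ z : Var, z.name ≠ y → φ s z = χ s z := by
  obtain ⟨Y, hY₀, hY, hYu⟩ := exists_linear_solution hT hca hcb y₀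
  -- `y` follows the solution of the linear equation with coefficients taken along `χ`, and `y'` its
  -- right-hand side.
  set φ : ℝ → State := fun s => Function.update (Function.update (χ s) ⟨y, 0⟩ (Y s)) ⟨y, 1⟩
    (val a (χ s) * Y s + val b (χ s)) with hφ_def
  have hφ : ∀ s, ∀ z : Var, z.name ≠ y → φ s z = χ s z := by
    intro s z hz
    have h₁ : z ≠ ⟨y, 0⟩ := by rintro rfl; exact hz rfl
    have h₂ : z ≠ ⟨y, 1⟩ := by rintro rfl; exact hz rfl
    simp [hφ_def, h₁, h₂]
  have hφ0 : ∀ s, φ s ⟨y, 0⟩ = Y s := fun s => by simp [hφ_def]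
  have hφ1 : ∀ s, φ s ⟨y, 1⟩ = val a (χ s) * Y s + val b (χ s) := fun s => by simp [hφ_def]
  have hω : ∀ z : Var, z.name ≠ y → Function.update ω ⟨y, 0⟩ y₀ z = ω z := fun z hz =>
    Function.update_of_ne (by rintro rfl; exact hz rfl) _ _
  have hname : ∀ {k : Kind} {e : DL k}, y ∉ e.names → ∀ z ∈ e.vars, z.name ≠ y := by
    rintro k e he z hz rfl
    exact he (mem_names hz)
  have hybv : ∀ z : Var, z.name = y → z ∉ o.bv := fun z hz h =>
    hname hy z (bv_subset_vars o h) hz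
  have hval : ∀ (e : DL .trm), y ∉ e.names → ∀ μ κ : State, (∀ z : Var, z.name ≠ y → μ z = κ z) →
      val e μ = val e κ := fun e he μ κ h => val_congr e fun z hz => h z (hname he z hz)
  have heq : ∀ p ∈ o.eqns, p.1.name ≠ y ∧ p.1.prime.name ≠ y ∧ y ∉ p.2.names := fun p hp => by
    obtain ⟨h₁, h₂, h₃⟩ := vars_of_mem_eqns o p hp
    exact ⟨hname hy _ h₁, hname hy _ h₂, fun h => hy (names_mono h₃ h)⟩
  have hθ : ∀ μ : State, ∀ s, (∀ z : Var, z.name ≠ y → μ z = χ s z) →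
      val θ₁ μ = val a (χ s) * μ ⟨y, 0⟩ + val b (χ s) := fun μ s h => by
    rw [hl, hval a ha μ _ h, hval b hb μ _ h]
  have hbv : ∀ z, z ∈ (Expr.comma o (.deq ⟨y, 0⟩ θ₁)).bv ↔
      z ∈ o.bv ∨ z = ⟨y, 0⟩ ∨ z = ⟨y, 1⟩ := fun z => by
    simp only [bv, Finset.mem_union, Finset.mem_insert, Finset.mem_singleton]
    rfl
  have hχ' := flow_iff.1 hχ.1
  refine ⟨φ, ⟨flow_iff.2 ⟨?_, fun s hs => ⟨?_, fun z hz => ?_⟩⟩, fun S hS ψ hψ r hr => ?_⟩, hφ⟩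
  · rintro p hp
    rcases List.mem_append.1 hp with hp | hp
    · rw [hφ 0 _ (heq p hp).1, hω _ (heq p hp).1, hχ'.1 p hp]
    · rw [List.mem_singleton.1 hp]
      simp [hφ0, hY₀]
  · rintro p hp
    rcases List.mem_append.1 hp with hp | hp
    · obtain ⟨e₁, e₂, e₃⟩ := heq p hp
      have := (hχ'.2 s hs).1 p hp
      rw [hval _ e₃ (φ s) (χ s) (hφ s), hφ s _ e₂]
      simpa only [hφ _ _ e₁] using this
    · rw [List.mem_singleton.1 hp]
      simp only
      rw [hθ (φ s) s (hφ s), hφ0]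
      exact ⟨hφ1 s, by simpa only [hφ0] using hY s hs⟩
  · simp only [hbv, not_or] at hz
    rw [Function.update_of_ne hz.2.1, ← hχ.1.eq_off_bv hs hz.1]
    simp [hφ_def, hz.2.1, hz.2.2]
  · have hψ' := flow_iff.1 hψ
    -- Uniqueness in two stages: without `y` a competitor solves the original system and so follows
    -- `χ`; its `y` then solves the same linear equation as `Y`.
    have hflow : Flow (field o) ω S fun r z => if z.name = y then ω z else ψ r z := by
      refine flow_iff.2 ⟨fun p hp => ?_, fun s hs => ⟨fun p hp => ?_, fun z hz => ?_⟩⟩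
      · rw [if_neg (heq p hp).1, hψ'.1 p (List.mem_append_left _ hp), hω _ (heq p hp).1]
      · obtain ⟨e₁, e₂, e₃⟩ := heq p hp
        have := (hψ'.2 s hs).1 p (List.mem_append_left _ hp)
        rw [hval _ e₃ (fun z => if z.name = y then ω z else ψ s z) (ψ s) fun z hz => if_neg hz]
        simpa only [e₁, e₂, if_false] using this
      · by_cases hzy : z.name = y
        · exact if_pos hzy
        · rw [if_neg hzy, ← hω z hzy]
          refine (hψ'.2 s hs).2 z ?_
          simp only [hbv, not_or]
          exact ⟨hz, by rintro rfl; exact hzy rfl, by rintro rfl; exact hzy rfl⟩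
    have hψχ : ∀ s ∈ Set.Icc 0 S, ∀ z : Var, z.name ≠ y → ψ s z = χ s z := fun s hs z hz => by
      have := congrFun (hχ.2 S hS _ hflow s hs) z
      simpa only [hz, if_false] using this
    have hmem : ((⟨y, 0⟩ : Var), θ₁) ∈ (Expr.comma o (.deq ⟨y, 0⟩ θ₁)).eqns :=
      List.mem_append_right _ (List.mem_singleton.2 rfl)
    have hZ : ∀ r ∈ Set.Icc 0 S, ψ r ⟨y, 0⟩ = Y r := by
      refine hYu S hS (fun s => ψ s ⟨y, 0⟩) ?_ fun s hs => ?_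
      · simpa using hψ'.1 _ hmem
      · have := ((hψ'.2 s hs).1 _ hmem).2
        rwa [hθ (ψ s) s (hψχ s hs)] at this
    funext z
    by_cases hz : z.name = y
    · by_cases hz0 : z = ⟨y, 0⟩
      · rw [hz0, hZ r hr, hφ0]
      · by_cases hz1 : z = ⟨y, 1⟩
        · have := ((hψ'.2 r hr).1 _ hmem).1
          rw [hθ (ψ r) r (hψχ r hr), hZ r hr] at this
          rw [hz1, hφ1]
          exact this
        -- Higher differential variables of `y` belong to no equation and keep their initial values.
        · rw [(hψ'.2 r hr).2 z (by simp [hbv, hz0, hz1, hybv z hz]), Function.update_of_ne hz0]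
          rw [← hχ.1.eq_off_bv (s := r) ⟨hr.1, hr.2.trans hS.2⟩ (hybv z hz)]
          simp [hφ_def, hz0, hz1]
    · rw [hψχ r hr z hz, hφ r z hz]

/-- Linearity in `y` rules out blow-up, so the extended system runs as long as the original and
every original run lifts to one of the extended system. Starting it with `y` equal to `θ₀` meets the
added assumption, and the remaining formulas do not mention `y`. -/
theorem sound_ghostOde {Γ : Ctx} {H : Trace} {y : ℕ} {θ₁ θ₀ : DL .trm} {o : DL .ode}
    {Q φ : DL .fml} {Δ : List (DL .fml)} {Js : List (Ident × DL .fml)} {a b : DL .trm}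
    (hy : Fresh y (boxedInvs (.evolve o Q) Js ++ Γ) H (.box (.evolve o Q) φ :: Δ))
    (hy₀ : y ∉ θ₀.names)
    (hab : y ∉ a.names ∧ y ∉ b.names ∧ Disjoint o.evolvedPrimes a.fv ∧
      Disjoint o.evolvedPrimes b.fv)
    (hl : ∀ ω : State, val θ₁ ω = val a ω * ω ⟨y, 0⟩ + val b ω)
    (hr : RegularAlong (boxedInvs (.evolve o Q) Js ++ Γ) Δ (.evolve o Q) a ∧
      RegularAlong (boxedInvs (.evolve o Q) Js ++ Γ) Δ (.evolve o Q) b)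
    (h : Sound (.hyp none (.cmp .eq (.var ⟨y, 0⟩) θ₀) :: Γ)
      (.box (.evolve (.comma o (.deq ⟨y, 0⟩ θ₁)) Q) φ :: Δ)) :
    Sound (boxedInvs (.evolve o Q) Js ++ Γ) (.box (.evolve o Q) φ :: Δ) := by
  refine sound_cons_iff.2 fun ω hΓ hΔ ν (hν : Run (.evolve o Q) ω ν) => ?_
  obtain ⟨T, hT, χ, hχ, hQ, rfl⟩ := (run_evolve _ _ _ _).1 hν
  have hrun : ∀ s ∈ Set.Icc 0 T, Run (.evolve o Q) ω (χ s) := fun s hs =>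
    run_evolve_prefix hχ hQ hs
  have hg := hy.2.2 _ List.mem_cons_self
  have hg' : (Expr.box (.evolve o Q) φ).names = o.names ∪ Q.names ∪ φ.names := by
    simp [names, Expr.vars, Finset.image_union]
  simp only [hg', Finset.mem_union, not_or] at hg
  obtain ⟨κ, hκ, hκχ⟩ := exists_ghost_flow hT hχ hg.1.1 hab.1 hab.2.1
    (continuousOn_val hχ.1 hab.2.2.1 fun s hs => hr.1 ω _ hΓ hΔ (hrun s hs))
    (continuousOn_val hχ.1 hab.2.2.2 fun s hs => hr.2 ω _ hΓ hΔ (hrun s hs)) hl (val θ₀ ω)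
  have hsat : ∀ {p : DL .fml}, y ∉ p.names → ∀ s, Sat p (κ s) ↔ Sat p (χ s) := fun hp s =>
    sat_congr _ fun z hz => hκχ s z (by rintro rfl; exact hp (mem_names hz))
  have hup : ∀ {p : DL .fml}, y ∉ p.names →
      (Sat p (Function.update ω ⟨y, 0⟩ (val θ₀ ω)) ↔ Sat p ω) := fun hp =>
    sat_update (notMem_vars_of_name hp) _ _
  refine (hsat hg.2 T).1 (h.apply (ω := Function.update ω ⟨y, 0⟩ (val θ₀ ω)) ?_
    (fun q hq hs => hΔ q hq ((hup (hy.2.2 q (by simp [hq]))).1 hs)) _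
    ((run_evolve _ _ _ _).2 ⟨T, hT, κ, hκ, fun s hs => (hsat hg.1.2 s).2 (hQ s hs), rfl⟩))
  simp only [facts_hyp, List.forall_mem_cons]
  refine ⟨?_, fun p hp => ?_⟩
  · simp only [sat_cmp, Cmp.Holds, val_var, Function.update_self]
    exact val_congr _ fun z hz =>
      (Function.update_of_ne (by rintro rfl; exact hy₀ (mem_names hz)) _ _).symm
  · have hp' : p ∈ facts (boxedInvs (.evolve o Q) Js ++ Γ) := by simp [hp]
    exact (hup (hy.notMem_names_of_mem_facts hp')).2 (hΓ p hp')

/-! Solutions -/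

/-- In a term only differentials restrict a substitution. There it must fix every variable, so
replacing `t` by something other than `t` is admissible only if `t` is absent, and then any
replacement is. -/
theorem adm_single_of_ne {k : Kind} (e : DL k) (hk : k = .trm) {t : Var} {u θ : DL .trm}
    (hu : u ≠ .var t) (h : Adm (single t u) e) : Adm (single t θ) e := by
  induction e <;> cases hk
  case diff a _ =>
    intro z hz
    have := h z hz
    by_cases hzt : z = t
    · subst hzt
      simp [single, hu] at this
    · simp [single, hzt]
  all_goals first | exact Empty.elim ‹_› | trivial | skip
  case pow a q ih => exact ih rfl h
  all_goals
    rename_i h₁ h₂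
    exact ⟨h₁ rfl h.1, h₂ rfl h.2⟩

/-- Runs follow unique flows, so any solution described by `Y` is the actual flow; hence `Solution`
suffices for a box. The premise is used with the duration `T` stored in the fresh `t`: the domain
constraint along the flow becomes the bounded quantifier over `s`, and `Y` at time `t` gives the
final values. -/
theorem sound_solve {Γ Γ₃ : Ctx} {H : Trace} {xt xd : Ident} {o : DL .ode} {Q φ : DL .fml}
    {Δ : List (DL .fml)} {t s : ℕ} {Y : Var → DL .trm} (hΓ₃ : facts Γ₃ = facts Γ)
    (ht : Fresh t Γ H (.box (.evolve o Q) φ :: Δ)) (hs : Fresh s Γ H (.box (.evolve o Q) φ :: Δ))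
    (hst : s ≠ t)
    (hY : ∀ x ∈ o.evolved, s ∉ (Y x).names ∧ Adm (single ⟨t, 0⟩ (.var ⟨s, 0⟩)) (Y x))
    (hsol : Solution o ⟨t, 0⟩ Y) (hQ : Disjoint o.evolvedPrimes Q.vars)
    (hφ : Disjoint o.evolvedPrimes φ.vars)
    (haQ : Adm (atTime o ⟨t, 0⟩ Y (.var ⟨s, 0⟩)) Q)
    (haφ : Adm (atTime o ⟨t, 0⟩ Y (.var ⟨t, 0⟩)) φ)
    (h : Sound (.hyp (some xt) (.cmp .ge (.var ⟨t, 0⟩) (.num 0)) ::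
        .hyp (some xd) (upTo ⟨s, 0⟩ (.var ⟨t, 0⟩)
          (Q.subst (atTime o ⟨t, 0⟩ Y (.var ⟨s, 0⟩)))) :: Γ₃)
      (φ.subst (atTime o ⟨t, 0⟩ Y (.var ⟨t, 0⟩)) :: Δ)) :
    Sound Γ (.box (.evolve o Q) φ :: Δ) := by
  refine sound_cons_iff.2 fun ω hΓ hΔ ν (hν : Run (.evolve o Q) ω ν) => ?_
  obtain ⟨T, hT, χ, hχ, hQχ, rfl⟩ := (run_evolve _ _ _ _).1 hν
  obtain ⟨φ₀, hφ₀, hφY⟩ := hsol ω T hT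
  have hχY : ∀ x ∈ o.evolved, ∀ r ∈ Set.Icc 0 T,
      val (Y x) (Function.update ω ⟨t, 0⟩ r) = χ r x := fun x hx r hr => by
    rw [← hχ.2 T ⟨hT, le_rfl⟩ φ₀ hφ₀ r hr]
    exact (hφY x hx r hr).symm
  have hg' : (Expr.box (.evolve o Q) φ).names = o.names ∪ Q.names ∪ φ.names := by
    simp [names, Expr.vars, Finset.image_union]
  have htg := ht.2.2 _ List.mem_cons_self
  have hsg := hs.2.2 _ List.mem_cons_self
  simp only [hg', Finset.mem_union, not_or] at htg hsg
  have hoff : ∀ {p : DL .fml}, Disjoint o.evolvedPrimes p.vars → ∀ z ∈ p.vars, z ∉ o.evolved →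
      ∀ r ∈ Set.Icc 0 T, χ r z = ω z := fun hp z hz hze r hr =>
    hχ.1.eq_off_bv hr (by simp [mem_bv_ode, hze, Finset.disjoint_right.1 hp hz])
  have hup : ∀ {p : DL .fml}, t ∉ p.names →
      (Sat p (Function.update ω ⟨t, 0⟩ T) ↔ Sat p ω) := fun hp =>
    sat_update (notMem_vars_of_name hp) _ _
  have hφT := h.apply (ω := Function.update ω ⟨t, 0⟩ T) ?_
    (fun q hq hs => hΔ q hq ((hup (ht.2.2 q (by simp [hq]))).1 hs))
  · refine (sat_subst haφ fun z hz => ?_).1 hφT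
    unfold atTime
    split_ifs with hze
    · have hid : single ⟨t, 0⟩ (.var ⟨t, 0⟩) = Expr.var := by simp [single]
      rw [hid, subst_var, hχY z hze T ⟨hT, le_rfl⟩]
    · rw [hoff hφ z hz hze T ⟨hT, le_rfl⟩, val_var, Function.update_of_ne]
      rintro rfl
      exact htg.2 (mem_names hz)
  · simp only [facts_hyp, List.forall_mem_cons, hΓ₃]
    refine ⟨by simpa [Cmp.Holds] using hT, ?_, fun p hp =>
      (hup (ht.notMem_names_of_mem_facts hp)).2 (hΓ p hp)⟩
    have hts : (⟨t, 0⟩ : Var) ≠ ⟨s, 0⟩ := by simp [hst.symm]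
    simp only [upTo, sat_all, sat_imp, sat_and, sat_cmp, Cmp.Holds, val_num, val_var,
      Function.update_self, Function.update_of_ne hts, Rat.cast_zero]
    intro r hr
    refine (sat_subst haQ fun z hz => ?_).2 (hQχ r hr)
    unfold atTime
    split_ifs with hze
    · rw [val_subst_single (hY z hze).2, ← hχY z hze r hr]
      refine val_congr _ fun v hv => ?_
      by_cases hvt : v = ⟨t, 0⟩
      · simp [hvt]
      · have hvs : v ≠ ⟨s, 0⟩ := by
          rintro rfl
          exact (hY z hze).1 (mem_names hv)
        simp [hvt, hvs]
    · rw [hoff hQ z hz hze r hr, val_var, Function.update_of_ne, Function.update_of_ne]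
      · rintro rfl
        exact htg.1.2 (mem_names hz)
      · rintro rfl
        exact hsg.1.2 (mem_names hz)

/-- A diamond has to exhibit a run, so the solution must itself be unique. Its duration is the value
of `θ`, and the first premise says that this is nonnegative and that the domain constraint holds
until then. -/
theorem sound_dsolve {Γ Γ₂ : Ctx} {H : Trace} {θ : DL .trm} {o : DL .ode} {Q φ : DL .fml}
    {Δ : List (DL .fml)} {t s : ℕ} {Y : Var → DL .trm} (hΓ₂ : facts Γ₂ = facts Γ)
    (hs : Fresh s Γ H (.dia (.evolve o Q) φ :: Δ)) (hst : s ≠ t) (hθ : s ∉ θ.names ∧ t ∉ θ.names)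
    (hY : ∀ x ∈ o.evolved, s ∉ (Y x).names ∧ Adm (single ⟨t, 0⟩ (.var ⟨s, 0⟩)) (Y x))
    (hsol : UniqueSolution o ⟨t, 0⟩ Y) (hQ : Disjoint o.evolvedPrimes Q.vars)
    (hφ : Disjoint o.evolvedPrimes φ.vars)
    (haQ : Adm (atTime o ⟨t, 0⟩ Y (.var ⟨s, 0⟩)) Q)
    (haφ : Adm (atTime o ⟨t, 0⟩ Y θ) φ)
    (h₁ : Sound Γ (.and (.cmp .ge θ (.num 0))
      (upTo ⟨s, 0⟩ θ (Q.subst (atTime o ⟨t, 0⟩ Y (.var ⟨s, 0⟩)))) :: Δ))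
    (h₂ : Sound Γ₂ (φ.subst (atTime o ⟨t, 0⟩ Y θ) :: Δ)) :
    Sound Γ (.dia (.evolve o Q) φ :: Δ) := by
  refine sound_cons_iff.2 fun ω hΓ hΔ => ?_
  obtain ⟨hT, hup⟩ := h₁.apply hΓ hΔ
  replace hT : 0 ≤ val θ ω := by
    have : val θ ω ≥ ((0 : ℚ) : ℝ) := hT
    simpa using this
  replace hup : Sat (upTo ⟨s, 0⟩ θ (Q.subst (atTime o ⟨t, 0⟩ Y (.var ⟨s, 0⟩)))) ω := hup
  have hθs : ∀ r, val θ (Function.update ω ⟨s, 0⟩ r) = val θ ω := fun r =>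
    val_congr _ fun z hz =>
      Function.update_of_ne (by rintro rfl; exact hθ.1 (mem_names hz)) _ _
  simp only [upTo, sat_all, sat_imp, sat_and, sat_cmp, Cmp.Holds, val_num, val_var,
    Function.update_self, Rat.cast_zero, hθs] at hup
  obtain ⟨χ, hχ, hχY⟩ := hsol ω (val θ ω) hT
  replace hχ : UniqueFlow (field o) ω (val θ ω) χ := hχ
  replace hχY : ∀ x ∈ o.evolved, ∀ r ∈ Set.Icc 0 (val θ ω),
      χ r x = val (Y x) (Function.update ω ⟨t, 0⟩ r) := hχY
  have hoff : ∀ {p : DL .fml}, Disjoint o.evolvedPrimes p.vars → ∀ z ∈ p.vars, z ∉ o.evolved →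
      ∀ r ∈ Set.Icc 0 (val θ ω), χ r z = ω z := fun hp z hz hze r hr =>
    hχ.1.eq_off_bv hr (by simp [mem_bv_ode, hze, Finset.disjoint_right.1 hp hz])
  have hg' : (Expr.dia (.evolve o Q) φ).names = o.names ∪ Q.names ∪ φ.names := by
    simp [names, Expr.vars, Finset.image_union]
  have hsg := hs.2.2 _ List.mem_cons_self
  simp only [hg', Finset.mem_union, not_or] at hsg
  change ∃ ν, Run (.evolve o Q) ω ν ∧ Sat φ ν
  refine ⟨χ (val θ ω), (run_evolve _ _ _ _).2 ⟨val θ ω, hT, χ, hχ, fun r hr => ?_, rfl⟩, ?_⟩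
  · refine (sat_subst haQ fun z hz => ?_).1 (hup r hr)
    unfold atTime
    split_ifs with hze
    · rw [val_subst_single (hY z hze).2, hχY z hze r hr]
      refine val_congr _ fun v hv => ?_
      by_cases hvt : v = ⟨t, 0⟩
      · simp [hvt]
      · have hvs : v ≠ ⟨s, 0⟩ := by
          rintro rfl
          exact (hY z hze).1 (mem_names hv)
        simp [hvt, hvs]
    · rw [hoff hQ z hz hze r hr, val_var, Function.update_of_ne]
      rintro rfl
      exact hsg.1.2 (mem_names hz)
  · refine (sat_subst haφ fun z hz => ?_).1 (h₂.apply (by rwa [hΓ₂]) hΔ)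
    unfold atTime
    split_ifs with hze
    · have hne : (Expr.var ⟨s, 0⟩ : DL .trm) ≠ .var ⟨t, 0⟩ := by simp [hst]
      rw [val_subst_single (adm_single_of_ne (Y z) rfl hne (hY z hze).2),
        hχY z hze _ ⟨hT, le_rfl⟩]
    · rw [hoff hφ z hz hze _ ⟨hT, le_rfl⟩, val_var]

/-! Soundness of the checking judgment -/

/-- The rules already contain the expanded expressions, so validity of the premises, which does not
refer to the traces, is enough in every case. -/
theorem Checks.sound {Γ : Ctx} {H H' : Trace} {sp : SP} {Δ : List (DL .fml)}
    (h : Checks Γ H sp Δ H') : Sound Γ Δ := by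
  induction h with
  | implicit hi _ ih =>
    refine sound_cons_iff.2 fun ω hΓ hΔ => ?_
    exact (hi.sat_iff ω).2 (ih.apply hΓ hΔ)
  | sLet _ hm _ ih => exact fun ω hω => ih ω (by rwa [facts_pmatch hm])
  | flet _ _ _ ih => exact ih
  | note hf _ ih =>
    exact fun ω hω => ih ω (List.forall_mem_cons.2 ⟨hf.sat hω, hω⟩)
  | sHave _ _ _ ih₁ ih₂ =>
    exact fun ω hω => ih₂ ω (List.forall_mem_cons.2 ⟨ih₁.apply hω (by simp), hω⟩)
  | sShow _ _ h => exact h.sound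
  | state _ ih => exact ih
  | @focusL Γ₁ Γ₂ n _ _ _ φ _ Δ _ _ ih =>
    intro ω hω
    simp only [facts_append, facts_hyp, List.forall_mem_append, List.forall_mem_cons] at hω
    by_contra! hΔ
    exact ih.apply (by simpa [or_imp, forall_and] using And.intro hω.1 hω.2.2) hΔ hω.2.1
  | focusR _ _ ih =>
    intro ω hω
    obtain ⟨q, hq, hs⟩ := ih ω hω
    exact ⟨q, by simp at hq ⊢; tauto, hs⟩
  | assumeTest hm _ ih =>
    refine sound_cons_iff.2 fun ω hΓ hΔ => ?_
    rintro _ ⟨rfl, hψ⟩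
    rw [← facts_pmatch hm] at hΓ
    exact ih.apply (List.forall_mem_cons.2 ⟨hψ, hΓ⟩) hΔ
  | assumeImp hm _ ih =>
    refine sound_cons_iff.2 fun ω hΓ hΔ hψ => ?_
    rw [← facts_pmatch hm] at hΓ
    exact ih.apply (List.forall_mem_cons.2 ⟨hψ, hΓ⟩) hΔ
  | caseAnd hm _ _ ih₁ ih₂ =>
    refine sound_cons_iff.2 fun ω hΓ hΔ => ?_
    rw [← facts_pmatch hm] at hΓ
    exact ⟨ih₁.apply hΓ hΔ, ih₂.apply hΓ hΔ⟩
  | caseOr hm _ ih =>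
    refine sound_cons_iff.2 fun ω hΓ hΔ => ?_
    rw [← facts_pmatch hm] at hΓ
    rw [sat_or]
    by_contra! hφ
    exact hφ.1 (ih.apply hΓ (List.forall_mem_cons.2 ⟨hφ.2, hΔ⟩))
  | caseIff hm _ _ ih₁ ih₂ =>
    refine sound_cons_iff.2 fun ω hΓ hΔ => ?_
    rw [← facts_pmatch hm] at hΓ
    exact ⟨fun hφ => ih₁.apply (List.forall_mem_cons.2 ⟨hφ, hΓ⟩) hΔ,
      fun hψ => ih₂.apply (List.forall_mem_cons.2 ⟨hψ, hΓ⟩) hΔ⟩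
  | boxSub _ ha _ ih =>
    refine sound_cons_iff.2 fun ω hΓ hΔ => ?_
    rintro _ rfl
    exact (sat_subst_single ha ω).1 (ih.apply hΓ hΔ)
  | boxEq _ hf _ ih => exact sound_boxEq (.inl rfl) hf ih
  | boxAny hf _ ih => exact sound_boxAny hf ih
  | diaSub _ ha _ ih =>
    refine sound_cons_iff.2 fun ω hΓ hΔ => ?_
    exact ⟨_, rfl, (sat_subst_single ha ω).1 (ih.apply hΓ hΔ)⟩
  | diaEq _ hf _ ih => exact sound_boxEq (.inr rfl) hf ih
  | diaAny _ ha _ ih =>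
    refine sound_cons_iff.2 fun ω hΓ hΔ => ?_
    exact ⟨_, ⟨_, rfl⟩, (sat_subst_single ha ω).1 (ih.apply hΓ hΔ)⟩
  | boxChoice hp hq _ _ ih₁ ih₂ =>
    refine sound_cons_iff.2 fun ω hΓ hΔ => ?_
    rintro ν (hν | hν)
    · exact ih₁.apply (by rwa [facts_pmatch hp]) hΔ ν hν
    · exact ih₂.apply (by rwa [facts_pmatch hq]) hΔ ν hν
  | boxAnd hp hq _ _ ih₁ ih₂ =>
    refine sound_cons_iff.2 fun ω hΓ hΔ ν hν => ?_
    exact ⟨ih₁.apply (by rwa [facts_pmatch hp]) hΔ ν hν,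
      ih₂.apply (by rwa [facts_pmatch hq]) hΔ ν hν⟩
  | @boxIter _ _ _ _ _ _ _ _ a φ _ _ _ hp hq _ _ ih₁ ih₂ =>
    refine sound_cons_iff.2 fun ω hΓ hΔ ν hν => ?_
    replace hν : Relation.ReflTransGen (Run a) ω ν := hν
    rcases hν.cases_head with rfl | ⟨μ, h₁, h₂⟩
    · exact ih₁.apply (by rwa [facts_pmatch hp]) hΔ
    · exact ih₂.apply (by rwa [facts_pmatch hq]) hΔ μ h₁ ν h₂
  | @diaChoice _ _ _ _ _ _ _ a b φ _ _ _ _ _ ih =>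
    refine sound_cons_iff.2 fun ω hΓ hΔ => ?_
    by_cases hb : Sat (.dia b φ) ω
    · obtain ⟨ν, hν, hs⟩ := hb
      exact ⟨ν, .inr hν, hs⟩
    · obtain ⟨ν, hν, hs⟩ := ih.apply hΓ (List.forall_mem_cons.2 ⟨hb, hΔ⟩)
      exact ⟨ν, .inl hν, hs⟩
  | @diaIter _ _ _ _ _ _ _ a φ _ _ _ hq _ ih =>
    refine sound_cons_iff.2 fun ω hΓ hΔ => ?_
    rw [← facts_pmatch hq] at hΓ
    by_cases hb : Sat (.dia a (.dia (.star a) φ)) ω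
    · obtain ⟨ν, hν, μ, hμ, hs⟩ := hb
      exact ⟨μ, Relation.ReflTransGen.head (r := Run a) hν hμ, hs⟩
    · exact ⟨ω, .refl, ih.apply hΓ (List.forall_mem_cons.2 ⟨hb, hΔ⟩)⟩
  | boxAfter _ hf _ _ ih₁ ih₂ => exact sound_boxAfter hf ih₁ ih₂
  | diaAfter _ hf _ _ ih₁ ih₂ => exact sound_diaAfter hf ih₁ ih₂
  | invLoop _ hf _ _ _ ih₁ ih₂ ih₃ => exact sound_invLoop hf ih₁ ih₂ ih₃
  | finLoop hf _ ih => exact sound_finLoop hf ih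
  | con _ hx hf hfx ha _ _ _ ih₁ ih₂ ih₃ => exact sound_con hx hf hfx ha ih₁ ih₂ ih₃
  | invOde _ hψ hf hd hd' hr hv _ _ _ ih₁ ih₂ ih₃ =>
    exact sound_invOde hψ hf hd hd' hr hv ih₁ ih₂ ih₃
  | finOde hf _ ih => exact sound_finOde hf ih
  | ghostOde _ _ hy hy₀ hab hl hr _ ih => exact sound_ghostOde hy hy₀ hab hl hr ih
  | solve hm₁ hm₂ hm₃ ht hs hst hY hsol hQ hφ haQ haφ _ ih =>
    exact sound_solve ((facts_pmatch hm₃).trans ((facts_pmatch hm₂).trans (facts_pmatch hm₁)))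
      ht hs hst hY hsol hQ hφ haQ haφ ih
  | dsolve hm₁ hm₂ _ _ hs hst hθ hY hsol hQ hφ haQ haφ _ _ ih₁ ih₂ =>
    exact sound_dsolve ((facts_pmatch hm₂).trans (facts_pmatch hm₁))
      hs hst hθ hY hsol hQ hφ haQ haφ ih₁ ih₂

/-! Nominalization -/

theorem fv_embed {k : Kind} (e : DL k) (hk : k = .trm) : e.embed.fv = e.fv := by
  unfold embed
  induction e <;> cases hk
  all_goals first | exact Empty.elim ‹_› | simp_all [trav, fv]

/-- No state names occur in dL, so the interpretation is never consulted. Differentials sum over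
free variables, which is where `fv_embed` enters. -/
theorem denh_embed (I : Interp) {k : Kind} (e : DL k) : denh I e.embed = den e := by
  induction e
  case diff a ih =>
    have e : (Expr.diff a).embed = .diff a.embed := rfl
    rw [e]
    funext ω
    change ∑ x ∈ a.embed.fv, deriv (fun r => denh I a.embed (Function.update ω x r)) (ω x) *
      ω x.prime = _
    rw [fv_embed a rfl, ih]
    rfl
  case leaf => exact Empty.elim ‹_›
  case un => exact Empty.elim ‹_›
  case bin => exact Empty.elim ‹_›
  all_goals
    simp only [denh, den, embed] at *
    simp only [trav, sem, id]
    first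
      | rfl
      | (simp only [*]; done)
      | (simp only [*]; rfl)

/-- The runs of a program that may be absent. -/
def RunRest : Option (DL .prg) → State → State → Prop
  | none, ω, ν => ω = ν
  | some a, ω, ν => Run a ω ν

/-- `uncons` reassociates sequences to the right, and composition of relations is associative. -/
theorem run_uncons (a : DL .prg) (ω ν : State) :
    Run a ω ν ↔ ∃ μ, Run (uncons a).1 ω μ ∧ RunRest (uncons a).2 μ ν := by
  suffices ∀ {k : Kind} (e : DL k) (hk : k = .prg) (ω ν : State),
      Run (hk ▸ e) ω ν ↔ ∃ μ, Run (uncons (hk ▸ e)).1 ω μ ∧ RunRest (uncons (hk ▸ e)).2 μ ν from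
    this a rfl ω ν
  intro k e hk
  induction e <;> cases hk
  case seq a b iha _ =>
    intro ω ν
    change Run (.seq a b) ω ν ↔
      ∃ μ, Run (uncons (.seq a b)).1 ω μ ∧ RunRest (uncons (.seq a b)).2 μ ν
    rw [uncons, run_seq]
    change _ ↔ ∃ μ, Run (uncons a).1 ω μ ∧ Run ((uncons a).2.elim b fun c => .seq c b) μ ν
    have iha : ∀ ω ν, Run a ω ν ↔ ∃ μ, Run (uncons a).1 ω μ ∧ RunRest (uncons a).2 μ ν :=
      iha rfl
    simp only [iha]
    rcases (uncons a).2 with _ | c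
    · simp [RunRest]
    · simp only [RunRest, Option.elim_some, run_seq]
      grind
  all_goals
    intro ω ν
    simp [uncons, RunRest, eq_comm]

theorem runRest_of_rest {I : Interp} {o : Option (DL .prg)} {ω ν : State}
    (h : denh I (rest o) ω ν) : RunRest o ω ν := by
  cases o with
  | none => exact h.1
  | some a =>
    rw [rest, denh_embed] at h
    exact h

/-- Nominalization only adds tests: every run of the result is a run of the program. -/
theorem runRest_of_nomRest {I : Interp} (sp : SP) {o : Option (DL .prg)} {ω ν : State}
    (h : denh I (nomRest sp o) ω ν) : RunRest o ω ν := by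
  -- Shared by all clauses that keep the first component of the program and nominalize the rest.
  have hseq : ∀ {a : DL .prg} {sp : SP} {c : DL .prg} {r : Option (DL .prg)} {ω ν : State},
      (∀ {o : Option (DL .prg)} {ω ν : State}, denh I (nomRest sp o) ω ν → RunRest o ω ν) →
      uncons a = (c, r) → denh I (.seq (embed c) (nomRest sp r)) ω ν →
      RunRest (some a) ω ν := by
    rintro a sp c r ω ν ih hu ⟨μ, h₁, h₂⟩
    refine (run_uncons a ω ν).2 ⟨μ, ?_, ?_⟩
    · rw [hu]
      have : denh I (embed c) ω μ := h₁
      rwa [denh_embed] at this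
    · rw [hu]
      exact ih h₂
  induction sp generalizing o ω ν with
  | state t sp ih =>
    obtain ⟨μ, ⟨rfl, -⟩, h⟩ := h
    exact ih h
  | sHave _ _ _ _ _ ih => exact ih h
  | sLet _ _ _ ih => exact ih h
  | flet _ _ _ _ ih => exact ih h
  | note _ _ _ ih => exact ih h
  | inv _ _ _ _ _ _ _ ih => exact ih h
  | ghost _ _ _ _ ih => exact ih h
  | after e sp₁ sp₂ ih₁ ih₂ =>
    rcases o with _ | a
    · exact runRest_of_rest h
    · cases a
      case seq b c =>
        rw [nomRest] at h
        obtain ⟨μ, h₁, h₂⟩ := h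
        exact ⟨μ, ih₁ (o := some b) h₁, ih₂ (o := some c) h₂⟩
      all_goals
        rw [nomRest] at h
        · obtain ⟨μ, h₁, h₂⟩ := h
          -- No program is left for the second proof, so its part consists of tests and cannot move
          -- the state.
          have e : μ = ν := ih₂ (o := none) h₂
          exact e ▸ ih₁ (o := some _) h₁
        · simp
  | _ =>
    first
      | exact runRest_of_rest h
      | cases o with
        | none => exact runRest_of_rest h
        | some a =>
          rename_i ih
          rw [nomRest] at h
          split at h
          all_goals first
            | exact runRest_of_rest (o := some a) h
            | exact hseq ih ‹_› h

end Kaisar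

/-! ### Soundness of nominalization -/

theorem mainTheorem6 (Γ : Kaisar.Ctx) (H H' : Kaisar.Trace) (sp : Kaisar.SP)
    (α : Kaisar.DL .prg) (φ : Kaisar.DL .fml)
    (h : Kaisar.Checks Γ H sp [.box α φ] H') (η : Kaisar.DynTrace) :
    Kaisar.ValidH (Kaisar.interp η) ((Kaisar.facts Γ).map Kaisar.Expr.embed)
      [.box (Kaisar.nom α sp) φ.embed] := by
  intro ω hω
  refine ⟨_, List.mem_singleton.2 rfl, fun ν hν => ?_⟩
  -- The nominalized run is a run of `α`, and `[α]φ` holds in `ω` because the proof checks.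
  have hφ : Kaisar.Sat φ ν := by
    refine h.sound.apply (ω := ω) (fun p hp => ?_) (by simp) ν
      (Kaisar.runRest_of_nomRest (o := some α) sp hν)
    have := hω _ (List.mem_map_of_mem hp)
    rwa [Kaisar.denh_embed] at this
  change Kaisar.denh _ φ.embed ν
  rw [Kaisar.denh_embed]
  exact hφ
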